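/- **Proposition 1.6.** Let $Q=(\mathbb{R}^n\setminus B_1)\times[0,1]$, where $B_1$ is the open unit ball centred at $0$. There is an absolute constant $c>0$ such that the following holds. For every $n$ and all $\Lambda\ge\lambda>0$ there is a constant $E_0=E_0(n,\Lambda,\lambda)>0$ such that for all $M>0$ and $0<E<E_0$ there is $\beta=\beta(n,\Lambda,\lambda,M,E)\ge 1$ with the following property. Let $\mathbf A=(a^{ij})$ be a real symmetric $n\times n$ matrix function on $Q$ with locally Lipschitz entries such that $$\lambda|\xi|^2\le\sum_{i,j}a^{ij}(x,t)\xi_i\xi_j\le\Lambda|\xi|^2\qquad\text{for all }(x,t)\in Q,\ \xi\in\mathbb{R}^n,$$ and, for all $i,j$ and almost every $(x,t)\in Q$, $$|\nabla_xa^{ij}(x,t)|+|\partial_ta^{ij}(x,t)|\le M,\qquad |\nabla_xa^{ij}(x,t)|\le\frac{E}{|x|}.$$ (Entries that are differentiable at every point of $Q$ with these bounds everywhere are included.) Put $$Pv=\partial_tv+\sum_{i,j}\partial_i(a^{ij}\partial_jv),\qquad f(t)=(t+1)^{-\beta}-2^{-\beta},\qquad b=\frac1{16\Lambda}.$$ Then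 for every real-valued $v\in C_0^\infty(Q)$ (that is, $v$ is smooth on $\mathbb{R}^n\times[0,1]$ up to $t=0$ and $t=1$, and vanishes outside a compact subset of $Q$; it need not vanish at $t=0$ or $t=1$) and every $\gamma>0$, $$\begin{aligned}\int_Q e^{2\gamma f|x|^{3/2}-\frac{b|x|^2+\beta}{t+1}}\left(|v|^2+|\nabla v|^2\right)dx\,dt\le{}&\int_Q e^{2\gamma f|x|^{3/2}-\frac{b|x|^2+\beta}{t+1}}|Pv|^2\,dx\,dt\\&+c\int_{\mathbb{R}^n}|x|^2e^{-\frac{b|x|^2}{2}}\left(|v(x,1)|^2+|\nabla v(x,1)|^2\right)dx\\&+c(1+\gamma)^2\int_{\mathbb{R}^n}|x|^2e^{2\gamma|x|^{3/2}-b|x|^2}|v(x,0)|^2\,dx,\end{aligned}$$ where $\nabla$ denotes the gradient in $x$. -/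

import Mathlib

open MeasureTheory Set
open scoped ContDiff

noncomputable section

namespace ExteriorCarleman

/-- Points `(x, t)` of space-time, `x ∈ ℝⁿ` with the Euclidean norm. -/
abbrev SpaceTime (n : ℕ) : Type := EuclideanSpace ℝ (Fin n) × ℝ

/-- The exterior cylinder `Q = (ℝⁿ ∖ B₁) × [0, 1]`, with `B₁` the open unit ball about `0`. -/
def cylinder (n : ℕ) : Set (SpaceTime n) :=
  (Metric.ball (0 : EuclideanSpace ℝ (Fin n)) 1)ᶜ ×ˢ Icc (0 : ℝ) 1

/-- The gradient in the space variable, `∇ₓ w (x, t)`. -/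
def spaceGrad {n : ℕ} (w : SpaceTime n → ℝ) (p : SpaceTime n) : EuclideanSpace ℝ (Fin n) :=
  gradient (fun y => w (y, p.2)) p.1

/-- The partial derivative `∂ᵢ w (x, t)` in the `i`-th space variable. -/
def spaceDeriv {n : ℕ} (i : Fin n) (w : SpaceTime n → ℝ) (p : SpaceTime n) : ℝ :=
  lineDeriv ℝ (fun y => w (y, p.2)) p.1 (EuclideanSpace.single i (1 : ℝ))

/-- The partial derivative `∂ₜ w (x, t)`. -/
def timeDeriv {n : ℕ} (w : SpaceTime n → ℝ) (p : SpaceTime n) : ℝ :=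
  deriv (fun s => w (p.1, s)) p.2

/-- The backward parabolic operator `P v = ∂ₜ v + ∑ᵢ ∂ᵢ (∑ⱼ aⁱʲ ∂ⱼ v)`. -/
def backwardOp {n : ℕ} (a : SpaceTime n → Matrix (Fin n) (Fin n) ℝ) (v : SpaceTime n → ℝ)
    (p : SpaceTime n) : ℝ :=
  timeDeriv v p + ∑ i, spaceDeriv i (fun q => ∑ j, a q i j * spaceDeriv j v q) p

/-- The assumptions on the coefficients, all of them on `Q` only: symmetry, ellipticity with
constants `lam ≤ Λ`, and (locally) Lipschitz entries whose first derivatives, which exist almost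
everywhere, satisfy `|∇ₓ aⁱʲ| + |∂ₜ aⁱʲ| ≤ M` and `|∇ₓ aⁱʲ| ≤ E / |x|`. Coefficients that are
differentiable at every point of `Q` with these bounds are a special case. -/
structure IsCoefficient {n : ℕ} (Λ lam M E : ℝ)
    (a : SpaceTime n → Matrix (Fin n) (Fin n) ℝ) : Prop where
  symm : ∀ p ∈ cylinder n, (a p).IsSymm
  lower : ∀ p ∈ cylinder n, ∀ ξ : EuclideanSpace ℝ (Fin n),
    lam * ‖ξ‖ ^ 2 ≤ ∑ i, ∑ j, a p i j * ξ i * ξ j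
  upper : ∀ p ∈ cylinder n, ∀ ξ : EuclideanSpace ℝ (Fin n),
    ∑ i, ∑ j, a p i j * ξ i * ξ j ≤ Λ * ‖ξ‖ ^ 2
  lipschitz : ∀ i j, LocallyLipschitzOn (cylinder n) (fun p => a p i j)
  deriv_le : ∀ i j, ∀ᵐ p ∂(volume.restrict (cylinder n)),
    ‖spaceGrad (fun q => a q i j) p‖ + |timeDeriv (fun q => a q i j) p| ≤ M
  grad_le : ∀ i j, ∀ᵐ p ∂(volume.restrict (cylinder n)),
    ‖spaceGrad (fun q => a q i j) p‖ ≤ E / ‖p.1‖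

/-- `v ∈ C₀^∞(Q)`: a function on `ℝⁿ × [0, 1]`, smooth up to `t = 0` and `t = 1` (that is, the
restriction of a smooth function on `ℝⁿ × ℝ`), which vanishes outside a compact subset of `Q`.
It need not vanish at `t = 0` or `t = 1`; the values of `v` for `t ∉ [0, 1]` are irrelevant. -/
def IsTestFunction {n : ℕ} (v : SpaceTime n → ℝ) : Prop :=
  ContDiff ℝ ∞ v ∧
    ∃ K : Set (SpaceTime n), IsCompact K ∧ K ⊆ cylinder n ∧
      ∀ p : SpaceTime n, p.2 ∈ Icc (0 : ℝ) 1 → p ∉ K → v p = 0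

/-- The time factor `f(t) = (t + 1)^{-β} - 2^{-β}`. -/
def timeFactor (β t : ℝ) : ℝ := (t + 1) ^ (-β) - 2 ^ (-β)

/-- The weight `exp (2 γ f(t) |x|^{3/2} - (b |x|² + β) / (t + 1))`. -/
def weight {n : ℕ} (b β γ : ℝ) (p : SpaceTime n) : ℝ :=
  Real.exp (2 * γ * timeFactor β p.2 * ‖p.1‖ ^ (3 / 2 : ℝ)
    - (b * ‖p.1‖ ^ 2 + β) / (p.2 + 1))

end ExteriorCarleman

end

/-! The method is Carleman's. Let `φ` be half the exponent of the weight, `u = e^φ v`, `U = ∇u`, `V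
= A∇φ` and `q = A∇φ·∇φ - ∂ₜφ`. For any multiplier `h`, `e^φ Pv = K + Z + r u`, where `K = ∂ₜu - 2
V·U - h u`, `Z = div(AU) + q u`, `r = h - div V`. Completing squares gives `|e^φ Pv|² ≥ 2KZ - r²u²`,
and `conjugated_identity` writes `2KZ` as the divergence of a flux, plus the time derivative of an
energy, plus a quadratic form in `U` and `u`. Everything rests on this form dominating `r²u²` and
the weighted norm of `v` and `∇v`: this is `commutator_lower`, which yields `pointwise_carleman`.

Here `∇φ = μ x` with `μ = α - b/(t+1)` and `α = (3/2) γ f |x|^{-1/2}`. Positivity has three sources.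
Convexity of `|x|^{3/2}` gives terms of size `α|U|²` and `α³|x|²u²`; the errors from `∇A` have the
same order in `α` and are absorbed because `E` is small. The rapid decay of `f` gives terms in `αα₁`
and `α₂`, where `α₁ = -∂ₜα` and `α₂ = ∂ₜ²α`; since `α₁ ≥ βα/2` and `α₂ ≥ βα₁/2`, a large `β` beats
what is of lower order in `α`. Where `α` is small, as near `t = 1`, a shift `k/(t+1)` in `h`
supplies `k|U|²` and `k(b|x|²+β)u²`, and `b = 1/(16Λ)` keeps the losses from the concave Gaussian
part below these gains. Thus `k` is chosen first and `β` afterwards.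

The natural multiplier `div V` contains derivatives of `A`, while `∇h` enters the form and `A` is
only Lipschitz. So `h` keeps only the part of `div V` that is free of derivatives of `A` and comes
from `α`.

The pointwise inequality holds almost everywhere, by Rademacher's theorem, and is integrated over an
annulus containing the support. The flux vanishes on the lateral boundary. The energy at `t = 0` and
`t = 1` gives the two boundary integrals, where a factor `e^{-β/2}` of the weight absorbs every
constant (`neg_energy_one_le`, `energy_zero_le`); hence `c = 1` suffices. -/

namespace ExteriorCarleman

open Topology
open scoped NNReal

/-! ### Integration by parts for Lipschitz functions on a cylinder. -/

section LipschitzIntegration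

/-- A Lipschitz function on a closed set, vanishing on its frontier, extends by zero. -/
theorem lipschitzWith_indicator {E : Type*} [NormedAddCommGroup E] [NormedSpace ℝ E]
    {S : Set E} (hS : IsClosed S) {f : E → ℝ} {C : ℝ≥0} (hf : LipschitzOnWith C f S)
    (h0 : ∀ z ∈ frontier S, f z = 0) : LipschitzWith C (S.indicator f) := by
  have key : ∀ x ∈ S, ∀ y ∉ S, dist (f x) 0 ≤ C * dist x y := by
    intro x hx y hy
    -- A segment that leaves `S` crosses its frontier: otherwise the open sets `interior S` and `Sᶜ`
    -- would disconnect it. Comparing at the crossing point needs no convexity of `S`.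
    have hz : ∃ z ∈ segment ℝ x y, z ∈ frontier S := by
      by_contra! hcon
      have hconn : IsPreconnected (segment ℝ x y) := (convex_segment x y).isPreconnected
      have hsub : segment ℝ x y ⊆ interior S ∪ Sᶜ := by
        intro z hz
        by_cases hzS : z ∈ S
        · left
          by_contra hni
          exact hcon z hz (by rw [frontier, hS.closure_eq]; exact ⟨hzS, hni⟩)
        · exact Or.inr hzS
      have hxi : x ∈ interior S := by
        rcases hsub (left_mem_segment ℝ x y) with h | h
        · exact h
        · exact absurd hx h
      obtain ⟨z, -, hz1, hz2⟩ := hconn _ _ isOpen_interior hS.isOpen_compl hsub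
        ⟨x, left_mem_segment ℝ x y, hxi⟩ ⟨y, right_mem_segment ℝ x y, hy⟩
      exact hz2 (interior_subset hz1)
    obtain ⟨z, hz, hzf⟩ := hz
    have h1 := hf.dist_le_mul x hx z (hS.frontier_subset hzf)
    rw [h0 z hzf] at h1
    have h2 : dist x z ≤ dist x y := by
      have := dist_add_dist_of_mem_segment hz
      linarith [dist_nonneg (x := z) (y := y)]
    exact h1.trans (by gcongr)
  refine LipschitzWith.of_dist_le_mul fun x y => ?_
  by_cases hx : x ∈ S <;> by_cases hy : y ∈ S
  · simpa [hx, hy] using hf.dist_le_mul x hx y hy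
  · simpa [hx, hy] using key x hx y hy
  · have := key y hy x hx
    rw [dist_comm y x] at this
    simpa [hx, hy, dist_comm] using this
  · simp [hx, hy]; positivity

variable {n : ℕ} {S : Set (EuclideanSpace ℝ (Fin n))} {f : SpaceTime n → ℝ} {C : ℝ≥0}

theorem volume_frontier_cylinder (hS0 : volume (frontier S) = 0) :
    volume (frontier (S ×ˢ Icc (0 : ℝ) 1)) = 0 := by
  rw [frontier_prod_eq, Measure.volume_eq_prod]
  refine measure_union_null ?_ ?_
  · rw [Measure.prod_prod, frontier_Icc zero_le_one,
      (Set.toFinite ({0, 1} : Set ℝ)).measure_zero, mul_zero]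
  · rw [Measure.prod_prod, hS0, zero_mul]

theorem ae_mem_interior (hS0 : volume (frontier S) = 0) :
    ∀ᵐ p ∂(volume.restrict (S ×ˢ Icc (0 : ℝ) 1)), p ∈ interior (S ×ˢ Icc (0 : ℝ) 1) := by
  refine ae_restrict_of_ae_restrict_of_subset subset_closure ?_
  rw [ae_restrict_iff' isClosed_closure.measurableSet]
  have := measure_eq_zero_iff_ae_notMem.1 (volume_frontier_cylinder hS0)
  filter_upwards [this] with p hp hpc
  by_contra hni
  exact hp ⟨hpc, hni⟩

/-- Rademacher's theorem gives differentiability within the set. The frontier is null, so almost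
every point is interior, where this is full differentiability. -/
theorem ae_differentiableAt_of_lipschitzOn (hS0 : volume (frontier S) = 0)
    (hf : LipschitzOnWith C f (S ×ˢ Icc (0 : ℝ) 1)) :
    ∀ᵐ p ∂(volume.restrict (S ×ˢ Icc (0 : ℝ) 1)),
      DifferentiableAt ℝ f p ∧ ‖fderiv ℝ f p‖ ≤ C := by
  have h1 : ∀ᵐ p ∂(volume : Measure (SpaceTime n)), p ∈ S ×ˢ Icc (0 : ℝ) 1 →
      DifferentiableWithinAt ℝ f (S ×ˢ Icc (0 : ℝ) 1) p := by
    have : (volume : Measure (SpaceTime n)).IsAddHaarMeasure :=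
      Measure.prod.instIsAddHaarMeasure volume volume
    exact hf.ae_differentiableWithinAt_of_mem
  filter_upwards [ae_mem_interior hS0, ae_restrict_of_ae h1] with p hp hp1
  have hn := mem_interior_iff_mem_nhds.1 hp
  exact ⟨(hp1 (interior_subset hp)).differentiableAt hn, norm_fderiv_le_of_lipschitzOn ℝ hn hf⟩

theorem integrableOn_fderiv_of_lipschitzOn (hS : IsCompact S) (hS0 : volume (frontier S) = 0)
    (hf : LipschitzOnWith C f (S ×ˢ Icc (0 : ℝ) 1)) (w : SpaceTime n) :
    IntegrableOn (fun p => fderiv ℝ f p w) (S ×ˢ Icc (0 : ℝ) 1) := by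
  have hfin : volume (S ×ˢ Icc (0 : ℝ) 1) < ⊤ := (hS.prod isCompact_Icc).measure_lt_top
  refine IntegrableOn.of_bound hfin (measurable_fderiv_apply_const ℝ f w).aestronglyMeasurable
    (C * ‖w‖) ?_
  filter_upwards [ae_differentiableAt_of_lipschitzOn hS0 hf] with p hp
  exact ((fderiv ℝ f p).le_opNorm w).trans (by gcongr; exact hp.2)

/-- By Fubini it suffices to treat time slices. There the extension by zero is Lipschitz with
compact support, and integration by parts against the constant `1` applies. -/
theorem integral_fderiv_space_eq_zero (hS : IsCompact S) (hS0 : volume (frontier S) = 0)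
    (hf : LipschitzOnWith C f (S ×ˢ Icc (0 : ℝ) 1))
    (h0 : ∀ x ∈ frontier S, ∀ t ∈ Icc (0 : ℝ) 1, f (x, t) = 0) (e : EuclideanSpace ℝ (Fin n)) :
    ∫ p in S ×ˢ Icc (0 : ℝ) 1, fderiv ℝ f p (e, 0) = 0 := by
  have hint := integrableOn_fderiv_of_lipschitzOn hS hS0 hf (e, 0)
  have hae := ae_differentiableAt_of_lipschitzOn hS0 hf
  rw [Measure.volume_eq_prod] at hint hae ⊢
  rw [IntegrableOn, ← Measure.prod_restrict] at hint
  rw [← Measure.prod_restrict] at hae ⊢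
  rw [integral_prod_symm _ hint]
  have hae' := Measure.ae_ae_of_ae_prod ((Measure.measurePreserving_swap
    (μ := volume.restrict (Icc (0 : ℝ) 1)) (ν := volume.restrict S)).quasiMeasurePreserving.ae hae)
  refine integral_eq_zero_of_ae ?_
  filter_upwards [hae', ae_restrict_mem measurableSet_Icc] with t ht htI
  set F : EuclideanSpace ℝ (Fin n) → ℝ := S.indicator (fun x => f (x, t)) with hF
  have hL : LipschitzWith C F := by
    refine lipschitzWith_indicator hS.isClosed ?_ fun z hz => h0 z hz t htI
    refine LipschitzOnWith.of_dist_le_mul fun x hx y hy => ?_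
    have := hf.dist_le_mul (x, t) ⟨hx, htI⟩ (y, t) ⟨hy, htI⟩
    simpa [Prod.dist_eq] using this
  have hc : HasCompactSupport F := HasCompactSupport.intro hS fun x hx => by simp [hF, hx]
  have hone : LipschitzWith 0 (fun _ : EuclideanSpace ℝ (Fin n) => (1 : ℝ)) := LipschitzWith.const 1
  -- Integration by parts reverses the direction, so `-e` produces the derivative along `e`.
  have h1 := LipschitzWith.integral_lineDeriv_mul_eq (E := EuclideanSpace ℝ (Fin n))
    (μ := volume) hone hL hc (-e)
  have h2 : ∫ x, lineDeriv ℝ F x e = 0 := by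
    simpa [lineDeriv] using h1.symm
  have hfr : ∀ᵐ x ∂(volume : Measure (EuclideanSpace ℝ (Fin n))), x ∉ frontier S :=
    measure_eq_zero_iff_ae_notMem.1 hS0
  have h3 : ∫ x in S, lineDeriv ℝ F x e = ∫ x, lineDeriv ℝ F x e := by
    refine setIntegral_eq_integral_of_forall_compl_eq_zero fun x hx => ?_
    have : F =ᶠ[𝓝 x] fun _ => 0 := by
      filter_upwards [hS.isClosed.isOpen_compl.mem_nhds hx] with y hy
      exact indicator_of_notMem hy _
    rw [this.lineDeriv_eq]
    simp [lineDeriv]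
  refine Eq.trans (integral_congr_ae ?_) (h3.trans h2)
  filter_upwards [ht, ae_restrict_of_ae hfr, ae_restrict_mem hS.isClosed.measurableSet]
    with x hx hxf hxS
  have hxi : x ∈ interior S := by
    by_contra hni
    exact hxf ⟨subset_closure hxS, hni⟩
  have hFf : F =ᶠ[𝓝 x] fun y => f (y, t) := by
    filter_upwards [mem_interior_iff_mem_nhds.1 hxi] with y hy
    exact indicator_of_mem hy _
  rw [hFf.lineDeriv_eq]
  have hd : HasFDerivAt (fun y => f (y, t))
      ((fderiv ℝ f (x, t)).comp (ContinuousLinearMap.inl ℝ _ ℝ)) x := by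
    have := hx.1.hasFDerivAt
    simp only [Prod.swap] at this
    exact HasFDerivAt.comp (f := fun y => (y, t)) x this (hasFDerivAt_prodMk_left x t)
  rw [hd.hasLineDerivAt e |>.lineDeriv]
  simp

/-- A Lipschitz function of `t` is absolutely continuous, so the fundamental theorem of calculus
holds on almost every vertical line. The boundary values are kept: they become the energy at `t = 0`
and `t = 1`. -/
theorem integral_fderiv_time_eq (hS : IsCompact S) (hS0 : volume (frontier S) = 0)
    (hf : LipschitzOnWith C f (S ×ˢ Icc (0 : ℝ) 1)) :
    ∫ p in S ×ˢ Icc (0 : ℝ) 1, fderiv ℝ f p (0, 1) = ∫ x in S, (f (x, 1) - f (x, 0)) := by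
  have hint := integrableOn_fderiv_of_lipschitzOn hS hS0 hf (0, 1)
  have hae := ae_differentiableAt_of_lipschitzOn hS0 hf
  rw [Measure.volume_eq_prod] at hint hae ⊢
  rw [IntegrableOn, ← Measure.prod_restrict] at hint
  rw [← Measure.prod_restrict] at hae ⊢
  rw [integral_prod _ hint]
  refine integral_congr_ae ?_
  filter_upwards [Measure.ae_ae_of_ae_prod hae, ae_restrict_mem hS.isClosed.measurableSet]
    with x hx hxS
  have hL : LipschitzOnWith C (fun t => f (x, t)) (uIcc 0 1) := by
    rw [uIcc_of_le zero_le_one]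
    refine LipschitzOnWith.of_dist_le_mul fun s hs t ht => ?_
    have := hf.dist_le_mul (x, s) ⟨hxS, hs⟩ (x, t) ⟨hxS, ht⟩
    simpa [Prod.dist_eq] using this
  rw [← hL.absolutelyContinuousOnInterval.integral_deriv_eq_sub,
    intervalIntegral.integral_of_le zero_le_one, ← integral_Icc_eq_integral_Ioc]
  refine integral_congr_ae ?_
  filter_upwards [hx] with t ht
  have hd : HasFDerivAt (fun s => f (x, s))
      ((fderiv ℝ f (x, t)).comp (ContinuousLinearMap.inr ℝ _ ℝ)) t :=
    HasFDerivAt.comp (f := fun s => (x, s)) t ht.1.hasFDerivAt (hasFDerivAt_prodMk_right x t)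
  rw [hd.hasDerivAt.deriv]
  simp

end LipschitzIntegration

/-! ### Calculus of locally Lipschitz functions. -/

section LocallyLipschitz

variable {X F G H : Type*} [PseudoEMetricSpace X] [NormedAddCommGroup F]
  [NormedAddCommGroup G] [NormedAddCommGroup H] {s : Set X}

theorem locallyLipschitzOn_comp {Φ : F → G} (hΦ : LocallyLipschitz Φ) {f : X → F}
    (hf : LocallyLipschitzOn s f) : LocallyLipschitzOn s (fun x => Φ (f x)) := by
  rw [locallyLipschitzOn_iff_restrict] at hf ⊢
  exact hΦ.comp hf

theorem locallyLipschitzOn_prodMk {f : X → F} {g : X → G} (hf : LocallyLipschitzOn s f)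
    (hg : LocallyLipschitzOn s g) : LocallyLipschitzOn s (fun x => (f x, g x)) := by
  rw [locallyLipschitzOn_iff_restrict] at hf hg ⊢
  exact hf.prodMk hg

variable [NormedSpace ℝ F] [NormedSpace ℝ G] [NormedSpace ℝ H]

theorem contDiff_locallyLipschitz {Φ : F → G} (h : ContDiff ℝ 1 Φ) : LocallyLipschitz Φ := by
  intro x
  exact h.contDiffAt.exists_lipschitzOnWith

theorem locallyLipschitzOn_comp₂ {Φ : F × G → H} (hΦ : ContDiff ℝ 1 Φ) {f : X → F} {g : X → G}
    (hf : LocallyLipschitzOn s f) (hg : LocallyLipschitzOn s g) :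
    LocallyLipschitzOn s (fun x => Φ (f x, g x)) :=
  locallyLipschitzOn_comp (contDiff_locallyLipschitz hΦ) (locallyLipschitzOn_prodMk hf hg)

theorem locallyLipschitzOn_sum {ι : Type*} (I : Finset ι) {f : ι → X → F}
    (hf : ∀ i ∈ I, LocallyLipschitzOn s (f i)) : LocallyLipschitzOn s (fun x => ∑ i ∈ I, f i x) := by
  classical
  induction I using Finset.induction_on with
  | empty => simpa using (LocallyLipschitz.const (0 : F)).locallyLipschitzOn
  | insert i I hi ih =>
    simp only [Finset.sum_insert hi]
    exact locallyLipschitzOn_comp₂ (Φ := fun z : F × F => z.1 + z.2) (by fun_prop)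
      (hf i (by simp)) (ih fun j hj => hf j (by simp [hj]))

theorem locallyLipschitzOn_of_contDiffAt {f : F → G} {s : Set F}
    (h : ∀ x ∈ s, ContDiffAt ℝ 1 f x) : LocallyLipschitzOn s f := by
  intro x hx
  obtain ⟨K, t, ht, hK⟩ := (h x hx).exists_lipschitzOnWith
  exact ⟨K, t, mem_nhdsWithin_of_mem_nhds ht, hK⟩

end LocallyLipschitz

end ExteriorCarleman

namespace ExteriorCarleman

open Topology
open scoped NNReal RealInnerProductSpace

/-! ### The differential identity for the conjugated operator. -/

section Identity

variable {n : ℕ}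

/-- The spatial divergence of a vector field with derivative `L`. -/
noncomputable def divergence (L : SpaceTime n →L[ℝ] EuclideanSpace ℝ (Fin n)) : ℝ :=
  ∑ i, L (EuclideanSpace.single i 1, 0) i

theorem divergence_add (L M : SpaceTime n →L[ℝ] EuclideanSpace ℝ (Fin n)) :
    divergence (L + M) = divergence L + divergence M := by
  simp [divergence, Finset.sum_add_distrib]

theorem divergence_smul (c : ℝ) (L : SpaceTime n →L[ℝ] EuclideanSpace ℝ (Fin n)) :
    divergence (c • L) = c * divergence L := by
  simp [divergence, Finset.mul_sum]

theorem divergence_smulRight (s : SpaceTime n →L[ℝ] ℝ) (X : EuclideanSpace ℝ (Fin n)) :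
    divergence (s.smulRight X) = s (X, 0) := by
  have hX : (X, (0 : ℝ)) = ∑ i, X i • ((EuclideanSpace.single i (1 : ℝ), (0 : ℝ)) : SpaceTime n) := by
    refine Prod.ext ?_ (by simp [Prod.snd_sum])
    rw [Prod.fst_sum]
    ext j
    simp [Finset.sum_apply, Pi.single_apply]
  rw [hX, map_sum]
  simp only [divergence, ContinuousLinearMap.smulRight_apply, map_smul, smul_eq_mul]
  exact Finset.sum_congr rfl fun i _ => by simp [mul_comm]

/-- The Rellich-type identity behind the Carleman inequality: twice the product of the
antisymmetric and the symmetric part of the conjugated operator is a divergence up to terms of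
lower order. -/
theorem conjugated_identity {p : SpaceTime n} {u ut q h : SpaceTime n → ℝ}
    {U V : SpaceTime n → EuclideanSpace ℝ (Fin n)}
    {A : SpaceTime n → EuclideanSpace ℝ (Fin n) →L[ℝ] EuclideanSpace ℝ (Fin n)}
    {u' ut' q' h' : SpaceTime n →L[ℝ] ℝ}
    {U' V' : SpaceTime n →L[ℝ] EuclideanSpace ℝ (Fin n)}
    {A' : SpaceTime n →L[ℝ] EuclideanSpace ℝ (Fin n) →L[ℝ] EuclideanSpace ℝ (Fin n)}
    (hu : HasFDerivAt u u' p) (hut : HasFDerivAt ut ut' p) (hq : HasFDerivAt q q' p)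
    (hh : HasFDerivAt h h' p) (hU : HasFDerivAt U U' p) (hV : HasFDerivAt V V' p)
    (hA : HasFDerivAt A A' p)
    (hux : ∀ y, u' (y, 0) = ⟪U p, y⟫) (hu1 : u' (0, 1) = ut p)
    (hUs : ∀ y z, ⟪U' (y, 0), z⟫ = ⟪U' (z, 0), y⟫) (hutx : ∀ y, ut' (y, 0) = ⟪U' (0, 1), y⟫)
    (hAs : ∀ y z, ⟪A p y, z⟫ = ⟪y, A p z⟫) :
    ∃ (W' : SpaceTime n →L[ℝ] EuclideanSpace ℝ (Fin n)) (g' : SpaceTime n →L[ℝ] ℝ), HasFDerivAt (fun z => (2 * ut z - 4 * ⟪V z, U z⟫ - 2 * h z * u z) • A z (U z)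
        + (2 * ⟪A z (U z), U z⟫ - 2 * q z * u z ^ 2) • V z) W' p ∧
      HasFDerivAt (fun z => q z * u z ^ 2 - ⟪A z (U z), U z⟫) g' p ∧
      divergence W' + g' (0, 1) =
        2 * (ut p - 2 * ⟪V p, U p⟫ - h p * u p) *
            (divergence ((A p).comp U' + A'.flip (U p)) + q p * u p)
        - (4 * ⟪V' (A p (U p), 0), U p⟫ - 2 * ⟪A' (V p, 0) (U p), U p⟫
          + 2 * (h p - divergence V') * ⟪A p (U p), U p⟫ + 2 * u p * h' (A p (U p), 0)
          + ⟪A' (0, 1) (U p), U p⟫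
          + (2 * q' (V p, 0) - q' (0, 1) - 2 * (h p - divergence V') * q p) * u p ^ 2) := by
  have hX : HasFDerivAt (fun z => A z (U z)) ((A p).comp U' + A'.flip (U p)) p := hA.clm_apply hU
  set X' := (A p).comp U' + A'.flip (U p) with hX'
  have hX'a : ∀ z, X' z = A p (U' z) + A' z (U p) := fun z => by simp [hX']
  have h1 := hV.inner ℝ hU
  have h2 := hX.inner ℝ hU
  have hc := ((hut.const_mul 2).sub (h1.const_mul 4)).sub ((hh.const_mul 2).mul hu)
  have hd := (h2.const_mul 2).sub ((hq.const_mul 2).mul (hu.pow 2))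
  have hW := (hc.smul hX).add (hd.smul hV)
  have hg := (hq.mul (hu.pow 2)).sub h2
  refine ⟨_, _, hW, hg, ?_⟩
  rw [divergence_add, divergence_add, divergence_add, divergence_smul, divergence_smul,
    divergence_smulRight, divergence_smulRight]
  have e1 : ∀ y z, ⟪A p y, U' (z, 0)⟫ = ⟪U' (A p y, 0), z⟫ := fun y z => by
    rw [real_inner_comm, hUs]
  simp only [sub_apply, add_apply, smul_apply, Pi.sub_apply, Pi.mul_apply, smul_eq_mul, ContinuousLinearMap.comp_apply,
    fderivInnerCLM_apply, ContinuousLinearMap.prod_apply, hux, hu1, hutx, hX'a,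
    inner_add_left]
  -- Symmetry of `A` and of the second derivatives of `u` brings all second-order terms to a common
  -- form; those not belonging to the product `2KZ` then cancel.
  have e2 : ⟪A p (U' (0, 1)), U p⟫ = ⟪U' (0, 1), A p (U p)⟫ := hAs _ _
  have e3 : ⟪A p (U' (V p, 0)), U p⟫ = ⟪U' (V p, 0), A p (U p)⟫ := hAs _ _
  have e4 : ⟪A p (U p), U' (V p, 0)⟫ = ⟪U' (V p, 0), A p (U p)⟫ := real_inner_comm _ _
  have e5 : ⟪V p, U' (A p (U p), 0)⟫ = ⟪U' (V p, 0), A p (U p)⟫ := by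
    rw [real_inner_comm, hUs]
  have e6 : ⟪A p (U p), U' (0, 1)⟫ = ⟪U' (0, 1), A p (U p)⟫ := real_inner_comm _ _
  have e7 : ⟪U p, A p (U p)⟫ = ⟪A p (U p), U p⟫ := real_inner_comm _ _
  have e8 : ⟪U p, V p⟫ = ⟪V p, U p⟫ := real_inner_comm _ _
  rw [e2, e3, e4, e5, e6, e7, e8]
  simp only [pow_one, Nat.cast_ofNat, nsmul_eq_mul, Nat.add_one_sub_one]
  ring

end Identity

end ExteriorCarleman

namespace ExteriorCarleman

/-! ### Scalar inequalities behind the positivity of the commutator. -/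

section ScalarInequalities

/-- Here `N = |U|`, `Y = |AU|`, `ℓ = AU·U`, `w = |u|`. The convexity term is at least `2αlam²N²`.
Half of it pays for the errors of order `αε` and for the mixed term coming from `∇h`; terms without
`α` are paid by `k`. The mixed term leaves a debt `αw²`, shown on the left and repaid at zeroth
order. -/
theorem gradient_form_lower {α b τ Λ lam ε k M N w Y ℓ H : ℝ} (hα : 0 ≤ α) (hb : 0 < b)
    (hτ : 1 ≤ τ) (hτ2 : τ ≤ 2) (hlam : 0 < lam) (hΛ : lam ≤ Λ) (hbΛ : b * Λ = 1 / 16)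
    (hε : 0 ≤ ε) (hεΛ : 16 * ε * Λ ≤ lam ^ 2) (hk : 0 ≤ k) (hN : 0 ≤ N) (hw : 0 ≤ w)
    (hH : 0 ≤ H) (hY1 : lam * N ≤ Y) (hY2 : Y ≤ Λ * N) (hℓ1 : lam * N ^ 2 ≤ ℓ)
    (hℓ2 : ℓ ≤ Λ * N ^ 2) (hkM : 2 + M + Λ / 4 + ε / 2 ≤ k * lam) :
    2 * N ^ 2 - 2 * (H * Λ / lam) ^ 2 * (α * w ^ 2) ≤
      (2 * α - 4 * (b / τ)) * Y ^ 2 - 4 * (α + b) * ε * Y * N - 2 * ε * (α + b) * Λ * N ^ 2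
        + 2 * (k / τ) * ℓ - 2 * ((α + b) * ε) * ℓ - 2 * w * (H * α * Y) - M * N ^ 2 := by
  have hΛ0 : 0 < Λ := hlam.trans_le hΛ
  have hY0 : 0 ≤ Y := le_trans (by positivity) hY1
  have hbτ : b / τ ≤ b := div_le_self hb.le hτ
  have hYY : (lam * N) ^ 2 ≤ Y ^ 2 := by gcongr
  have hYY2 : Y ^ 2 ≤ (Λ * N) ^ 2 := by gcongr
  have t1 : 2 * α * (lam ^ 2 * N ^ 2) ≤ 2 * α * Y ^ 2 := by
    have := mul_le_mul_of_nonneg_left hYY (by positivity : 0 ≤ 2 * α)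
    linarith [mul_pow lam N 2]
  have t2 : 4 * (b / τ) * Y ^ 2 ≤ Λ / 4 * N ^ 2 := by
    calc 4 * (b / τ) * Y ^ 2 ≤ 4 * b * (Λ * N) ^ 2 := by gcongr
      _ = 4 * (b * Λ) * Λ * N ^ 2 := by ring
      _ = _ := by rw [hbΛ]; ring
  have t3 : 4 * (α + b) * ε * Y * N ≤ 4 * (α + b) * ε * (Λ * N) * N := by gcongr
  have t4 : 2 * ((α + b) * ε) * ℓ ≤ 2 * ((α + b) * ε) * (Λ * N ^ 2) := by gcongr
  have t5 : k * lam * N ^ 2 ≤ 2 * (k / τ) * ℓ := by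
    have h1 : k / 2 ≤ k / τ := div_le_div_of_nonneg_left hk (by linarith) hτ2
    calc k * lam * N ^ 2 = 2 * (k / 2) * (lam * N ^ 2) := by ring
      _ ≤ _ := by gcongr
  have t6 : 2 * w * (H * α * Y) ≤ α * (lam ^ 2 / 2) * N ^ 2 + 2 * (H * Λ / lam) ^ 2 * (α * w ^ 2) := by
    have h1 : 2 * w * (H * α * Y) ≤ 2 * w * (H * α * (Λ * N)) := by gcongr
    -- Young's inequality, weighted so that exactly `αlam²/2` of the gradient term is spent.
    have h2 : 0 ≤ α / 2 * (lam * N - 2 * (H * Λ / lam) * w) ^ 2 := by positivity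
    have h3 : α / 2 * (lam * N - 2 * (H * Λ / lam) * w) ^ 2 = α * (lam ^ 2 / 2) * N ^ 2
        + 2 * (H * Λ / lam) ^ 2 * (α * w ^ 2) - 2 * w * (H * α * (Λ * N)) := by
      field_simp
      ring
    linarith
  have t7 : 8 * α * ε * Λ * N ^ 2 ≤ α * lam ^ 2 / 2 * N ^ 2 := by
    have : α * N ^ 2 * (16 * ε * Λ) ≤ α * N ^ 2 * lam ^ 2 := by gcongr
    linarith
  have t8 : 8 * b * ε * Λ * N ^ 2 = ε / 2 * N ^ 2 := by
    calc 8 * b * ε * Λ * N ^ 2 = 8 * (b * Λ) * ε * N ^ 2 := by ring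
      _ = _ := by rw [hbΛ]; ring
  have t9 : (2 + M + Λ / 4 + ε / 2) * N ^ 2 ≤ k * lam * N ^ 2 := by gcongr
  have t10 : 0 ≤ α * (lam ^ 2 * N ^ 2) := by positivity
  linarith

set_option maxHeartbeats 1000000 in
-- This concerns the coefficient of `u²`, with `y = |x|²`, `m = Ax·x`, `P = |Ax|²`, `T = tr A`; `i`,
-- `j`, `d` stand for the derivatives of `A` that occur, and `D α` is the debt left by
-- `gradient_form_lower`. Good terms are `α³y` from convexity, `αα₁y` and `α₂y` from the decay of
-- `f`, and `Kψ/τ³` from the shift. Errors cubic in `α` are absorbed by smallness of `ε`, quadratic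
-- ones by `αα₁ ≥ βα²/2`, those linear in `α` or `α₁` by `α₂`, and the rest by `kψ`.
theorem zeroth_order_lower {α α₁ α₂ b τ μ κ m P y ε Λ lam k T d β ψ M D i j : ℝ}
    (hα : 0 ≤ α) (hα₁ : β / 2 * α ≤ α₁) (hα₂ : β / 2 * α₁ ≤ α₂)
    (hb : 0 < b) (hτ : 1 ≤ τ) (hτ2 : τ ≤ 2) (hlam : 0 < lam) (hΛ : lam ≤ Λ)
    (hbΛ : b * Λ = 1 / 16) (hε : 0 ≤ ε) (hεΛ : 16 * ε * Λ ≤ lam ^ 2) (hM : 0 ≤ M) (hD : 0 ≤ D)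
    (hμ : μ = α - b / τ) (hκ : κ = α / (2 * y)) (hψ : ψ = b * y + β) (hy : 1 ≤ y)
    (hm1 : lam * y ≤ m) (hm2 : m ≤ Λ * y) (hmP : m ^ 2 ≤ y * P) (hP1 : lam ^ 2 * y ≤ P)
    (hP2 : P ≤ Λ ^ 2 * y) (hT0 : 0 ≤ T) (hTk : b * T ≤ k) (hd : |d| ≤ ε) (hi : |i| ≤ M * y)
    (hj : |j| ≤ ε * Λ * y) (hk4 : 4 ≤ k)
    (hk : b * ε + 16 * ε * Λ * b ^ 2 + 2 * (4 * b * Λ ^ 2 + M + 2 + 2 * ε ^ 2) * b ≤ k / 32)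
    (hβ1 : 1 ≤ β) (hβ2 : 2 * (4 * b * Λ ^ 2 + M + 2 + 2 * ε ^ 2) + 8 * k * Λ ≤ lam * β)
    (hβ3 : 3 * (1 / 4 + 8 / 3 * k + 4 / 3 * b * ε + 2 * (2 * lam ^ 2 * b ^ 2 + 1 / 4 + D + ε * b)
      + 2 * ε) ≤ β)
    (hβ4 : 256 * k + 8 ≤ β) :
    0 ≤ 2 * (2 * μ * (-κ * (μ * m)) * m + μ ^ 2 * (μ * j + 2 * (μ * P))
          - (-α₁ + b / τ ^ 2) * (μ * m))
        - (2 * μ * (-α₁ + b / τ ^ 2) * m + μ ^ 2 * i - (2 / 3 * α₂ * y - ψ / τ ^ 3))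
        - 2 * ((b * T + k) / τ - μ * d) * (μ ^ 2 * m - (-(2 / 3) * α₁ * y + ψ / (2 * τ ^ 2)))
        - ((b * T + k) / τ - μ * d) ^ 2 - 1 - 2 * μ ^ 2 * y - D * α := by
  have hΛ0 : 0 < Λ := hlam.trans_le hΛ
  have hy0 : 0 < y := by linarith
  have hτ0 : 0 < τ := by linarith
  have hα₁0 : 0 ≤ α₁ := le_trans (by positivity) hα₁
  have hm0 : 0 ≤ m := le_trans (by positivity) hm1
  have hP0 : 0 ≤ P := le_trans (by positivity) hP1
  have hψ0 : 0 < ψ := by rw [hψ]; positivity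
  obtain ⟨θ, hθ⟩ : ∃ θ, θ = b / τ := ⟨_, rfl⟩
  have hθ0 : 0 < θ := by rw [hθ]; positivity
  have hθb : θ ≤ b := by rw [hθ]; exact div_le_self hb.le hτ
  obtain ⟨K, hK⟩ : ∃ K, K = b * T + k := ⟨_, rfl⟩
  have hK1 : k ≤ K := by rw [hK]; linarith [mul_nonneg hb.le hT0]
  have hK2 : K ≤ 2 * k := by rw [hK]; linarith
  have hK0 : 0 ≤ K := by linarith
  rw [← hθ] at hμ
  rw [← hK]
  have hεΛlam : ε ≤ lam := by
    have : ε * Λ ≤ lam * Λ := by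
      linarith [mul_nonneg hε hΛ0.le, mul_le_mul_of_nonneg_left hΛ hlam.le, sq lam]
    exact le_of_mul_le_mul_right this hΛ0
  -- size of `μ`
  have hμabs : |μ| ≤ α + b := by
    rw [hμ, abs_le]; constructor <;> linarith
  have hμ2 : μ ^ 2 ≤ 2 * α ^ 2 + 2 * θ ^ 2 := by rw [hμ]; nlinarith only [sq_nonneg (α + θ)]
  have hθ2 : θ ^ 2 ≤ b ^ 2 := by gcongr
  have hμ2b : μ ^ 2 ≤ 2 * α ^ 2 + 2 * b ^ 2 := by linarith
  have hμlow : α ^ 2 / 2 - b ^ 2 ≤ μ ^ 2 := by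
    rw [hμ]; nlinarith only [sq_nonneg (α - 2 * θ), hθ2]
  have hμ3 : |μ| ^ 3 ≤ 4 * α ^ 3 + 4 * b ^ 3 := by
    calc |μ| ^ 3 ≤ (α + b) ^ 3 := by gcongr
      _ ≤ _ := by nlinarith only [mul_nonneg (add_nonneg hα hb.le) (sq_nonneg (α - b))]
  have hμ3a : ∀ z B, |z| ≤ B → |μ ^ 3 * z| ≤ (4 * α ^ 3 + 4 * b ^ 3) * B := by
    intro z B hz
    rw [abs_mul, abs_pow]
    gcongr
  -- the convexity term
  have T1 : lam ^ 2 * (α ^ 3 * y) - 2 * lam ^ 2 * b ^ 2 * (α * y) - 4 * b * Λ ^ 2 * (μ ^ 2 * y)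
      ≤ 4 * μ ^ 3 * P - 4 * κ * μ ^ 2 * m ^ 2 := by
    -- By Cauchy–Schwarz `m² ≤ yP`, while `κy = α/2`: the radial loss costs only half of the `α`
    -- part of `4μ³P`, and this is where the exponent `3/2` enters.
    have h1 : κ * m ^ 2 ≤ α / 2 * P := by
      rw [hκ]
      calc α / (2 * y) * m ^ 2 ≤ α / (2 * y) * (y * P) := by gcongr
        _ = _ := by field_simp
    have h2 : μ ^ 2 * (κ * m ^ 2) ≤ μ ^ 2 * (α / 2 * P) := by gcongr
    have h3 : 4 * μ ^ 3 * P - 4 * (μ ^ 2 * (α / 2 * P)) = 2 * α * (μ ^ 2 * P) - 4 * θ * (μ ^ 2 * P) := by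
      rw [hμ]; ring
    have h4 : μ ^ 2 * (lam ^ 2 * y) ≤ μ ^ 2 * P := by gcongr
    have h5 : 4 * θ * (μ ^ 2 * P) ≤ 4 * b * (μ ^ 2 * (Λ ^ 2 * y)) := by gcongr
    have h6 : 2 * α * (lam ^ 2 * y) * (α ^ 2 / 2 - b ^ 2) ≤ 2 * α * (lam ^ 2 * y) * μ ^ 2 := by gcongr
    have h7 : 2 * α * (μ ^ 2 * (lam ^ 2 * y)) ≤ 2 * α * (μ ^ 2 * P) := by gcongr
    linarith
  have T2 : -(8 * ε * Λ * (α ^ 3 * y) + 8 * ε * Λ * b ^ 3 * y) ≤ 2 * (μ ^ 3 * j) := by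
    have := (abs_le.1 (hμ3a j _ hj)).1
    linarith
  have hmb : b * m ≤ y / 16 := by
    calc b * m ≤ b * (Λ * y) := by gcongr
      _ = _ := by rw [← mul_assoc, hbΛ]; ring
  have T3 : 4 * lam * (α * α₁ * y) - α * y / 4 - α₁ * y / 4
      ≤ -4 * μ * (-α₁ + b / τ ^ 2) * m := by
    have hθτ : b / τ ^ 2 = θ / τ := by rw [hθ]; field_simp
    have hθτb : θ / τ ≤ b := (div_le_self hθ0.le hτ).trans hθb
    have hθτ0 : 0 < θ / τ := by positivity
    rw [hθτ, hμ]
    have h1 : α * α₁ * (lam * y) ≤ α * α₁ * m := by gcongr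
    have h2 : α * (θ / τ * m) ≤ α * (y / 16) := by
      gcongr; exact le_trans (by gcongr) hmb
    have h3 : α₁ * (θ * m) ≤ α₁ * (y / 16) := by
      gcongr; exact le_trans (by gcongr) hmb
    have h4 : 0 ≤ θ * (θ / τ) * m := by positivity
    linarith
  have T4 : -(M * (μ ^ 2 * y)) ≤ -(μ ^ 2 * i) := by
    have : μ ^ 2 * i ≤ μ ^ 2 * (M * y) := by gcongr; exact (abs_le.1 hi).2
    linarith
  -- the terms containing the zeroth order multiplier
  have hμd : |μ * d| ≤ (α + b) * ε := by rw [abs_mul]; gcongr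
  have hKτ : K / τ ≤ 2 * k := (div_le_self hK0 hτ).trans hK2
  have T5 : 2 * (K / τ) * (μ ^ 2 * m) ≤ 8 * k * Λ * (α ^ 2 * y) + K * ψ / τ ^ 3 / 4 := by
    have h1 : 2 * (K / τ) * (μ ^ 2 * m) ≤ 2 * (K / τ) * ((2 * α ^ 2 + 2 * θ ^ 2) * (Λ * y)) := by
      gcongr
    have h2 : 2 * (K / τ) * (2 * α ^ 2 * (Λ * y)) ≤ 2 * (2 * k) * (2 * α ^ 2 * (Λ * y)) := by gcongr
    -- The part of `μ²` without `α` could compete with the good term `Kψ/τ³`; since `4bΛ = 1/4`, it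
    -- takes at most a quarter of it.
    have h3 : 2 * (K / τ) * (2 * θ ^ 2 * (Λ * y)) = K * (b * y) / τ ^ 3 / 4 := by
      rw [hθ]
      calc _ = 4 * (b * Λ) * K * (b * y) / τ ^ 3 := by field_simp; ring
        _ = _ := by rw [hbΛ]; ring
    have h4 : K * (b * y) / τ ^ 3 / 4 ≤ K * ψ / τ ^ 3 / 4 := by
      gcongr; rw [hψ]; linarith
    linarith
  have T6 : -(8 * ε * Λ * (α ^ 3 * y) + 8 * ε * Λ * b ^ 3 * y) ≤ 2 * (μ ^ 3 * (d * m)) := by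
    have h1 : |d * m| ≤ ε * (Λ * y) := by
      rw [abs_mul, abs_of_nonneg hm0]; gcongr
    have := (abs_le.1 (hμ3a _ _ h1)).1
    linarith
  have T7 : K / τ * (α₁ * y) ≤ 2 * k * (α₁ * y) := by gcongr
  have T8 : -((α + b) * ε * (α₁ * y)) ≤ μ * d * (α₁ * y) := by
    have : -((α + b) * ε) * (α₁ * y) ≤ μ * d * (α₁ * y) := by
      gcongr; exact (abs_le.1 hμd).1
    linarith
  have T9 : μ * d * ψ / τ ^ 2 ≤ ε * (b + β) * (α * y) + b * ε * ψ := by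
    have h1 : μ * d * ψ / τ ^ 2 ≤ (α + b) * ε * ψ := by
      calc μ * d * ψ / τ ^ 2 ≤ (α + b) * ε * ψ / τ ^ 2 :=
          div_le_div_of_nonneg_right (mul_le_mul_of_nonneg_right (abs_le.1 hμd).2 hψ0.le)
            (by positivity)
        _ ≤ _ := div_le_self (by positivity) (one_le_pow₀ hτ)
    have h2 : ψ ≤ (b + β) * y := by rw [hψ]; nlinarith only [hy, hβ1]
    have h3 : α * ε * ψ ≤ α * ε * ((b + β) * y) := by gcongr
    linarith
  have T10 : (K / τ - μ * d) ^ 2 ≤ 8 * k ^ 2 + 2 * ε ^ 2 * (μ ^ 2 * y) := by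
    have h1 : (K / τ) ^ 2 ≤ (2 * k) ^ 2 := by gcongr
    have h2 : d ^ 2 ≤ ε ^ 2 := by rw [← sq_abs]; gcongr
    have h3 : μ ^ 2 * d ^ 2 ≤ μ ^ 2 * (ε ^ 2 * y) := by
      gcongr; exact h2.trans (le_mul_of_one_le_right (sq_nonneg ε) hy)
    have h4 : (K / τ - μ * d) ^ 2 = 2 * (K / τ) ^ 2 + 2 * (μ ^ 2 * d ^ 2) - (K / τ + μ * d) ^ 2 := by
      ring
    linarith [sq_nonneg (K / τ + μ * d)]
  -- absorption of the terms linear in `α` and `α₁`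
  have A1 : 0 ≤ α ^ 3 * y * (lam ^ 2 - 16 * ε * Λ) :=
    mul_nonneg (by positivity) (by linarith)
  have A2 : (2 * (4 * b * Λ ^ 2 + M + 2 + 2 * ε ^ 2) + 8 * k * Λ) * (α ^ 2 * y)
      ≤ 2 * lam * (α * α₁ * y) := by
    calc _ ≤ lam * β * (α ^ 2 * y) := by gcongr
      _ = 2 * lam * (α * (β / 2 * α) * y) := by ring
      _ ≤ _ := by gcongr
  have A3 : α * y ≤ 2 * (α₁ * y) := by
    have : β / 2 * α * y ≤ α₁ * y := by gcongr
    have h2 : 1 / 2 * (α * y) ≤ β / 2 * (α * y) := by gcongr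
    linarith
  have A3' : β * (α * y) ≤ 2 * (α₁ * y) := by
    have : β / 2 * α * y ≤ α₁ * y := by gcongr
    linarith
  have A4 : β / 3 * (α₁ * y) ≤ 2 / 3 * α₂ * y := by
    have : β / 2 * α₁ * y ≤ α₂ * y := by gcongr
    linarith
  have A5 : 3 * (1 / 4 + 8 / 3 * k + 4 / 3 * b * ε + 2 * (2 * lam ^ 2 * b ^ 2 + 1 / 4 + D + ε * b)
      + 2 * ε) * (α₁ * y) ≤ β * (α₁ * y) := by gcongr
  have A6 : (2 * lam ^ 2 * b ^ 2 + 1 / 4 + D + ε * b) * (α * y)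
      ≤ (2 * lam ^ 2 * b ^ 2 + 1 / 4 + D + ε * b) * (2 * (α₁ * y)) := by gcongr
  have A7 : ε * (β * (α * y)) ≤ ε * (2 * (α₁ * y)) := by gcongr
  have A8 : D * α ≤ D * (α * y) := by
    gcongr; exact le_mul_of_one_le_right hα hy
  have A9 : ε * (α * α₁ * y) ≤ lam * (α * α₁ * y) := by gcongr
  have A10 : 0 ≤ lam * (α * α₁ * y) := by positivity
  -- absorption of the constants
  have hbyψ : b * y ≤ ψ := by rw [hψ]; linarith
  have hβψ : β ≤ ψ := by rw [hψ]; linarith [mul_pos hb hy0]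
  have hτ3 : τ ^ 3 ≤ 8 := by
    calc τ ^ 3 ≤ 2 ^ 3 := by gcongr
      _ = 8 := by norm_num
  have B1 : k / 16 * ψ ≤ 3 / 4 * (K * ψ / τ ^ 3) - ψ / τ ^ 3 := by
    have h1 : 3 / 4 * (K * ψ / τ ^ 3) - ψ / τ ^ 3 = (3 / 4 * K - 1) * ψ / τ ^ 3 := by ring
    rw [h1, le_div_iff₀ (by positivity)]
    have h2 : k / 16 * ψ * τ ^ 3 ≤ k / 16 * ψ * 8 := by gcongr
    have h3 : k / 2 * ψ ≤ (3 / 4 * K - 1) * ψ := by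
      gcongr; linarith
    linarith
  have B2 : (b * ε + 16 * ε * Λ * b ^ 2 + 2 * (4 * b * Λ ^ 2 + M + 2 + 2 * ε ^ 2) * b) * ψ
      ≤ k / 32 * ψ := by gcongr
  have B3 : 16 * ε * Λ * b ^ 2 * (b * y) ≤ 16 * ε * Λ * b ^ 2 * ψ := by gcongr
  have B4 : 2 * (4 * b * Λ ^ 2 + M + 2 + 2 * ε ^ 2) * b * (b * y)
      ≤ 2 * (4 * b * Λ ^ 2 + M + 2 + 2 * ε ^ 2) * b * ψ := by gcongr
  -- Constants of size `k²` are absorbed because `ψ ≥ β ≥ 256k + 8` and `k ≥ 4`. This is the purpose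
  -- of the term `-β/(t+1)` in the weight.
  have B5 : 8 * k ^ 2 + 1 ≤ k / 32 * ψ := by
    have h1 : k / 32 * (256 * k + 8) ≤ k / 32 * ψ := by gcongr; linarith
    linarith
  have B6 : (4 * b * Λ ^ 2 + M + 2 + 2 * ε ^ 2) * (μ ^ 2 * y)
      ≤ (4 * b * Λ ^ 2 + M + 2 + 2 * ε ^ 2) * ((2 * α ^ 2 + 2 * b ^ 2) * y) := by gcongr
  have expand : 2 * (2 * μ * (-κ * (μ * m)) * m + μ ^ 2 * (μ * j + 2 * (μ * P))
          - (-α₁ + b / τ ^ 2) * (μ * m))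
        - (2 * μ * (-α₁ + b / τ ^ 2) * m + μ ^ 2 * i - (2 / 3 * α₂ * y - ψ / τ ^ 3))
        - 2 * (K / τ - μ * d) * (μ ^ 2 * m - (-(2 / 3) * α₁ * y + ψ / (2 * τ ^ 2)))
        - (K / τ - μ * d) ^ 2 - 1 - 2 * μ ^ 2 * y - D * α
      = (4 * μ ^ 3 * P - 4 * κ * μ ^ 2 * m ^ 2) + 2 * (μ ^ 3 * j)
        + (-4 * μ * (-α₁ + b / τ ^ 2) * m) + -(μ ^ 2 * i) + 2 / 3 * α₂ * y - ψ / τ ^ 3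
        - 2 * (K / τ) * (μ ^ 2 * m) + 2 * (μ ^ 3 * (d * m)) - 4 / 3 * (K / τ * (α₁ * y))
        + 4 / 3 * (μ * d * (α₁ * y)) + K * ψ / τ ^ 3 - μ * d * ψ / τ ^ 2
        - (K / τ - μ * d) ^ 2 - 1 - 2 * (μ ^ 2 * y) - D * α := by
    field_simp
    ring
  rw [expand]
  clear hα₁ hα₂ hbΛ hεΛ hk hβ2 hβ3 hβ4 hμ hκ hψ hm1 hm2 hmP hP1 hP2 hTk hd hi hj hK hθ expand hμ2 hμ2b
    hμlow hμ3 hμ3a hmb hμd hKτ A3 hbyψ hβψ hτ3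
  linarith

end ScalarInequalities

end ExteriorCarleman

namespace ExteriorCarleman

open scoped RealInnerProductSpace

/-! ### Positivity of the commutator. -/

section CommutatorBound

/-- The relations between the parameters under which the commutator is positive: `ε` bounds the
scale invariant oscillation of the coefficients, `M` their time derivative, `k` is the size of the
zeroth order multiplier, and `H` bounds the gradient of that multiplier. -/
structure AdmissibleParameters (b Λ lam ε M k H β : ℝ) : Prop where
  b_pos : 0 < b
  lam_pos : 0 < lam
  lam_le : lam ≤ Λ
  b_mul : b * Λ = 1 / 16
  ε_nonneg : 0 ≤ ε
  ε_small : 16 * ε * Λ ≤ lam ^ 2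
  M_nonneg : 0 ≤ M
  H_nonneg : 0 ≤ H
  four_le : 4 ≤ k
  k_grad : 2 + M + Λ / 4 + ε / 2 ≤ k * lam
  k_zero : b * ε + 16 * ε * Λ * b ^ 2 + 2 * (4 * b * Λ ^ 2 + M + 2 + 2 * ε ^ 2) * b ≤ k / 32
  one_le : 1 ≤ β
  β_sq : 2 * (4 * b * Λ ^ 2 + M + 2 + 2 * ε ^ 2) + 8 * k * Λ ≤ lam * β
  β_lin : 3 * (1 / 4 + 8 / 3 * k + 4 / 3 * b * ε
    + 2 * (2 * lam ^ 2 * b ^ 2 + 1 / 4 + 2 * (H * Λ / lam) ^ 2 + ε * b) + 2 * ε) ≤ β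
  β_const : 256 * k + 8 ≤ β

variable {n : ℕ}

/-- The form separates into a part in `U` and a coefficient of `u²`, coupled only by `2 u Dh`. The
left side is what `weight_mul_le` requires, together with `r²u²` for `r = (bT+k)/τ - μd`, the loss
from completing squares. -/
theorem commutator_lower {b Λ lam ε M k H β α α₁ α₂ τ μ κ m T d ψ u Dh : ℝ}
    (hpar : AdmissibleParameters b Λ lam ε M k H β)
    (hα : 0 ≤ α) (hα₁ : β / 2 * α ≤ α₁) (hα₂ : β / 2 * α₁ ≤ α₂) (hτ : 1 ≤ τ) (hτ2 : τ ≤ 2)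
    {x U X V : EuclideanSpace ℝ (Fin n)}
    {A : EuclideanSpace ℝ (Fin n) →L[ℝ] EuclideanSpace ℝ (Fin n)}
    {A' : SpaceTime n →L[ℝ] EuclideanSpace ℝ (Fin n) →L[ℝ] EuclideanSpace ℝ (Fin n)}
    (hx : 1 ≤ ‖x‖) (hX : X = A U) (hV : V = μ • A x) (hm : m = ⟪A x, x⟫)
    (hμ : μ = α - b / τ) (hκ : κ = α / (2 * ‖x‖ ^ 2)) (hψ : ψ = b * ‖x‖ ^ 2 + β)
    (hAs : ∀ y z, ⟪A y, z⟫ = ⟪y, A z⟫) (hA1 : ∀ y, lam * ‖y‖ ^ 2 ≤ ⟪A y, y⟫)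
    (hA2 : ∀ y, ‖A y‖ ≤ Λ * ‖y‖)
    (hA'x : ∀ y z w, |⟪A' (y, 0) z, w⟫| ≤ ε / ‖x‖ * ‖y‖ * ‖z‖ * ‖w‖)
    (hA't : ∀ z w, |⟪A' (0, 1) z, w⟫| ≤ M * ‖z‖ * ‖w‖)
    (hT0 : 0 ≤ T) (hTk : b * T ≤ k) (hd : |d| ≤ ε) (hDh : |Dh| ≤ H * α * ‖X‖) :
    2 * ‖U‖ ^ 2 + (1 + 2 * μ ^ 2 * ‖x‖ ^ 2) * u ^ 2 + ((b * T + k) / τ - μ * d) ^ 2 * u ^ 2 ≤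
      4 * ⟪(-κ * ⟪x, X⟫) • A x + μ • (A' (X, 0) x + A X), U⟫ - 2 * ⟪A' (V, 0) U, U⟫
        + 2 * ((b * T + k) / τ - μ * d) * ⟪X, U⟫ + 2 * u * Dh + ⟪A' (0, 1) U, U⟫
        + (2 * (2 * μ * (-κ * ⟪x, V⟫) * m + μ ^ 2 * (⟪A' (V, 0) x, x⟫ + 2 * ⟪A x, V⟫)
            - (-α₁ + b / τ ^ 2) * ⟪x, V⟫)
          - (2 * μ * (-α₁ + b / τ ^ 2) * m + μ ^ 2 * ⟪A' (0, 1) x, x⟫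
            - (2 / 3 * α₂ * ‖x‖ ^ 2 - ψ / τ ^ 3))
          - 2 * ((b * T + k) / τ - μ * d)
            * (μ ^ 2 * m - (-(2 / 3) * α₁ * ‖x‖ ^ 2 + ψ / (2 * τ ^ 2)))) * u ^ 2 := by
  obtain ⟨hb, hlam, hΛ, hbΛ, hε, hεΛ, hM, hH, hk4, hk1, hk2, hβ1, hβ2, hβ3, hβ4⟩ := hpar
  have hs : 0 < ‖x‖ := by linarith
  have hΛ0 : 0 < Λ := hlam.trans_le hΛ
  have hk0 : 0 ≤ k := by linarith
  have hτ0 : 0 < τ := by linarith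
  have hlow : ∀ y, lam * ‖y‖ ≤ ‖A y‖ := by
    intro y
    rcases eq_or_lt_of_le (norm_nonneg y) with h | h
    · rw [← h]; simp
    · have h1 : lam * ‖y‖ * ‖y‖ ≤ ‖A y‖ * ‖y‖ := by
        calc lam * ‖y‖ * ‖y‖ = lam * ‖y‖ ^ 2 := by ring
          _ ≤ _ := (hA1 y).trans (real_inner_le_norm _ _)
      exact le_of_mul_le_mul_right h1 h
  have hup : ∀ y, ⟪A y, y⟫ ≤ Λ * ‖y‖ ^ 2 := fun y =>
    (real_inner_le_norm _ _).trans (by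
      calc ‖A y‖ * ‖y‖ ≤ Λ * ‖y‖ * ‖y‖ := by gcongr; exact hA2 y
        _ = _ := by ring)
  have hθ : b / τ ≤ b := div_le_self hb.le hτ
  have hθ0 : 0 < b / τ := by positivity
  have hμabs : |μ| ≤ α + b := by
    rw [hμ, abs_le]; constructor <;> linarith
  have hμd : |μ * d| ≤ (α + b) * ε := by rw [abs_mul]; gcongr
  -- zeroth order terms
  have hxV : ⟪x, V⟫ = μ * m := by rw [hV, inner_smul_right, real_inner_comm, hm]
  have hAxV : ⟪A x, V⟫ = μ * ‖A x‖ ^ 2 := by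
    rw [hV, inner_smul_right, real_inner_self_eq_norm_sq]
  have hA'V : ∀ z, A' (V, 0) z = μ • A' (A x, 0) z := fun z => by
    have : ((V, 0) : SpaceTime n) = μ • (A x, 0) := by rw [hV]; simp
    rw [this, map_smul, smul_apply]
  have hj : |⟪A' (A x, 0) x, x⟫| ≤ ε * Λ * ‖x‖ ^ 2 := by
    calc _ ≤ ε / ‖x‖ * ‖A x‖ * ‖x‖ * ‖x‖ := hA'x _ _ _
      _ ≤ ε / ‖x‖ * (Λ * ‖x‖) * ‖x‖ * ‖x‖ := by gcongr; exact hA2 x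
      _ = _ := by field_simp
  have hi : |⟪A' (0, 1) x, x⟫| ≤ M * ‖x‖ ^ 2 := (hA't x x).trans_eq (by ring)
  have hmP : m ^ 2 ≤ ‖x‖ ^ 2 * ‖A x‖ ^ 2 := by
    have := abs_real_inner_le_norm (A x) x
    rw [hm, ← sq_abs]
    calc _ ≤ (‖A x‖ * ‖x‖) ^ 2 := by gcongr
      _ = _ := by ring
  have hP1 : lam ^ 2 * ‖x‖ ^ 2 ≤ ‖A x‖ ^ 2 := by
    rw [← mul_pow]; have := hlow x; gcongr
  have hP2 : ‖A x‖ ^ 2 ≤ Λ ^ 2 * ‖x‖ ^ 2 := by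
    rw [← mul_pow]; have := hA2 x; gcongr
  have hzero := zeroth_order_lower (y := ‖x‖ ^ 2) (P := ‖A x‖ ^ 2)
    hα hα₁ hα₂ hb hτ hτ2 hlam hΛ hbΛ hε hεΛ hM
    (by positivity : 0 ≤ 2 * (H * Λ / lam) ^ 2) hμ hκ hψ (one_le_pow₀ hx)
    (hm ▸ hA1 x) (hm ▸ hup x) hmP hP1 hP2 hT0 hTk hd hi hj hk4 hk2 hβ1 hβ2 hβ3 hβ4
  -- gradient terms
  have hY1 : lam * ‖U‖ ≤ ‖X‖ := hX ▸ hlow U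
  have hY2 : ‖X‖ ≤ Λ * ‖U‖ := hX ▸ hA2 U
  have hgrad := gradient_form_lower (w := |u|) (ℓ := ⟪X, U⟫) (M := M)
    hα hb hτ hτ2 hlam hΛ hbΛ hε hεΛ hk0 (norm_nonneg U) (abs_nonneg u) hH hY1 hY2
    (hX ▸ hA1 U) (hX ▸ hup U) hk1
  rw [sq_abs] at hgrad
  have hℓ0 : 0 ≤ ⟪X, U⟫ := le_trans (by positivity) (hX ▸ hA1 U)
  have g1 : (2 * α - 4 * (b / τ)) * ‖X‖ ^ 2 - 4 * (α + b) * ε * ‖X‖ * ‖U‖ ≤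
      4 * ⟪(-κ * ⟪x, X⟫) • A x + μ • (A' (X, 0) x + A X), U⟫ := by
    have e1 : ⟪A x, U⟫ = ⟪x, X⟫ := by rw [hAs, hX]
    have e2 : ⟪A X, U⟫ = ‖X‖ ^ 2 := by rw [hAs, ← hX, real_inner_self_eq_norm_sq]
    rw [inner_add_left, inner_smul_left, inner_smul_left, inner_add_left, e1, e2]
    simp only [conj_trivial]
    -- Convexity again: in the Hessian of the phase applied to `X = AU`, the radial loss is at most
    -- half of `α|X|²`.
    have h1 : κ * ⟪x, X⟫ ^ 2 ≤ α / 2 * ‖X‖ ^ 2 := by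
      have h2 : ⟪x, X⟫ ^ 2 ≤ (‖x‖ * ‖X‖) ^ 2 := by
        rw [← sq_abs]; have := abs_real_inner_le_norm x X; gcongr
      rw [hκ]
      calc α / (2 * ‖x‖ ^ 2) * ⟪x, X⟫ ^ 2 ≤ α / (2 * ‖x‖ ^ 2) * (‖x‖ * ‖X‖) ^ 2 := by gcongr
        _ = _ := by field_simp
    have h3 : |μ * ⟪A' (X, 0) x, U⟫| ≤ (α + b) * (ε * ‖X‖ * ‖U‖) := by
      rw [abs_mul]
      gcongr
      exact (hA'x _ _ _).trans_eq (by field_simp)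
    have h4 := (abs_le.1 h3).1
    have h5 : μ * ‖X‖ ^ 2 = α * ‖X‖ ^ 2 - b / τ * ‖X‖ ^ 2 := by rw [hμ]; ring
    linarith
  have g2 : 2 * ⟪A' (V, 0) U, U⟫ ≤ 2 * ε * (α + b) * Λ * ‖U‖ ^ 2 := by
    have h1 : |⟪A' (A x, 0) U, U⟫| ≤ ε * Λ * ‖U‖ ^ 2 := by
      calc _ ≤ ε / ‖x‖ * ‖A x‖ * ‖U‖ * ‖U‖ := hA'x _ _ _
        _ ≤ ε / ‖x‖ * (Λ * ‖x‖) * ‖U‖ * ‖U‖ := by gcongr; exact hA2 x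
        _ = _ := by field_simp
    have h2 : |⟪A' (V, 0) U, U⟫| ≤ (α + b) * (ε * Λ * ‖U‖ ^ 2) := by
      rw [hA'V, inner_smul_left, conj_trivial, abs_mul]
      gcongr
    linarith [(abs_le.1 h2).2]
  have g3 : 2 * (k / τ) * ⟪X, U⟫ - 2 * ((α + b) * ε) * ⟪X, U⟫
      ≤ 2 * ((b * T + k) / τ - μ * d) * ⟪X, U⟫ := by
    have h1 : k / τ ≤ (b * T + k) / τ := by
      gcongr; linarith [mul_nonneg hb.le hT0]
    have h2 := (abs_le.1 hμd).2
    have : (k / τ - (α + b) * ε) * ⟪X, U⟫ ≤ ((b * T + k) / τ - μ * d) * ⟪X, U⟫ := by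
      gcongr
    linarith
  have g4 : -(2 * |u| * (H * α * ‖X‖)) ≤ 2 * u * Dh := by
    have : |u * Dh| ≤ |u| * (H * α * ‖X‖) := by rw [abs_mul]; gcongr
    linarith [(abs_le.1 this).1]
  have g5 : -(M * ‖U‖ ^ 2) ≤ ⟪A' (0, 1) U, U⟫ := by
    have h := (abs_le.1 (hA't U U)).1
    linarith [sq ‖U‖, mul_assoc M ‖U‖ ‖U‖]
  have hz2 := mul_nonneg hzero (sq_nonneg u)
  rw [hxV, hAxV, hA'V x, inner_smul_left, conj_trivial]
  linarith

end CommutatorBound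

end ExteriorCarleman

namespace ExteriorCarleman

open scoped RealInnerProductSpace

/-! ### Derivatives of the phase and its radial factors. -/

section WeightCalculus

variable {n : ℕ}

/-- The exponent of the square root of the weight. -/
noncomputable def phase (b β γ : ℝ) (p : SpaceTime n) : ℝ :=
  γ * timeFactor β p.2 * (‖p.1‖ ^ (-1 / 2 : ℝ) * ‖p.1‖ ^ 2) - (b * ‖p.1‖ ^ 2 + β) / (2 * (p.2 + 1))

/-- The convex part of the radial derivative of the phase, divided by the radius. -/
noncomputable def radialConvex (β γ : ℝ) (p : SpaceTime n) : ℝ :=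
  3 / 2 * γ * timeFactor β p.2 * ‖p.1‖ ^ (-1 / 2 : ℝ)

/-- Minus the first time derivative of `radialConvex`. -/
noncomputable def radialConvex₁ (β γ : ℝ) (p : SpaceTime n) : ℝ :=
  3 / 2 * γ * (β * (p.2 + 1) ^ (-β - 1)) * ‖p.1‖ ^ (-1 / 2 : ℝ)

/-- The second time derivative of `radialConvex`. -/
noncomputable def radialConvex₂ (β γ : ℝ) (p : SpaceTime n) : ℝ :=
  3 / 2 * γ * (β * (β + 1) * (p.2 + 1) ^ (-β - 1 - 1)) * ‖p.1‖ ^ (-1 / 2 : ℝ)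

/-- The factor `μ` in `∇ phase = μ x`. -/
noncomputable def radialSlope (b β γ : ℝ) (p : SpaceTime n) : ℝ :=
  radialConvex β γ p - b / (p.2 + 1)

/-- The factor `κ` in `∇ radialSlope = -κ x`. -/
noncomputable def radialCurvature (β γ : ℝ) (p : SpaceTime n) : ℝ :=
  radialConvex β γ p / (2 * ‖p.1‖ ^ 2)

/-- The time derivative of the phase. -/
noncomputable def phaseRate (b β γ : ℝ) (p : SpaceTime n) : ℝ :=
  -(2 / 3) * radialConvex₁ β γ p * ‖p.1‖ ^ 2 + (b * ‖p.1‖ ^ 2 + β) / (2 * (p.2 + 1) ^ 2)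

theorem weight_eq_exp_phase (b β γ : ℝ) (p : SpaceTime n) :
    weight b β γ p = Real.exp (phase b β γ p) ^ 2 := by
  -- Writing `|x|^{3/2}` as `|x|^{-1/2}|x|²` leaves a single fractional power to differentiate. At
  -- the origin both sides are zero.
  have h : ‖p.1‖ ^ (3 / 2 : ℝ) = ‖p.1‖ ^ (-1 / 2 : ℝ) * ‖p.1‖ ^ 2 := by
    rcases eq_or_lt_of_le (norm_nonneg p.1) with h0 | h0
    · rw [← h0, Real.zero_rpow (by norm_num)]; simp
    · rw [← Real.rpow_natCast ‖p.1‖ 2, ← Real.rpow_add h0]; norm_num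
  rw [weight, phase, ← Real.exp_nat_mul, h]
  congr 1
  rw [mul_comm 2 (p.2 + 1), ← div_div]
  push_cast
  ring

theorem hasFDerivAt_norm_rpow_neg_half {x : EuclideanSpace ℝ (Fin n)} (hx : x ≠ 0) :
    HasFDerivAt (fun y : EuclideanSpace ℝ (Fin n) => ‖y‖ ^ (-1 / 2 : ℝ))
      ((-1 / 2 * (‖x‖ ^ (-1 / 2 : ℝ) / ‖x‖ ^ 2)) • innerSL ℝ x) x := by
  have hs : 0 < ‖x‖ := norm_pos_iff.2 hx
  have h1 := (hasStrictFDerivAt_norm_sq x).hasFDerivAt.rpow_const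
    (p := (-1 / 4 : ℝ)) (Or.inl (by positivity))
  -- The power is differentiated as `(|x|²)^{-1/4}`, since `|x|²` is smooth.
  have hpow : ∀ (r : ℝ) (hr : 0 ≤ r), (r ^ 2) ^ (-1 / 4 : ℝ) = r ^ (-1 / 2 : ℝ) := by
    intro r hr
    rw [← Real.rpow_natCast r 2, ← Real.rpow_mul hr]; norm_num
  simp only [hpow _ (norm_nonneg _)] at h1
  refine h1.congr_fderiv ?_
  rw [Real.rpow_sub (by positivity), hpow _ (norm_nonneg _), Real.rpow_one]
  ext y
  simp
  ring

theorem hasDerivAt_timeFactor (β : ℝ) {t : ℝ} (ht : -1 < t) :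
    HasDerivAt (timeFactor β) (-(β * (t + 1) ^ (-β - 1))) t := by
  have h := ((hasDerivAt_id t).add_const 1).rpow_const (p := -β) (Or.inl (by simp; linarith))
  have h' : HasDerivAt (fun s : ℝ => (s + 1) ^ (-β)) (-(β * (t + 1) ^ (-β - 1))) t := by
    simpa using h
  exact h'.sub_const _

theorem hasDerivAt_add_one_rpow (e : ℝ) {t : ℝ} (ht : -1 < t) :
    HasDerivAt (fun s : ℝ => (s + 1) ^ e) (e * (t + 1) ^ (e - 1)) t := by
  have h := ((hasDerivAt_id t).add_const 1).rpow_const (p := e) (Or.inl (by simp; linarith))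
  simpa using h

variable {b β γ : ℝ} {p : SpaceTime n}

/-- The derivatives of the building blocks of the phase. -/
theorem hasFDerivAt_blocks (hx : p.1 ≠ 0) :
    HasFDerivAt (fun q : SpaceTime n => ‖q.1‖ ^ (-1 / 2 : ℝ))
      (((-1 / 2 * (‖p.1‖ ^ (-1 / 2 : ℝ) / ‖p.1‖ ^ 2)) • innerSL ℝ p.1).comp
        (ContinuousLinearMap.fst ℝ _ ℝ)) p ∧
    HasFDerivAt (fun q : SpaceTime n => ‖q.1‖ ^ 2)
      ((2 • innerSL ℝ p.1).comp (ContinuousLinearMap.fst ℝ _ ℝ)) p :=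
  ⟨(hasFDerivAt_norm_rpow_neg_half hx).comp p hasFDerivAt_fst,
    (hasStrictFDerivAt_norm_sq p.1).hasFDerivAt.comp p hasFDerivAt_fst⟩

theorem hasFDerivAt_time {g : ℝ → ℝ} {g' : ℝ} (h : HasDerivAt g g' p.2) :
    HasFDerivAt (fun q : SpaceTime n => g q.2)
      (((1 : ℝ →L[ℝ] ℝ).smulRight g').comp (ContinuousLinearMap.snd ℝ _ ℝ)) p :=
  h.hasFDerivAt.comp p hasFDerivAt_snd

theorem hasDerivAt_inv_add_one {t : ℝ} (ht : -1 < t) :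
    HasDerivAt (fun s : ℝ => (s + 1)⁻¹) (-1 / (t + 1) ^ 2) t := by
  exact ((hasDerivAt_id t).add_const 1).fun_inv (by simp; linarith)

theorem hasFDerivAt_phase (hx : p.1 ≠ 0) (ht : -1 < p.2) :
    ∃ L : SpaceTime n →L[ℝ] ℝ, HasFDerivAt (phase b β γ) L p ∧
      (∀ y, L (y, 0) = radialSlope b β γ p * ⟪p.1, y⟫) ∧ L (0, 1) = phaseRate b β γ p := by
  obtain ⟨h1, h2⟩ := hasFDerivAt_blocks hx
  have h3 := hasFDerivAt_time (hasDerivAt_timeFactor β ht)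
  have h4 := hasFDerivAt_time (hasDerivAt_inv_add_one ht)
  have hs : ‖p.1‖ ≠ 0 := norm_ne_zero_iff.2 hx
  have ht' : p.2 + 1 ≠ 0 := by linarith
  have h := ((h3.const_mul γ).mul (h1.mul h2)).sub ((((h2.const_mul b).add_const β).mul h4).const_mul (1 / 2))
  refine ⟨_, (h.congr_of_eventuallyEq (Filter.Eventually.of_forall fun q => ?_)), fun y => ?_, ?_⟩
  · simp only [phase, Pi.sub_apply, Pi.mul_apply, mul_comm (2 : ℝ) (q.2 + 1), ← div_div]
    ring
  · simp [radialSlope, radialConvex]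
    field_simp
    ring
  · simp [phaseRate, radialConvex₁]
    field_simp
    ring

theorem hasFDerivAt_radialConvex (hx : p.1 ≠ 0) (ht : -1 < p.2) :
    ∃ L : SpaceTime n →L[ℝ] ℝ, HasFDerivAt (radialConvex β γ) L p ∧
      (∀ y, L (y, 0) = -radialCurvature β γ p * ⟪p.1, y⟫) ∧
        L (0, 1) = -radialConvex₁ β γ p := by
  obtain ⟨h1, -⟩ := hasFDerivAt_blocks hx
  have h3 := hasFDerivAt_time (hasDerivAt_timeFactor β ht)
  have hs : ‖p.1‖ ≠ 0 := norm_ne_zero_iff.2 hx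
  refine ⟨_, (h3.const_mul (3 / 2 * γ)).mul h1, fun y => ?_, ?_⟩
  · simp [radialCurvature, radialConvex]
    field_simp
  · simp [radialConvex₁]
    ring

theorem hasFDerivAt_radialConvex₁ (hx : p.1 ≠ 0) (ht : -1 < p.2) :
    ∃ L : SpaceTime n →L[ℝ] ℝ, HasFDerivAt (radialConvex₁ β γ) L p ∧
      (∀ y, L (y, 0) = -(radialConvex₁ β γ p / (2 * ‖p.1‖ ^ 2)) * ⟪p.1, y⟫) ∧
        L (0, 1) = -radialConvex₂ β γ p := by
  obtain ⟨h1, -⟩ := hasFDerivAt_blocks hx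
  have h3 := hasFDerivAt_time (hasDerivAt_add_one_rpow (-β - 1) ht)
  have hs : ‖p.1‖ ≠ 0 := norm_ne_zero_iff.2 hx
  refine ⟨_, ((h3.const_mul β).const_mul (3 / 2 * γ)).mul h1, fun y => ?_, ?_⟩
  · simp [radialConvex₁]
    field_simp
  · simp [radialConvex₂]
    ring

theorem hasFDerivAt_radialSlope (hx : p.1 ≠ 0) (ht : -1 < p.2) :
    ∃ L : SpaceTime n →L[ℝ] ℝ, HasFDerivAt (radialSlope b β γ) L p ∧
      (∀ y, L (y, 0) = -radialCurvature β γ p * ⟪p.1, y⟫) ∧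
        L (0, 1) = -radialConvex₁ β γ p + b / (p.2 + 1) ^ 2 := by
  obtain ⟨L, h, hy, h1⟩ := hasFDerivAt_radialConvex (β := β) (γ := γ) hx ht
  have h4 := hasFDerivAt_time (p := p) (hasDerivAt_inv_add_one ht)
  refine ⟨_, (h.sub (h4.const_mul b)).congr_of_eventuallyEq
    (Filter.Eventually.of_forall fun q => ?_), fun y => ?_, ?_⟩
  · simp [radialSlope, div_eq_mul_inv]
  · simp [hy]
  · simp [h1]
    ring

theorem hasFDerivAt_radialCurvature (hx : p.1 ≠ 0) (ht : -1 < p.2) :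
    ∃ L : SpaceTime n →L[ℝ] ℝ, HasFDerivAt (radialCurvature β γ) L p ∧
      (∀ y, L (y, 0) = -(5 / 2 * radialCurvature β γ p / ‖p.1‖ ^ 2) * ⟪p.1, y⟫) := by
  obtain ⟨L, h, hy, -⟩ := hasFDerivAt_radialConvex (β := β) (γ := γ) hx ht
  have h2 := (hasFDerivAt_blocks hx).2
  have hs : ‖p.1‖ ≠ 0 := norm_ne_zero_iff.2 hx
  have h5 := (hasDerivAt_inv (pow_ne_zero 2 hs)).comp_hasFDerivAt p h2
  refine ⟨_, ((h.mul h5).const_mul (1 / 2)).congr_of_eventuallyEq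
    (Filter.Eventually.of_forall fun q => ?_), fun y => ?_⟩
  · simp [radialCurvature, div_eq_mul_inv]
    ring
  · simp [hy]
    simp only [radialCurvature]
    field_simp
    ring

theorem hasFDerivAt_phaseRate (hx : p.1 ≠ 0) (ht : -1 < p.2) :
    ∃ L : SpaceTime n →L[ℝ] ℝ, HasFDerivAt (phaseRate b β γ) L p ∧
      (∀ y, L (y, 0) = (-radialConvex₁ β γ p + b / (p.2 + 1) ^ 2) * ⟪p.1, y⟫) ∧
        L (0, 1) = 2 / 3 * radialConvex₂ β γ p * ‖p.1‖ ^ 2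
          - (b * ‖p.1‖ ^ 2 + β) / (p.2 + 1) ^ 3 := by
  obtain ⟨L, h, hy, hL1⟩ := hasFDerivAt_radialConvex₁ (β := β) (γ := γ) hx ht
  have h2 := (hasFDerivAt_blocks hx).2
  have h4 := hasFDerivAt_time (p := p) (hasDerivAt_inv_add_one ht)
  have hs : ‖p.1‖ ≠ 0 := norm_ne_zero_iff.2 hx
  have ht' : p.2 + 1 ≠ 0 := by linarith
  refine ⟨_, (((h.const_mul (-(2 / 3))).mul h2).add
    ((((h2.const_mul b).add_const β).mul (h4.pow 2)).const_mul (1 / 2))).congr_of_eventuallyEq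
    (Filter.Eventually.of_forall fun q => ?_), fun y => ?_, ?_⟩
  · simp only [phaseRate, Pi.add_apply, Pi.mul_apply, div_eq_mul_inv, mul_inv, inv_pow]
    ring
  · simp [hy]
    field_simp
    ring
  · simp [hL1]
    field_simp
    ring

theorem contDiffAt_norm_rpow (hx : p.1 ≠ 0) (e : ℝ) :
    ContDiffAt ℝ ∞ (fun q : SpaceTime n => ‖q.1‖ ^ e) p :=
  (contDiffAt_fst.norm ℝ hx).rpow_const_of_ne (norm_ne_zero_iff.2 hx)

theorem contDiffAt_add_one_rpow (ht : -1 < p.2) (e : ℝ) :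
    ContDiffAt ℝ ∞ (fun q : SpaceTime n => (q.2 + 1) ^ e) p :=
  (contDiffAt_snd.add contDiffAt_const).rpow_const_of_ne (by simp; linarith)

theorem contDiffAt_phase (hx : p.1 ≠ 0) (ht : -1 < p.2) :
    ContDiffAt ℝ ∞ (phase (n := n) b β γ) p := by
  have h1 := contDiffAt_norm_rpow hx (-1 / 2)
  have h2 : ContDiffAt ℝ ∞ (fun q : SpaceTime n => ‖q.1‖ ^ 2) p := contDiffAt_fst.norm_sq ℝ
  have h3 := contDiffAt_add_one_rpow ht (-β)
  have h4 : ContDiffAt ℝ ∞ (fun q : SpaceTime n => 2 * (q.2 + 1)) p := by fun_prop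
  exact ((contDiffAt_const.mul (h3.sub contDiffAt_const)).mul (h1.mul h2)).sub
    (((contDiffAt_const.mul h2).add contDiffAt_const).div h4 (by linarith))

theorem contDiffAt_radialConvex (hx : p.1 ≠ 0) (ht : -1 < p.2) :
    ContDiffAt ℝ ∞ (radialConvex (n := n) β γ) p :=
  (contDiffAt_const.mul ((contDiffAt_add_one_rpow ht (-β)).sub contDiffAt_const)).mul
    (contDiffAt_norm_rpow hx (-1 / 2))

theorem contDiffAt_radialConvex₁ (hx : p.1 ≠ 0) (ht : -1 < p.2) :
    ContDiffAt ℝ ∞ (radialConvex₁ (n := n) β γ) p :=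
  (contDiffAt_const.mul (contDiffAt_const.mul (contDiffAt_add_one_rpow ht (-β - 1)))).mul
    (contDiffAt_norm_rpow hx (-1 / 2))

theorem contDiffAt_radialSlope (hx : p.1 ≠ 0) (ht : -1 < p.2) :
    ContDiffAt ℝ ∞ (radialSlope (n := n) b β γ) p :=
  (contDiffAt_radialConvex hx ht).sub
    (contDiffAt_const.div (contDiffAt_snd.add contDiffAt_const) (by simp; linarith))

theorem contDiffAt_radialCurvature (hx : p.1 ≠ 0) (ht : -1 < p.2) :
    ContDiffAt ℝ ∞ (radialCurvature (n := n) β γ) p :=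
  (contDiffAt_radialConvex hx ht).div (contDiffAt_const.mul (contDiffAt_fst.norm_sq ℝ))
    (by simpa using hx)

theorem contDiffAt_phaseRate (hx : p.1 ≠ 0) (ht : -1 < p.2) :
    ContDiffAt ℝ ∞ (phaseRate (n := n) b β γ) p := by
  have h2 : ContDiffAt ℝ ∞ (fun q : SpaceTime n => ‖q.1‖ ^ 2) p := contDiffAt_fst.norm_sq ℝ
  have h4 : ContDiffAt ℝ ∞ (fun q : SpaceTime n => 2 * (q.2 + 1) ^ 2) p := by fun_prop
  have h5 : p.2 + 1 ≠ 0 := by linarith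
  exact ((contDiffAt_const.mul (contDiffAt_radialConvex₁ hx ht)).mul h2).add
    (((contDiffAt_const.mul h2).add contDiffAt_const).div h4 (by positivity))

theorem timeFactor_nonneg (hβ : 0 ≤ β) {t : ℝ} (ht0 : 0 ≤ t) (ht1 : t ≤ 1) :
    0 ≤ timeFactor β t :=
  sub_nonneg.2 (Real.rpow_le_rpow_of_nonpos (by linarith) (by linarith) (by linarith))

theorem radialConvex_nonneg (hβ : 0 ≤ β) (hγ : 0 ≤ γ) (ht0 : 0 ≤ p.2) (ht1 : p.2 ≤ 1) :
    0 ≤ radialConvex β γ p := by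
  have := timeFactor_nonneg hβ ht0 ht1
  rw [radialConvex]; positivity

/-- Since `t + 1 ≤ 2`, `f ≤ (t+1)^{-β} ≤ 2(t+1)^{-β-1}`: a time derivative gains the factor `β/2`.
-/
theorem radialConvex_le (hβ : 0 ≤ β) (hγ : 0 ≤ γ) (ht0 : 0 ≤ p.2) (ht1 : p.2 ≤ 1) :
    β / 2 * radialConvex β γ p ≤ radialConvex₁ β γ p := by
  have ht : 0 < p.2 + 1 := by linarith
  have h1 : 1 / 2 * timeFactor β p.2 ≤ (p.2 + 1) ^ (-β - 1) := by
    rw [Real.rpow_sub ht, Real.rpow_one, timeFactor, le_div_iff₀ ht]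
    have h2 : 0 < (2 : ℝ) ^ (-β) := by positivity
    have h3 : 0 < (p.2 + 1) ^ (-β) := by positivity
    have := timeFactor_nonneg hβ ht0 ht1
    rw [timeFactor] at this
    nlinarith
  rw [radialConvex, radialConvex₁]
  calc _ = 3 / 2 * γ * (β * (1 / 2 * timeFactor β p.2)) * ‖p.1‖ ^ (-1 / 2 : ℝ) := by ring
    _ ≤ _ := by gcongr

theorem radialConvex₁_le (hβ : 0 ≤ β) (hγ : 0 ≤ γ) (ht0 : 0 ≤ p.2) (ht1 : p.2 ≤ 1) :
    β / 2 * radialConvex₁ β γ p ≤ radialConvex₂ β γ p := by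
  have ht : 0 < p.2 + 1 := by linarith
  have h1 : 1 / 2 * (p.2 + 1) ^ (-β - 1) ≤ (p.2 + 1) ^ (-β - 1 - 1) := by
    rw [Real.rpow_sub_one ht.ne' (-β - 1), le_div_iff₀ ht]
    have h3 : 0 < (p.2 + 1) ^ (-β - 1) := by positivity
    nlinarith
  rw [radialConvex₁, radialConvex₂]
  calc _ = 3 / 2 * γ * (β * β * (1 / 2 * (p.2 + 1) ^ (-β - 1))) * ‖p.1‖ ^ (-1 / 2 : ℝ) := by ring
    _ ≤ _ := by gcongr; linarith

end WeightCalculus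

end ExteriorCarleman

namespace ExteriorCarleman

open scoped RealInnerProductSpace

/-! ### Partial derivatives in terms of the Fréchet derivative. -/

section Partials

variable {n : ℕ} {f : SpaceTime n → ℝ} {p : SpaceTime n}

theorem hasFDerivAt_slice_space (hf : DifferentiableAt ℝ f p) :
    HasFDerivAt (fun y => f (y, p.2)) ((fderiv ℝ f p).comp (ContinuousLinearMap.inl ℝ _ ℝ)) p.1 :=
  HasFDerivAt.comp (f := fun y => (y, p.2)) p.1 hf.hasFDerivAt (hasFDerivAt_prodMk_left p.1 p.2)

theorem hasDerivAt_slice_time (hf : DifferentiableAt ℝ f p) :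
    HasDerivAt (fun s => f (p.1, s)) (fderiv ℝ f p (0, 1)) p.2 := by
  have h : HasFDerivAt (fun s => f (p.1, s))
      ((fderiv ℝ f p).comp (ContinuousLinearMap.inr ℝ _ ℝ)) p.2 :=
    HasFDerivAt.comp (f := fun s => (p.1, s)) p.2 hf.hasFDerivAt (hasFDerivAt_prodMk_right p.1 p.2)
  simpa using h.hasDerivAt

theorem inner_spaceGrad (hf : DifferentiableAt ℝ f p) (y : EuclideanSpace ℝ (Fin n)) :
    ⟪spaceGrad f p, y⟫ = fderiv ℝ f p (y, 0) := by
  rw [spaceGrad, gradient, (hasFDerivAt_slice_space hf).fderiv,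
    InnerProductSpace.toDual_symm_apply]
  simp

theorem spaceDeriv_eq (hf : DifferentiableAt ℝ f p) (i : Fin n) :
    spaceDeriv i f p = fderiv ℝ f p (EuclideanSpace.single i 1, 0) := by
  rw [spaceDeriv, ((hasFDerivAt_slice_space hf).hasLineDerivAt _).lineDeriv]
  simp

theorem timeDeriv_eq (hf : DifferentiableAt ℝ f p) : timeDeriv f p = fderiv ℝ f p (0, 1) :=
  (hasDerivAt_slice_time hf).deriv

theorem abs_fderiv_space_le (hf : DifferentiableAt ℝ f p) (y : EuclideanSpace ℝ (Fin n)) :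
    |fderiv ℝ f p (y, 0)| ≤ ‖spaceGrad f p‖ * ‖y‖ := by
  rw [← inner_spaceGrad hf]
  exact abs_real_inner_le_norm _ _

end Partials

/-! ### The coefficient matrix as an operator, and bounds on its derivatives. -/

section Coefficients

variable {n : ℕ}

/-- The matrix unit with entry `1` at `(i, j)`, as a linear map. -/
noncomputable def matrixUnit (i j : Fin n) :
    EuclideanSpace ℝ (Fin n) →L[ℝ] EuclideanSpace ℝ (Fin n) :=
  (EuclideanSpace.proj j : EuclideanSpace ℝ (Fin n) →L[ℝ] ℝ).smulRight (EuclideanSpace.single i 1)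

/-- The coefficient matrix as a linear map. -/
noncomputable def coeffMap (a : SpaceTime n → Matrix (Fin n) (Fin n) ℝ) (p : SpaceTime n) :
    EuclideanSpace ℝ (Fin n) →L[ℝ] EuclideanSpace ℝ (Fin n) :=
  ∑ i, ∑ j, a p i j • matrixUnit i j

/-- The derivative of `coeffMap`. -/
noncomputable def coeffDeriv (a : SpaceTime n → Matrix (Fin n) (Fin n) ℝ) (p : SpaceTime n) :
    SpaceTime n →L[ℝ] EuclideanSpace ℝ (Fin n) →L[ℝ] EuclideanSpace ℝ (Fin n) :=
  ∑ i, ∑ j, (fderiv ℝ (fun q => a q i j) p).smulRight (matrixUnit i j)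

theorem sum_matrixUnit_apply (c : Fin n → Fin n → ℝ) (ξ : EuclideanSpace ℝ (Fin n)) (l : Fin n) :
    (∑ i, ∑ j, c i j • matrixUnit i j) ξ l = ∑ j, c l j * ξ j := by
  simp [matrixUnit, Finset.sum_apply, Pi.single_apply]

theorem inner_sum_matrixUnit (c : Fin n → Fin n → ℝ) (ξ η : EuclideanSpace ℝ (Fin n)) :
    ⟪(∑ i, ∑ j, c i j • matrixUnit i j) ξ, η⟫ = ∑ i, ∑ j, c i j * ξ j * η i := by
  rw [PiLp.inner_apply]
  refine Finset.sum_congr rfl fun i _ => ?_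
  rw [sum_matrixUnit_apply]
  simp [Finset.mul_sum, mul_comm]

/-- Counting entries is enough, and it is the source of the factor `n²` attached to `E` and `M` in
the parameters. -/
theorem abs_inner_sum_matrixUnit_le {c : Fin n → Fin n → ℝ} {B : ℝ} (hB : ∀ i j, |c i j| ≤ B)
    (ξ η : EuclideanSpace ℝ (Fin n)) :
    |⟪(∑ i, ∑ j, c i j • matrixUnit i j) ξ, η⟫| ≤ n ^ 2 * B * ‖ξ‖ * ‖η‖ := by
  rw [inner_sum_matrixUnit]
  have h1 : ∀ i j, |c i j * ξ j * η i| ≤ B * ‖ξ‖ * ‖η‖ := fun i j => by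
    have hB0 := (abs_nonneg _).trans (hB i j)
    rw [abs_mul, abs_mul]
    have h2 : |ξ j| ≤ ‖ξ‖ := PiLp.norm_apply_le ξ j
    have h3 : |η i| ≤ ‖η‖ := PiLp.norm_apply_le η i
    gcongr
    exact hB i j
  calc _ ≤ ∑ i, ∑ j, |c i j * ξ j * η i| :=
        (Finset.abs_sum_le_sum_abs _ _).trans
          (Finset.sum_le_sum fun i _ => Finset.abs_sum_le_sum_abs _ _)
    _ ≤ ∑ _i : Fin n, ∑ _j : Fin n, B * ‖ξ‖ * ‖η‖ :=
        Finset.sum_le_sum fun i _ => Finset.sum_le_sum fun j _ => h1 i j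
    _ = _ := by simp; ring

variable {a : SpaceTime n → Matrix (Fin n) (Fin n) ℝ} {p : SpaceTime n} {Λ lam M E : ℝ}

theorem coeffMap_apply (ξ : EuclideanSpace ℝ (Fin n)) (l : Fin n) :
    coeffMap a p ξ l = ∑ j, a p l j * ξ j := sum_matrixUnit_apply _ _ _

theorem inner_coeffMap (ξ η : EuclideanSpace ℝ (Fin n)) :
    ⟪coeffMap a p ξ, η⟫ = ∑ i, ∑ j, a p i j * ξ j * η i := inner_sum_matrixUnit _ _ _

theorem coeffDeriv_apply (w : SpaceTime n) :
    coeffDeriv a p w = ∑ i, ∑ j, fderiv ℝ (fun q => a q i j) p w • matrixUnit i j := by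
  simp [coeffDeriv]

theorem hasFDerivAt_coeffMap (h : ∀ i j, DifferentiableAt ℝ (fun q => a q i j) p) :
    HasFDerivAt (coeffMap a) (coeffDeriv a p) p :=
  HasFDerivAt.fun_sum fun i _ => HasFDerivAt.fun_sum fun j _ =>
    (h i j).hasFDerivAt.smul_const (matrixUnit i j)

theorem IsCoefficient.inner_comm (ha : IsCoefficient Λ lam M E a) (hp : p ∈ cylinder n)
    (y z : EuclideanSpace ℝ (Fin n)) : ⟪coeffMap a p y, z⟫ = ⟪y, coeffMap a p z⟫ := by
  rw [real_inner_comm (coeffMap a p z) y, inner_coeffMap, inner_coeffMap,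
    Finset.sum_comm]
  refine Finset.sum_congr rfl fun i _ => Finset.sum_congr rfl fun j _ => ?_
  rw [(ha.symm p hp).apply i j]
  ring

theorem inner_coeffMap_self (y : EuclideanSpace ℝ (Fin n)) :
    ⟪coeffMap a p y, y⟫ = ∑ i, ∑ j, a p i j * y i * y j := by
  rw [inner_coeffMap]
  exact Finset.sum_congr rfl fun i _ => Finset.sum_congr rfl fun j _ => by ring

theorem IsCoefficient.le_inner (ha : IsCoefficient Λ lam M E a) (hp : p ∈ cylinder n)
    (y : EuclideanSpace ℝ (Fin n)) : lam * ‖y‖ ^ 2 ≤ ⟪coeffMap a p y, y⟫ := by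
  rw [inner_coeffMap_self]; exact ha.lower p hp y

theorem IsCoefficient.inner_le (ha : IsCoefficient Λ lam M E a) (hp : p ∈ cylinder n)
    (y : EuclideanSpace ℝ (Fin n)) : ⟪coeffMap a p y, y⟫ ≤ Λ * ‖y‖ ^ 2 := by
  rw [inner_coeffMap_self]; exact ha.upper p hp y

/-- Polarization: for `z = Λ⁻¹Ay`, the difference of the quadratic form at `y + z` and at `y - z` is
`4Λ|z|²`. It is at most `Λ(|y| + |z|)²`, so `2|z| ≤ |y| + |z|`. -/
theorem IsCoefficient.norm_le (hlam : 0 < lam) (hΛ : lam ≤ Λ) (ha : IsCoefficient Λ lam M E a)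
    (hp : p ∈ cylinder n) (y : EuclideanSpace ℝ (Fin n)) : ‖coeffMap a p y‖ ≤ Λ * ‖y‖ := by
  have hΛ0 : 0 < Λ := hlam.trans_le hΛ
  set z := Λ⁻¹ • coeffMap a p y with hz
  have hAz : coeffMap a p y = Λ • z := by rw [hz, smul_smul, mul_inv_cancel₀ hΛ0.ne', one_smul]
  have h1 := ha.inner_le hp (y + z)
  have h2 := (ha.le_inner hp (y - z)).trans' (by positivity)
  rw [map_add, inner_add_left, inner_add_right, inner_add_right] at h1
  rw [map_sub, inner_sub_left, inner_sub_right, inner_sub_right] at h2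
  have h3 : ⟪coeffMap a p z, y⟫ = ⟪coeffMap a p y, z⟫ := by
    rw [ha.inner_comm hp, real_inner_comm]
  have h4 : ⟪coeffMap a p y, z⟫ = Λ * ‖z‖ ^ 2 := by
    rw [hAz, inner_smul_left, real_inner_self_eq_norm_sq]; simp
  have h5 : Λ * (4 * ‖z‖ ^ 2) ≤ Λ * (‖y‖ + ‖z‖) ^ 2 := by
    have : Λ * ‖y + z‖ ^ 2 ≤ Λ * (‖y‖ + ‖z‖) ^ 2 := by gcongr; exact norm_add_le _ _
    linarith
  have h6 : (2 * ‖z‖) ^ 2 ≤ (‖y‖ + ‖z‖) ^ 2 := by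
    have := le_of_mul_le_mul_left h5 hΛ0
    linarith [mul_pow 2 ‖z‖ 2]
  have h7 := abs_le_of_sq_le_sq h6 (by positivity)
  rw [hAz, norm_smul, Real.norm_of_nonneg hΛ0.le]
  gcongr
  rw [abs_of_nonneg (by positivity)] at h7
  linarith

theorem IsCoefficient.diag (ha : IsCoefficient Λ lam M E a) (hp : p ∈ cylinder n) (i : Fin n) :
    lam ≤ a p i i ∧ a p i i ≤ Λ := by
  have h : ⟪coeffMap a p (EuclideanSpace.single i 1), EuclideanSpace.single i 1⟫ = a p i i := by
    rw [inner_coeffMap_self]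
    simp
  have h1 := ha.le_inner hp (EuclideanSpace.single i 1)
  have h2 := ha.inner_le hp (EuclideanSpace.single i 1)
  rw [h] at h1 h2
  simpa using And.intro h1 h2

/-- The trace of the coefficient matrix. -/
noncomputable def coeffTrace (a : SpaceTime n → Matrix (Fin n) (Fin n) ℝ) (p : SpaceTime n) : ℝ :=
  ∑ i, a p i i

theorem IsCoefficient.trace (hlam : 0 < lam) (ha : IsCoefficient Λ lam M E a)
    (hp : p ∈ cylinder n) : 0 ≤ coeffTrace a p ∧ coeffTrace a p ≤ n * Λ := by
  refine ⟨Finset.sum_nonneg fun i _ => hlam.le.trans (ha.diag hp i).1, ?_⟩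
  calc coeffTrace a p ≤ ∑ _i : Fin n, Λ := Finset.sum_le_sum fun i _ => (ha.diag hp i).2
    _ = _ := by simp

/-- The points at which the coefficients are differentiable with the assumed bounds. -/
structure RegularPoint (M E : ℝ) (a : SpaceTime n → Matrix (Fin n) (Fin n) ℝ) (p : SpaceTime n) :
    Prop where
  diff : ∀ i j, DifferentiableAt ℝ (fun q => a q i j) p
  space : ∀ i j y, |fderiv ℝ (fun q => a q i j) p (y, 0)| ≤ E / ‖p.1‖ * ‖y‖
  time : ∀ i j, |fderiv ℝ (fun q => a q i j) p (0, 1)| ≤ M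

theorem RegularPoint.abs_inner_space_le (h : RegularPoint M E a p)
    (y z w : EuclideanSpace ℝ (Fin n)) :
    |⟪coeffDeriv a p (y, 0) z, w⟫| ≤ n ^ 2 * E / ‖p.1‖ * ‖y‖ * ‖z‖ * ‖w‖ := by
  rw [coeffDeriv_apply]
  refine (abs_inner_sum_matrixUnit_le (fun i j => h.space i j y) z w).trans_eq ?_
  ring

theorem RegularPoint.abs_inner_time_le (h : RegularPoint M E a p)
    (z w : EuclideanSpace ℝ (Fin n)) :
    |⟪coeffDeriv a p (0, 1) z, w⟫| ≤ n ^ 2 * M * ‖z‖ * ‖w‖ := by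
  rw [coeffDeriv_apply]
  exact abs_inner_sum_matrixUnit_le (fun i j => h.time i j) z w

theorem RegularPoint.abs_divergence_le (hE : 0 ≤ E) (hx : p.1 ≠ 0) (h : RegularPoint M E a p) :
    |divergence ((coeffDeriv a p).flip p.1)| ≤ n ^ 2 * E := by
  have hs : 0 < ‖p.1‖ := norm_pos_iff.2 hx
  have h1 : ∀ i j : Fin n,
      |fderiv ℝ (fun q => a q i j) p (EuclideanSpace.single i 1, 0) * p.1 j| ≤ E := by
    intro i j
    have h2 := h.space i j (EuclideanSpace.single i 1)
    have h3 : |p.1 j| ≤ ‖p.1‖ := PiLp.norm_apply_le p.1 j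
    rw [abs_mul]
    calc _ ≤ E / ‖p.1‖ * ‖(EuclideanSpace.single i 1 : EuclideanSpace ℝ (Fin n))‖ * ‖p.1‖ := by
          gcongr
      _ = E := by simp; field_simp
  have h4 : divergence ((coeffDeriv a p).flip p.1) =
      ∑ i, ∑ j, fderiv ℝ (fun q => a q i j) p (EuclideanSpace.single i 1, 0) * p.1 j := by
    refine Finset.sum_congr rfl fun i _ => ?_
    rw [ContinuousLinearMap.flip_apply, coeffDeriv_apply, sum_matrixUnit_apply]
  rw [h4]
  calc _ ≤ ∑ i, ∑ j, |fderiv ℝ (fun q => a q i j) p (EuclideanSpace.single i 1, 0) * p.1 j| :=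
        (Finset.abs_sum_le_sum_abs _ _).trans
          (Finset.sum_le_sum fun i _ => Finset.abs_sum_le_sum_abs _ _)
    _ ≤ ∑ _i : Fin n, ∑ _j : Fin n, E :=
        Finset.sum_le_sum fun i _ => Finset.sum_le_sum fun j _ => h1 i j
    _ = _ := by simp; ring

theorem RegularPoint.hasFDerivAt_trace (hE : 0 ≤ E) (h : RegularPoint M E a p) :
    ∃ L : SpaceTime n →L[ℝ] ℝ, HasFDerivAt (coeffTrace a) L p ∧
      ∀ y, |L (y, 0)| ≤ n ^ 2 * E / ‖p.1‖ * ‖y‖ := by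
  refine ⟨∑ i, fderiv ℝ (fun q => a q i i) p,
    HasFDerivAt.fun_sum fun i _ => (h.diff i i).hasFDerivAt, fun y => ?_⟩
  have hn : (n : ℝ) ≤ n ^ 2 := by
    rcases Nat.eq_zero_or_pos n with h0 | h0
    · simp [h0]
    · have : (1 : ℝ) ≤ n := by exact_mod_cast h0
      nlinarith
  rw [sum_apply]
  calc _ ≤ ∑ i, |fderiv ℝ (fun q => a q i i) p (y, 0)| := Finset.abs_sum_le_sum_abs _ _
    _ ≤ ∑ _i : Fin n, E / ‖p.1‖ * ‖y‖ := Finset.sum_le_sum fun i _ => h.space i i y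
    _ = n * (E / ‖p.1‖ * ‖y‖) := by simp
    _ ≤ n ^ 2 * (E / ‖p.1‖ * ‖y‖) := by gcongr
    _ = _ := by ring

theorem divergence_coeff :
    divergence ((coeffMap a p).comp (ContinuousLinearMap.fst ℝ _ ℝ)) = coeffTrace a p := by
  refine Finset.sum_congr rfl fun i _ => ?_
  simp [coeffMap_apply]

theorem locallyLipschitzOn_coeffMap (ha : IsCoefficient Λ lam M E a) :
    LocallyLipschitzOn (cylinder n) (coeffMap a) := by
  refine locallyLipschitzOn_sum _ fun i _ => locallyLipschitzOn_sum _ fun j _ => ?_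
  exact locallyLipschitzOn_comp (contDiff_locallyLipschitz
    (Φ := fun r : ℝ => r • (matrixUnit i j)) (by fun_prop)) (ha.lipschitz i j)

theorem locallyLipschitzOn_coeffTrace (ha : IsCoefficient Λ lam M E a) :
    LocallyLipschitzOn (cylinder n) (coeffTrace a) :=
  locallyLipschitzOn_sum _ fun i _ => ha.lipschitz i i

end Coefficients

end ExteriorCarleman

namespace ExteriorCarleman

open scoped RealInnerProductSpace

/-! ### The conjugated function, the multiplier, the flux and the energy. -/

section Conjugation

variable {n : ℕ}

theorem spaceGrad_eq_toDual_symm {v : SpaceTime n → ℝ} (hv : ContDiff ℝ ∞ v) :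
    spaceGrad v = fun z => (InnerProductSpace.toDual ℝ (EuclideanSpace ℝ (Fin n))).symm
      ((fderiv ℝ v z).comp (ContinuousLinearMap.inl ℝ _ ℝ)) := by
  funext z
  rw [spaceGrad, gradient, (hasFDerivAt_slice_space (hv.differentiable (by simp) z)).fderiv]

theorem contDiff_spaceGrad {v : SpaceTime n → ℝ} (hv : ContDiff ℝ ∞ v) :
    ContDiff ℝ ∞ (spaceGrad v) := by
  rw [spaceGrad_eq_toDual_symm hv]
  have h1 : ContDiff ℝ ∞ (fderiv ℝ v) := hv.fderiv_right (by simp)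
  exact (InnerProductSpace.toDual ℝ (EuclideanSpace ℝ (Fin n))).symm.contDiff.comp
    (h1.clm_comp contDiff_const)

theorem contDiff_fderiv_apply {v : SpaceTime n → ℝ} (hv : ContDiff ℝ ∞ v) (w : SpaceTime n) :
    ContDiff ℝ ∞ (fun z => fderiv ℝ v z w) :=
  ContDiff.clm_apply (hv.fderiv_right (by simp)) contDiff_const

theorem second_derivatives {v : SpaceTime n → ℝ} (hv : ContDiff ℝ ∞ v) (p : SpaceTime n) :
    (∀ y z, ⟪fderiv ℝ (spaceGrad v) p (y, 0), z⟫ = ⟪fderiv ℝ (spaceGrad v) p (z, 0), y⟫) ∧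
    (∀ y, fderiv ℝ (fun z => fderiv ℝ v z (0, 1)) p (y, 0) =
      ⟪fderiv ℝ (spaceGrad v) p (0, 1), y⟫) := by
  have hd : DifferentiableAt ℝ (fderiv ℝ v) p :=
    ((hv.fderiv_right (m := ∞) (by simp)).differentiable (by simp)) p
  have hG : DifferentiableAt ℝ (spaceGrad v) p :=
    ((contDiff_spaceGrad hv).differentiable (by simp)) p
  have hs : IsSymmSndFDerivAt ℝ v p := hv.contDiffAt.isSymmSndFDerivAt (by
    rw [minSmoothness_of_isRCLikeNormedField]; exact WithTop.coe_le_coe.2 (le_top : (2 : ℕ∞) ≤ ⊤))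
  have h1 : ∀ w y, ⟪fderiv ℝ (spaceGrad v) p w, y⟫ = fderiv ℝ (fderiv ℝ v) p w (y, 0) := by
    intro w y
    have e1 : (fun z => ⟪spaceGrad v z, y⟫) = fun z => fderiv ℝ v z (y, 0) :=
      funext fun z => inner_spaceGrad (hv.differentiable (by simp) z) y
    have e2 := (hG.hasFDerivAt.inner ℝ (hasFDerivAt_const y p)).fderiv
    have e3 := (hd.hasFDerivAt.clm_apply (hasFDerivAt_const ((y, 0) : SpaceTime n) p)).fderiv
    rw [e1, e3] at e2
    have := DFunLike.congr_fun e2 w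
    simpa using this.symm
  have h2 : ∀ w z, fderiv ℝ (fun z => fderiv ℝ v z w) p z = fderiv ℝ (fderiv ℝ v) p z w := by
    intro w z
    rw [(hd.hasFDerivAt.clm_apply (hasFDerivAt_const w p)).fderiv]
    simp
  refine ⟨fun y z => ?_, fun y => ?_⟩
  · rw [h1, h1, hs.eq]
  · rw [h1, h2, hs.eq]

variable (b β γ k : ℝ) (a : SpaceTime n → Matrix (Fin n) (Fin n) ℝ) (v : SpaceTime n → ℝ)

/-- The conjugated function `u = e^φ v`. -/
noncomputable def conj (z : SpaceTime n) : ℝ := Real.exp (phase b β γ z) * v z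

/-- The spatial gradient of `conj`. -/
noncomputable def conjGrad (z : SpaceTime n) : EuclideanSpace ℝ (Fin n) :=
  Real.exp (phase b β γ z) • (spaceGrad v z + (v z * radialSlope b β γ z) • z.1)

/-- The time derivative of `conj`. -/
noncomputable def conjRate (z : SpaceTime n) : ℝ :=
  Real.exp (phase b β γ z) * (fderiv ℝ v z (0, 1) + v z * phaseRate b β γ z)

/-- The vector field `A ∇φ`. -/
noncomputable def drift (z : SpaceTime n) : EuclideanSpace ℝ (Fin n) :=
  radialSlope b β γ z • coeffMap a z z.1

/-- The potential `A ∇φ · ∇φ - ∂ₜ φ`. -/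
noncomputable def potential (z : SpaceTime n) : ℝ :=
  radialSlope b β γ z ^ 2 * ⟪coeffMap a z z.1, z.1⟫ - phaseRate b β γ z

/-- The zeroth order multiplier: the part of `div (A ∇φ)` without derivatives of `A`, shifted. -/
noncomputable def multiplier (z : SpaceTime n) : ℝ :=
  radialConvex β γ z * coeffTrace a z - radialCurvature β γ z * ⟪coeffMap a z z.1, z.1⟫
    + k / (z.2 + 1)

/-- The vector field whose divergence appears in the Carleman identity. -/
noncomputable def flux (z : SpaceTime n) : EuclideanSpace ℝ (Fin n) :=
  (2 * conjRate b β γ v z - 4 * ⟪drift b β γ a z, conjGrad b β γ v z⟫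
      - 2 * multiplier β γ k a z * conj b β γ v z) • coeffMap a z (conjGrad b β γ v z)
    + (2 * ⟪coeffMap a z (conjGrad b β γ v z), conjGrad b β γ v z⟫
      - 2 * potential b β γ a z * conj b β γ v z ^ 2) • drift b β γ a z

/-- The density whose time derivative appears in the Carleman identity. -/
noncomputable def energy (z : SpaceTime n) : ℝ :=
  potential b β γ a z * conj b β γ v z ^ 2
    - ⟪coeffMap a z (conjGrad b β γ v z), conjGrad b β γ v z⟫

variable {b β γ k a v} {p : SpaceTime n}

theorem conj_derivatives (hv : ContDiff ℝ ∞ v) (hx : p.1 ≠ 0) (ht : -1 < p.2) :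
    ∃ (u' ut' : SpaceTime n →L[ℝ] ℝ) (U' : SpaceTime n →L[ℝ] EuclideanSpace ℝ (Fin n)),
      HasFDerivAt (conj b β γ v) u' p ∧ HasFDerivAt (conjRate b β γ v) ut' p ∧
      HasFDerivAt (conjGrad b β γ v) U' p ∧
      (∀ y, u' (y, 0) = ⟪conjGrad b β γ v p, y⟫) ∧ u' (0, 1) = conjRate b β γ v p ∧
      (∀ y z, ⟪U' (y, 0), z⟫ = ⟪U' (z, 0), y⟫) ∧ (∀ y, ut' (y, 0) = ⟪U' (0, 1), y⟫) := by
  obtain ⟨φ', hφ, hφx, hφ1⟩ := hasFDerivAt_phase (b := b) (β := β) (γ := γ) hx ht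
  obtain ⟨μ', hμ, hμx, hμ1⟩ := hasFDerivAt_radialSlope (b := b) (β := β) (γ := γ) hx ht
  obtain ⟨r', hr, hrx, -⟩ := hasFDerivAt_phaseRate (b := b) (β := β) (γ := γ) hx ht
  have hvd := hv.differentiable (by simp) p
  have hv' := hvd.hasFDerivAt
  have hG := ((contDiff_spaceGrad hv).differentiable (by simp) p).hasFDerivAt
  have hvt := ((contDiff_fderiv_apply hv (0, 1)).differentiable (by simp) p).hasFDerivAt
  obtain ⟨hs1, hs2⟩ := second_derivatives hv p
  have hvx : ∀ y, fderiv ℝ v p (y, 0) = ⟪spaceGrad v p, y⟫ := fun y => (inner_spaceGrad hvd y).symm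
  refine ⟨_, _, _, hφ.exp.mul hv', hφ.exp.mul (hvt.add (hv'.mul hr)),
    hφ.exp.smul (hG.add ((hv'.mul hμ).smul hasFDerivAt_fst)), fun y => ?_, ?_, fun y z => ?_,
    fun y => ?_⟩
  · simp [hφx, hvx, conjGrad, inner_add_left, inner_smul_left]
    ring
  · simp [hφ1, conjRate]
    ring
  · simp [hφx, hvx, hμx, inner_add_left, inner_smul_left, hs1 y z, real_inner_comm y z]
    ring
  · simp [hφx, hφ1, hvx, hμ1, hrx, inner_add_left, inner_smul_left, hs2]
    ring

theorem drift_derivative (hx : p.1 ≠ 0) (ht : -1 < p.2)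
    (ha : ∀ i j, DifferentiableAt ℝ (fun q => a q i j) p) :
    ∃ V' : SpaceTime n →L[ℝ] EuclideanSpace ℝ (Fin n), HasFDerivAt (drift b β γ a) V' p ∧
      (∀ y, V' (y, 0) = (-radialCurvature β γ p * ⟪p.1, y⟫) • coeffMap a p p.1
        + radialSlope b β γ p • (coeffDeriv a p (y, 0) p.1 + coeffMap a p y)) ∧
      divergence V' = -radialCurvature β γ p * ⟪coeffMap a p p.1, p.1⟫
        + radialSlope b β γ p * (divergence ((coeffDeriv a p).flip p.1) + coeffTrace a p) := by
  obtain ⟨μ', hμ, hμx, -⟩ := hasFDerivAt_radialSlope (b := b) (β := β) (γ := γ) hx ht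
  have h1 := (hasFDerivAt_coeffMap ha).clm_apply (hasFDerivAt_fst (p := p))
  refine ⟨_, hμ.smul h1, fun y => ?_, ?_⟩
  · simp [hμx]
    abel
  · rw [divergence_add, divergence_smul, divergence_smulRight, hμx, divergence_add,
      divergence_coeff, real_inner_comm]
    ring

theorem quadratic_derivative (ha : ∀ i j, DifferentiableAt ℝ (fun q => a q i j) p)
    (hAs : ∀ y z, ⟪coeffMap a p y, z⟫ = ⟪y, coeffMap a p z⟫) :
    ∃ m' : SpaceTime n →L[ℝ] ℝ, HasFDerivAt (fun z => ⟪coeffMap a z z.1, z.1⟫) m' p ∧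
      ∀ w, m' w = ⟪coeffDeriv a p w p.1, p.1⟫ + 2 * ⟪coeffMap a p p.1, w.1⟫ := by
  have h1 := (hasFDerivAt_coeffMap ha).clm_apply (hasFDerivAt_fst (p := p))
  refine ⟨_, h1.inner ℝ hasFDerivAt_fst, fun w => ?_⟩
  simp [inner_add_left]
  rw [hAs w.1 p.1, real_inner_comm]
  ring

theorem potential_derivative (hx : p.1 ≠ 0) (ht : -1 < p.2)
    (ha : ∀ i j, DifferentiableAt ℝ (fun q => a q i j) p)
    (hAs : ∀ y z, ⟪coeffMap a p y, z⟫ = ⟪y, coeffMap a p z⟫) :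
    ∃ q' : SpaceTime n →L[ℝ] ℝ, HasFDerivAt (potential b β γ a) q' p ∧
      (∀ y, q' (y, 0) =
        2 * radialSlope b β γ p * (-radialCurvature β γ p * ⟪p.1, y⟫) * ⟪coeffMap a p p.1, p.1⟫
        + radialSlope b β γ p ^ 2 * (⟪coeffDeriv a p (y, 0) p.1, p.1⟫ + 2 * ⟪coeffMap a p p.1, y⟫)
        - (-radialConvex₁ β γ p + b / (p.2 + 1) ^ 2) * ⟪p.1, y⟫) ∧
      q' (0, 1) =
        2 * radialSlope b β γ p * (-radialConvex₁ β γ p + b / (p.2 + 1) ^ 2)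
          * ⟪coeffMap a p p.1, p.1⟫
        + radialSlope b β γ p ^ 2 * ⟪coeffDeriv a p (0, 1) p.1, p.1⟫
        - (2 / 3 * radialConvex₂ β γ p * ‖p.1‖ ^ 2
          - (b * ‖p.1‖ ^ 2 + β) / (p.2 + 1) ^ 3) := by
  obtain ⟨μ', hμ, hμx, hμ1⟩ := hasFDerivAt_radialSlope (b := b) (β := β) (γ := γ) hx ht
  obtain ⟨r', hr, hrx, hr1⟩ := hasFDerivAt_phaseRate (b := b) (β := β) (γ := γ) hx ht
  obtain ⟨m', hm, hm'⟩ := quadratic_derivative ha hAs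
  refine ⟨_, ((hμ.pow 2).mul hm).sub hr, fun y => ?_, ?_⟩
  · simp [hμx, hrx, hm']
    ring
  · simp [hμ1, hr1, hm']
    ring

/-- The shift `k/(t+1)` has no spatial gradient, so the bound is proportional to `α`; `κ|x|² = α/2`
converts `κ` to `α`, and `|x| ≥ 1` discards the remaining decay. Proportionality to `α` is what
makes the mixed term absorbable for every `γ`. -/
theorem multiplier_derivative {Λ lam M E : ℝ} (hE : 0 ≤ E) (hlam : 0 < lam) (hΛ : lam ≤ Λ)
    (hp : p ∈ cylinder n) (hcoef : IsCoefficient Λ lam M E a) (hreg : RegularPoint M E a p)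
    (hx1 : 1 ≤ ‖p.1‖) (ht : -1 < p.2) (hα : 0 ≤ radialConvex β γ p) :
    ∃ h' : SpaceTime n →L[ℝ] ℝ, HasFDerivAt (multiplier β γ k a) h' p ∧
      ∀ y, |h' (y, 0)| ≤ (n * Λ + 3 * Λ + 2 * (n ^ 2 * E)) * radialConvex β γ p * ‖y‖ := by
  have hs : 0 < ‖p.1‖ := by linarith
  have hx : p.1 ≠ 0 := norm_pos_iff.1 hs
  have hΛ0 : 0 < Λ := hlam.trans_le hΛ
  obtain ⟨α', hα', hαx, -⟩ := hasFDerivAt_radialConvex (β := β) (γ := γ) hx ht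
  obtain ⟨κ', hκ', hκx⟩ := hasFDerivAt_radialCurvature (β := β) (γ := γ) hx ht
  obtain ⟨T', hT', hTx⟩ := hreg.hasFDerivAt_trace hE
  obtain ⟨m', hm, hm'⟩ := quadratic_derivative hreg.diff (hcoef.inner_comm hp)
  have h4 := hasFDerivAt_time (p := p) (hasDerivAt_inv_add_one ht)
  refine ⟨_, (((hα'.mul hT').sub (hκ'.mul hm)).add (h4.const_mul k)).congr_of_eventuallyEq
    (Filter.Eventually.of_forall fun q => by simp [multiplier, div_eq_mul_inv]), fun y => ?_⟩
  set α := radialConvex β γ p with hαdef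
  set κ := radialCurvature β γ p with hκdef
  have hκ : κ * ‖p.1‖ ^ 2 = α / 2 := by
    rw [hκdef, radialCurvature]; field_simp; rfl
  have hκ0 : 0 ≤ κ := by rw [hκdef, radialCurvature]; positivity
  obtain ⟨hT0, hT1⟩ := hcoef.trace hlam hp
  set ε := (n : ℝ) ^ 2 * E with hε
  have hε0 : 0 ≤ ε := by positivity
  have hxy := abs_real_inner_le_norm p.1 y
  have hm0 : |⟪coeffMap a p p.1, p.1⟫| ≤ Λ * ‖p.1‖ ^ 2 := by
    rw [abs_of_nonneg ((hcoef.le_inner hp _).trans' (by positivity))]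
    exact hcoef.inner_le hp _
  have hAxy : |⟪coeffMap a p p.1, y⟫| ≤ Λ * ‖p.1‖ * ‖y‖ :=
    (abs_real_inner_le_norm _ _).trans (by gcongr; exact hcoef.norm_le hlam hΛ hp _)
  have hs1 : ‖y‖ / ‖p.1‖ ≤ ‖y‖ := div_le_self (norm_nonneg _) hx1
  have b1 : |κ * ⟪p.1, y⟫ * coeffTrace a p| ≤ n * Λ / 2 * α * ‖y‖ := by
    rw [abs_mul, abs_mul, abs_of_nonneg hκ0, abs_of_nonneg hT0]
    calc _ ≤ κ * (‖p.1‖ * ‖y‖) * (n * Λ) := by gcongr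
      _ = (κ * ‖p.1‖ ^ 2) * (‖y‖ / ‖p.1‖) * (n * Λ) := by field_simp
      _ ≤ (κ * ‖p.1‖ ^ 2) * ‖y‖ * (n * Λ) := by gcongr
      _ = _ := by rw [hκ]; ring
  have b2 : |α * T' (y, 0)| ≤ ε * α * ‖y‖ := by
    rw [abs_mul, abs_of_nonneg hα]
    calc _ ≤ α * (ε / ‖p.1‖ * ‖y‖) := by gcongr; exact hTx y
      _ = α * ε * (‖y‖ / ‖p.1‖) := by ring
      _ ≤ α * ε * ‖y‖ := by gcongr
      _ = _ := by ring
  have b3 : |5 / 2 * κ / ‖p.1‖ ^ 2 * ⟪p.1, y⟫ * ⟪coeffMap a p p.1, p.1⟫|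
      ≤ 5 / 4 * Λ * α * ‖y‖ := by
    rw [abs_mul, abs_mul, abs_of_nonneg (by positivity : 0 ≤ 5 / 2 * κ / ‖p.1‖ ^ 2)]
    calc _ ≤ 5 / 2 * κ / ‖p.1‖ ^ 2 * (‖p.1‖ * ‖y‖) * (Λ * ‖p.1‖ ^ 2) := by gcongr
      _ = 5 / 2 * (κ * ‖p.1‖ ^ 2) * (‖y‖ / ‖p.1‖) * Λ := by field_simp
      _ ≤ 5 / 2 * (κ * ‖p.1‖ ^ 2) * ‖y‖ * Λ := by gcongr
      _ = _ := by rw [hκ]; ring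
  have b4 : |κ * ⟪coeffDeriv a p (y, 0) p.1, p.1⟫| ≤ ε / 2 * α * ‖y‖ := by
    rw [abs_mul, abs_of_nonneg hκ0]
    calc _ ≤ κ * (ε / ‖p.1‖ * ‖y‖ * ‖p.1‖ * ‖p.1‖) := by
          gcongr; exact hreg.abs_inner_space_le _ _ _
      _ = (κ * ‖p.1‖ ^ 2) * ε * (‖y‖ / ‖p.1‖) := by field_simp
      _ ≤ (κ * ‖p.1‖ ^ 2) * ε * ‖y‖ := by gcongr
      _ = _ := by rw [hκ]; ring
  have b5 : |κ * ⟪coeffMap a p p.1, y⟫| ≤ Λ / 2 * α * ‖y‖ := by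
    rw [abs_mul, abs_of_nonneg hκ0]
    calc _ ≤ κ * (Λ * ‖p.1‖ * ‖y‖) := by gcongr
      _ = (κ * ‖p.1‖ ^ 2) * (‖y‖ / ‖p.1‖) * Λ := by field_simp
      _ ≤ (κ * ‖p.1‖ ^ 2) * ‖y‖ * Λ := by gcongr
      _ = _ := by rw [hκ]; ring
  simp [hαx, hκx, hm']
  rw [abs_le] at b1 b2 b3 b4 b5 ⊢
  have hαy : 0 ≤ α * ‖y‖ := by positivity
  have c1 : 0 ≤ n * Λ * (α * ‖y‖) := by positivity
  have c2 : 0 ≤ Λ * (α * ‖y‖) := by positivity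
  have c3 : 0 ≤ ε * (α * ‖y‖) := by positivity
  constructor <;> linarith [b1.1, b1.2, b2.1, b2.2, b3.1, b3.2, b4.1, b4.2, b5.1, b5.2]

end Conjugation

end ExteriorCarleman

namespace ExteriorCarleman

open scoped RealInnerProductSpace

/-! ### The pointwise Carleman inequality. -/

section PointwiseInequality

variable {n : ℕ} {b β γ k : ℝ} {a : SpaceTime n → Matrix (Fin n) (Fin n) ℝ} {v : SpaceTime n → ℝ}
  {p : SpaceTime n}

/-- The operator in divergence form, at points of differentiability of the coefficients. -/
theorem backwardOp_eq (hv : ContDiff ℝ ∞ v)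
    (ha : ∀ i j, DifferentiableAt ℝ (fun q => a q i j) p) :
    backwardOp a v p = fderiv ℝ v p (0, 1) + divergence ((coeffMap a p).comp
      (fderiv ℝ (spaceGrad v) p) + (coeffDeriv a p).flip (spaceGrad v p)) := by
  have hG := ((contDiff_spaceGrad hv).differentiable (by simp) p).hasFDerivAt
  have hY := (hasFDerivAt_coeffMap ha).clm_apply hG
  rw [backwardOp, timeDeriv_eq (hv.differentiable (by simp) p)]
  congr 1
  refine Finset.sum_congr rfl fun i _ => ?_
  have e : (fun q => ∑ j, a q i j * spaceDeriv j v q) =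
      fun q => (coeffMap a q (spaceGrad v q)) i := by
    funext q
    rw [coeffMap_apply]
    refine Finset.sum_congr rfl fun j _ => ?_
    have hvd := hv.differentiable (by simp) q
    rw [spaceDeriv_eq hvd, ← inner_spaceGrad hvd]
    simp [EuclideanSpace.inner_single_right]
  have hYi : HasFDerivAt (fun q => (coeffMap a q (spaceGrad v q)) i)
      ((EuclideanSpace.proj i : EuclideanSpace ℝ (Fin n) →L[ℝ] ℝ).comp ((coeffMap a p).comp
      (fderiv ℝ (spaceGrad v) p) + (coeffDeriv a p).flip (spaceGrad v p))) p :=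
    (EuclideanSpace.proj i : EuclideanSpace ℝ (Fin n) →L[ℝ] ℝ).hasFDerivAt.comp p hY
  rw [e, spaceDeriv_eq hYi.differentiableAt, hYi.fderiv]
  rfl

/-- This is the splitting `K + Z + r u`. The multiplier cancels from the sum, so its choice is free.
Since `AU = e^φ(A∇v + vV)`, the derivative of `AU` can be computed in two ways, which brings in the
divergence form of the operator. -/
theorem conjugated_operator (hv : ContDiff ℝ ∞ v) (hx : p.1 ≠ 0) (ht : -1 < p.2)
    (ha : ∀ i j, DifferentiableAt ℝ (fun q => a q i j) p)
    (hAs : ∀ y z, ⟪coeffMap a p y, z⟫ = ⟪y, coeffMap a p z⟫)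
    {U' V' : SpaceTime n →L[ℝ] EuclideanSpace ℝ (Fin n)}
    (hU : HasFDerivAt (conjGrad b β γ v) U' p) (hV : HasFDerivAt (drift b β γ a) V' p) :
    Real.exp (phase b β γ p) * backwardOp a v p =
      (conjRate b β γ v p - 2 * ⟪drift b β γ a p, conjGrad b β γ v p⟫
          - multiplier β γ k a p * conj b β γ v p)
        + (divergence ((coeffMap a p).comp U' + (coeffDeriv a p).flip (conjGrad b β γ v p))
          + potential b β γ a p * conj b β γ v p)
        + (multiplier β γ k a p - divergence V') * conj b β γ v p := by
  obtain ⟨φ', hφ, hφx, -⟩ := hasFDerivAt_phase (b := b) (β := β) (γ := γ) hx ht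
  have hvd := hv.differentiable (by simp) p
  have hG := ((contDiff_spaceGrad hv).differentiable (by simp) p).hasFDerivAt
  have hY := (hasFDerivAt_coeffMap ha).clm_apply hG
  have hX := (hasFDerivAt_coeffMap ha).clm_apply hU
  have hX2 := hφ.exp.smul (hY.add (hvd.hasFDerivAt.smul hV))
  have e : (fun z => coeffMap a z (conjGrad b β γ v z)) =
      (fun z : SpaceTime n => Real.exp (phase b β γ z)) •
        ((fun z => coeffMap a z (spaceGrad v z)) + v • drift b β γ a) := by
    funext z
    simp [conjGrad, drift, smul_smul]
  rw [e] at hX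
  rw [hX.unique hX2, backwardOp_eq hv ha]
  simp only [divergence_add, divergence_smul, divergence_smulRight, smul_apply, hφx,
    ← inner_spaceGrad hvd, Pi.add_apply, Pi.smul_apply', inner_add_right, smul_eq_mul,
    inner_smul_right]
  have e1 : ⟪p.1, drift b β γ a p⟫ = radialSlope b β γ p * ⟪coeffMap a p p.1, p.1⟫ := by
    rw [drift, inner_smul_right, real_inner_comm]
  have e2 : ⟪drift b β γ a p, spaceGrad v p⟫ =
      radialSlope b β γ p * ⟪p.1, coeffMap a p (spaceGrad v p)⟫ := by
    rw [drift, inner_smul_left, hAs]; simp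
  rw [real_inner_comm (drift b β γ a p) (spaceGrad v p)]
  simp only [conjRate, conj, potential, conjGrad, inner_smul_right, inner_add_right, e2,
    real_inner_comm p.1 (drift b β γ a p), e1]
  ring

/-- Undoing the conjugation: `e^φ∇v = U - μ u x`, followed by `(s + t)² ≤ 2s² + 2t²`. -/
theorem weight_mul_le :
    weight b β γ p * (|v p| ^ 2 + ‖spaceGrad v p‖ ^ 2) ≤ 2 * ‖conjGrad b β γ v p‖ ^ 2
      + (1 + 2 * radialSlope b β γ p ^ 2 * ‖p.1‖ ^ 2) * conj b β γ v p ^ 2 := by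
  set e := Real.exp (phase b β γ p) with he
  have he0 : 0 < e := Real.exp_pos _
  have h1 : e • spaceGrad v p = conjGrad b β γ v p
      - (conj b β γ v p * radialSlope b β γ p) • p.1 := by
    simp only [conjGrad, conj, ← he, smul_add, smul_smul, mul_assoc]
    abel
  have h2 : e * ‖spaceGrad v p‖ ≤ ‖conjGrad b β γ v p‖
      + |conj b β γ v p * radialSlope b β γ p| * ‖p.1‖ := by
    have := norm_sub_le (conjGrad b β γ v p) ((conj b β γ v p * radialSlope b β γ p) • p.1)
    rwa [← h1, norm_smul, norm_smul, Real.norm_of_nonneg he0.le, Real.norm_eq_abs] at this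
  have h3 : (e * ‖spaceGrad v p‖) ^ 2 ≤ 2 * ‖conjGrad b β γ v p‖ ^ 2
      + 2 * (|conj b β γ v p * radialSlope b β γ p| * ‖p.1‖) ^ 2 := by
    calc _ ≤ (‖conjGrad b β γ v p‖ + |conj b β γ v p * radialSlope b β γ p| * ‖p.1‖) ^ 2 := by
          gcongr
      _ ≤ _ := by
          linarith [sq_nonneg (‖conjGrad b β γ v p‖
            - |conj b β γ v p * radialSlope b β γ p| * ‖p.1‖)]
  rw [mul_pow |_|, sq_abs] at h3
  rw [weight_eq_exp_phase, ← he, sq_abs]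
  have h4 : conj b β γ v p ^ 2 = e ^ 2 * v p ^ 2 := by rw [conj, mul_pow]
  nlinarith only [h3, h4]

theorem pointwise_carleman {Λ lam M E : ℝ} (hE : 0 ≤ E)
    (hpar : AdmissibleParameters b Λ lam (n ^ 2 * E) (n ^ 2 * M) k
      (n * Λ + 3 * Λ + 2 * (n ^ 2 * E)) β) (hkn : (n : ℝ) ≤ k) (hγ : 0 ≤ γ)
    (hcoef : IsCoefficient Λ lam M E a) (hreg : RegularPoint M E a p) (hp : p ∈ cylinder n)
    (hv : ContDiff ℝ ∞ v) :
    DifferentiableAt ℝ (flux b β γ k a v) p ∧ DifferentiableAt ℝ (energy b β γ a v) p ∧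
      weight b β γ p * (|v p| ^ 2 + ‖spaceGrad v p‖ ^ 2)
        + (divergence (fderiv ℝ (flux b β γ k a v) p) + fderiv ℝ (energy b β γ a v) p (0, 1))
      ≤ weight b β γ p * |backwardOp a v p| ^ 2 := by
  have hx1 : 1 ≤ ‖p.1‖ := by simpa using hp.1
  have hx : p.1 ≠ 0 := norm_pos_iff.1 (by linarith)
  obtain ⟨ht0, ht1⟩ := hp.2
  have ht : -1 < p.2 := by linarith
  have hlam := hpar.lam_pos
  have hΛ := hpar.lam_le
  have hβ := hpar.one_le
  have hβ0 : 0 ≤ β := by linarith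
  have hα := radialConvex_nonneg (p := p) hβ0 hγ ht0 ht1
  have hAs := hcoef.inner_comm hp
  obtain ⟨u', ut', U', hu, hut, hU, hux, hu1, hUs, hutx⟩ :=
    conj_derivatives (b := b) (β := β) (γ := γ) hv hx ht
  obtain ⟨V', hV, hVx, hVd⟩ := drift_derivative (b := b) (β := β) (γ := γ) hx ht hreg.diff
  obtain ⟨q', hq, hqx, hq1⟩ := potential_derivative (b := b) (β := β) (γ := γ) hx ht hreg.diff hAs
  obtain ⟨h', hh, hhx⟩ := multiplier_derivative (β := β) (γ := γ) (k := k) hE hlam hΛ hp hcoef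
    hreg hx1 ht hα
  obtain ⟨W', g', hW, hg, hid⟩ := conjugated_identity hu hut hq hh hU hV
    (hasFDerivAt_coeffMap hreg.diff) hux hu1 hUs hutx hAs
  have hW' : HasFDerivAt (flux b β γ k a v) W' p := hW
  have hg' : HasFDerivAt (energy b β γ a v) g' p := hg
  refine ⟨hW'.differentiableAt, hg'.differentiableAt, ?_⟩
  rw [hW'.fderiv, hg'.fderiv, hid]
  have hop := conjugated_operator (k := k) hv hx ht hreg.diff hAs hU hV
  have hT := hcoef.trace hlam hp
  have hTk : b * coeffTrace a p ≤ k := by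
    calc b * coeffTrace a p ≤ b * (n * Λ) := by gcongr; exacts [hpar.b_pos.le, hT.2]
      _ = n * (b * Λ) := by ring
      _ = n / 16 := by rw [hpar.b_mul]; ring
      _ ≤ k := by linarith [(Nat.cast_nonneg n : (0 : ℝ) ≤ n)]
  have hlow := commutator_lower (u := conj b β γ v p) hpar hα (radialConvex_le (p := p) hβ0 hγ ht0 ht1)
    (radialConvex₁_le (p := p) hβ0 hγ ht0 ht1) (by linarith : 1 ≤ p.2 + 1)
    (by linarith : p.2 + 1 ≤ 2) hx1
    (rfl : coeffMap a p (conjGrad b β γ v p) = coeffMap a p (conjGrad b β γ v p))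
    (rfl : drift b β γ a p = radialSlope b β γ p • coeffMap a p p.1) rfl
    (rfl : radialSlope b β γ p = radialConvex β γ p - b / (p.2 + 1))
    (rfl : radialCurvature β γ p = radialConvex β γ p / (2 * ‖p.1‖ ^ 2)) rfl hAs
    (hcoef.le_inner hp) (hcoef.norm_le hlam hΛ hp) hreg.abs_inner_space_le
    hreg.abs_inner_time_le hT.1 hTk (hreg.abs_divergence_le hE hx) (hhx _)
  -- The `α` and `κ` parts cancel; what remains is the trace term of the Gaussian, the shift, and
  -- the derivatives of `A` that the multiplier omits.
  have hr : multiplier β γ k a p - divergence V' = (b * coeffTrace a p + k) / (p.2 + 1)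
      - radialSlope b β γ p * divergence ((coeffDeriv a p).flip p.1) := by
    rw [hVd, multiplier, radialSlope]; ring
  have hpot : potential b β γ a p = radialSlope b β γ p ^ 2 * ⟪coeffMap a p p.1, p.1⟫
      - (-(2 / 3) * radialConvex₁ β γ p * ‖p.1‖ ^ 2
        + (b * ‖p.1‖ ^ 2 + β) / (2 * (p.2 + 1) ^ 2)) := rfl
  rw [← hpot, ← hr, ← hVx, ← hqx, ← hq1] at hlow
  have hw := weight_mul_le (b := b) (β := β) (γ := γ) (v := v) (p := p)
  have hsq : weight b β γ p * |backwardOp a v p| ^ 2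
      = (Real.exp (phase b β γ p) * backwardOp a v p) ^ 2 := by
    rw [weight_eq_exp_phase, sq_abs, mul_pow]
  rw [hsq, hop]
  set K := conjRate b β γ v p - 2 * ⟪drift b β γ a p, conjGrad b β γ v p⟫
          - multiplier β γ k a p * conj b β γ v p
  set Z := divergence ((coeffMap a p).comp U' + (coeffDeriv a p).flip (conjGrad b β γ v p))
          + potential b β γ a p * conj b β γ v p
  set r := multiplier β γ k a p - divergence V'
  set u := conj b β γ v p
  -- `(K + Z + ru)² - 2KZ + r²u²` is the sum of these two squares.
  linarith [sq_nonneg (K + r * u), sq_nonneg (Z + r * u)]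

end PointwiseInequality

end ExteriorCarleman

namespace ExteriorCarleman

open scoped RealInnerProductSpace NNReal
open Topology

/-! ### Local Lipschitz regularity of the flux and the energy. -/

section Regularity

variable {n : ℕ} {b β γ k Λ lam M E : ℝ} {a : SpaceTime n → Matrix (Fin n) (Fin n) ℝ}
  {v : SpaceTime n → ℝ} {p : SpaceTime n}

theorem one_le_norm_of_mem_cylinder (hp : p ∈ cylinder n) : 1 ≤ ‖p.1‖ := by simpa using hp.1

theorem ne_zero_of_mem_cylinder (hp : p ∈ cylinder n) : p.1 ≠ 0 :=
  norm_pos_iff.1 (by linarith [one_le_norm_of_mem_cylinder hp])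

theorem neg_one_lt_of_mem_cylinder (hp : p ∈ cylinder n) : -1 < p.2 := by linarith [hp.2.1]

theorem locallyLipschitzOn_cylinder {F : Type*} [NormedAddCommGroup F] [NormedSpace ℝ F]
    {f : SpaceTime n → F} (h : ∀ p : SpaceTime n, p.1 ≠ 0 → -1 < p.2 → ContDiffAt ℝ ∞ f p) :
    LocallyLipschitzOn (cylinder n) f :=
  locallyLipschitzOn_of_contDiffAt fun p hp =>
    (h p (ne_zero_of_mem_cylinder hp) (neg_one_lt_of_mem_cylinder hp)).of_le
      (by exact_mod_cast le_top)

section Algebra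

variable {X : Type*} [PseudoEMetricSpace X] {s : Set X}

theorem locallyLipschitzOn_mul' {f g : X → ℝ} (hf : LocallyLipschitzOn s f)
    (hg : LocallyLipschitzOn s g) : LocallyLipschitzOn s (fun x => f x * g x) :=
  locallyLipschitzOn_comp₂ (Φ := fun z : ℝ × ℝ => z.1 * z.2) (by fun_prop) hf hg

theorem locallyLipschitzOn_smul' {f : X → ℝ} {g : X → EuclideanSpace ℝ (Fin n)}
    (hf : LocallyLipschitzOn s f) (hg : LocallyLipschitzOn s g) :
    LocallyLipschitzOn s (fun x => f x • g x) :=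
  locallyLipschitzOn_comp₂ (Φ := fun z : ℝ × EuclideanSpace ℝ (Fin n) => z.1 • z.2)
    (by fun_prop) hf hg

theorem locallyLipschitzOn_inner' {f g : X → EuclideanSpace ℝ (Fin n)}
    (hf : LocallyLipschitzOn s f) (hg : LocallyLipschitzOn s g) :
    LocallyLipschitzOn s (fun x => ⟪f x, g x⟫) :=
  locallyLipschitzOn_comp₂
    (Φ := fun z : EuclideanSpace ℝ (Fin n) × EuclideanSpace ℝ (Fin n) => ⟪z.1, z.2⟫)
    (contDiff_fst.inner ℝ contDiff_snd) hf hg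

theorem locallyLipschitzOn_clm_apply'
    {f : X → EuclideanSpace ℝ (Fin n) →L[ℝ] EuclideanSpace ℝ (Fin n)}
    {g : X → EuclideanSpace ℝ (Fin n)} (hf : LocallyLipschitzOn s f)
    (hg : LocallyLipschitzOn s g) : LocallyLipschitzOn s (fun x => f x (g x)) :=
  locallyLipschitzOn_comp₂ (Φ := fun z : (EuclideanSpace ℝ (Fin n) →L[ℝ]
    EuclideanSpace ℝ (Fin n)) × EuclideanSpace ℝ (Fin n) => z.1 z.2)
    (contDiff_fst.clm_apply contDiff_snd) hf hg

theorem locallyLipschitzOn_const_mul' (c : ℝ) {f : X → ℝ} (hf : LocallyLipschitzOn s f) :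
    LocallyLipschitzOn s (fun x => c * f x) :=
  locallyLipschitzOn_comp (contDiff_locallyLipschitz (Φ := fun r : ℝ => c * r) (by fun_prop)) hf

end Algebra

theorem contDiffAt_conj (hv : ContDiff ℝ ∞ v) (hx : p.1 ≠ 0) (ht : -1 < p.2) :
    ContDiffAt ℝ ∞ (conj b β γ v) p :=
  (contDiffAt_phase hx ht).exp.mul hv.contDiffAt

theorem contDiffAt_conjGrad (hv : ContDiff ℝ ∞ v) (hx : p.1 ≠ 0) (ht : -1 < p.2) :
    ContDiffAt ℝ ∞ (conjGrad b β γ v) p :=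
  (contDiffAt_phase hx ht).exp.smul ((contDiff_spaceGrad hv).contDiffAt.add
    ((hv.contDiffAt.mul (contDiffAt_radialSlope hx ht)).smul contDiffAt_fst))

theorem contDiffAt_conjRate (hv : ContDiff ℝ ∞ v) (hx : p.1 ≠ 0) (ht : -1 < p.2) :
    ContDiffAt ℝ ∞ (conjRate b β γ v) p :=
  (contDiffAt_phase hx ht).exp.mul ((contDiff_fderiv_apply hv (0, 1)).contDiffAt.add
    (hv.contDiffAt.mul (contDiffAt_phaseRate hx ht)))

theorem locallyLipschitzOn_quadratic (ha : IsCoefficient Λ lam M E a) :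
    LocallyLipschitzOn (cylinder n) (fun z => ⟪coeffMap a z z.1, z.1⟫) := by
  have h1 : LocallyLipschitzOn (cylinder n) (fun z : SpaceTime n => z.1) :=
    locallyLipschitzOn_cylinder fun p _ _ => contDiffAt_fst
  exact locallyLipschitzOn_inner'
    (locallyLipschitzOn_clm_apply' (locallyLipschitzOn_coeffMap ha) h1) h1

theorem locallyLipschitzOn_drift (ha : IsCoefficient Λ lam M E a) :
    LocallyLipschitzOn (cylinder n) (drift b β γ a) :=
  locallyLipschitzOn_smul' (locallyLipschitzOn_cylinder fun _ => contDiffAt_radialSlope)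
    (locallyLipschitzOn_clm_apply' (locallyLipschitzOn_coeffMap ha)
      (locallyLipschitzOn_cylinder fun _ _ _ => contDiffAt_fst))

theorem locallyLipschitzOn_potential (ha : IsCoefficient Λ lam M E a) :
    LocallyLipschitzOn (cylinder n) (potential b β γ a) :=
  (locallyLipschitzOn_mul' (locallyLipschitzOn_cylinder fun _ hx ht =>
    (contDiffAt_radialSlope hx ht).pow 2) (locallyLipschitzOn_quadratic ha)).sub
    (locallyLipschitzOn_cylinder fun _ => contDiffAt_phaseRate)

theorem locallyLipschitzOn_multiplier (ha : IsCoefficient Λ lam M E a) :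
    LocallyLipschitzOn (cylinder n) (multiplier β γ k a) :=
  ((locallyLipschitzOn_mul' (locallyLipschitzOn_cylinder fun _ => contDiffAt_radialConvex)
    (locallyLipschitzOn_coeffTrace ha)).sub
    (locallyLipschitzOn_mul' (locallyLipschitzOn_cylinder fun _ => contDiffAt_radialCurvature)
      (locallyLipschitzOn_quadratic ha))).add
    (locallyLipschitzOn_cylinder fun _ _ ht =>
      contDiffAt_const.div (contDiffAt_snd.add contDiffAt_const) (by simp; linarith))

theorem locallyLipschitzOn_coeff_conjGrad (ha : IsCoefficient Λ lam M E a)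
    (hv : ContDiff ℝ ∞ v) :
    LocallyLipschitzOn (cylinder n) (fun z => coeffMap a z (conjGrad b β γ v z)) :=
  locallyLipschitzOn_clm_apply' (locallyLipschitzOn_coeffMap ha)
    (locallyLipschitzOn_cylinder fun _ => contDiffAt_conjGrad hv)

theorem locallyLipschitzOn_flux (ha : IsCoefficient Λ lam M E a) (hv : ContDiff ℝ ∞ v) :
    LocallyLipschitzOn (cylinder n) (flux b β γ k a v) := by
  have hU : LocallyLipschitzOn (cylinder n) (conjGrad b β γ v) :=
    locallyLipschitzOn_cylinder fun _ => contDiffAt_conjGrad hv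
  have hu : LocallyLipschitzOn (cylinder n) (conj b β γ v) :=
    locallyLipschitzOn_cylinder fun _ => contDiffAt_conj hv
  have hu2 : LocallyLipschitzOn (cylinder n) (fun z => conj b β γ v z ^ 2) :=
    locallyLipschitzOn_cylinder fun _ hx ht => (contDiffAt_conj hv hx ht).pow 2
  have hut : LocallyLipschitzOn (cylinder n) (conjRate b β γ v) :=
    locallyLipschitzOn_cylinder fun _ => contDiffAt_conjRate hv
  have hX := locallyLipschitzOn_coeff_conjGrad (b := b) (β := β) (γ := γ) ha hv
  have hV := locallyLipschitzOn_drift (b := b) (β := β) (γ := γ) ha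
  exact (locallyLipschitzOn_smul' (((locallyLipschitzOn_const_mul' 2 hut).sub
    (locallyLipschitzOn_const_mul' 4 (locallyLipschitzOn_inner' hV hU))).sub
    (locallyLipschitzOn_mul' (locallyLipschitzOn_const_mul' 2 (locallyLipschitzOn_multiplier ha))
      hu)) hX).add
    (locallyLipschitzOn_smul' ((locallyLipschitzOn_const_mul' 2
      (locallyLipschitzOn_inner' hX hU)).sub (locallyLipschitzOn_mul'
        (locallyLipschitzOn_const_mul' 2 (locallyLipschitzOn_potential ha)) hu2)) hV)

theorem locallyLipschitzOn_energy (ha : IsCoefficient Λ lam M E a) (hv : ContDiff ℝ ∞ v) :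
    LocallyLipschitzOn (cylinder n) (energy b β γ a v) :=
  (locallyLipschitzOn_mul' (locallyLipschitzOn_potential ha)
    (locallyLipschitzOn_cylinder fun _ hx ht => (contDiffAt_conj hv hx ht).pow 2)).sub
    (locallyLipschitzOn_inner' (locallyLipschitzOn_coeff_conjGrad ha hv)
      (locallyLipschitzOn_cylinder fun _ => contDiffAt_conjGrad hv))

end Regularity

/-! ### The annulus as domain of integration. -/

section Annulus

variable {n : ℕ} {R : ℝ}

/-- The closed annulus with radii `1` and `R`. -/
def annulus (n : ℕ) (R : ℝ) : Set (EuclideanSpace ℝ (Fin n)) :=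
  Metric.closedBall 0 R ∩ (Metric.ball 0 1)ᶜ

theorem mem_annulus {x : EuclideanSpace ℝ (Fin n)} : x ∈ annulus n R ↔ ‖x‖ ≤ R ∧ 1 ≤ ‖x‖ := by
  simp [annulus]

theorem isCompact_annulus : IsCompact (annulus n R) :=
  (isCompact_closedBall 0 R).inter_right Metric.isOpen_ball.isClosed_compl

theorem frontier_annulus_subset :
    frontier (annulus n R) ⊆ Metric.sphere 0 R ∪ Metric.sphere 0 1 := by
  intro x hx
  rcases frontier_inter_subset _ _ hx with h | h
  · exact Or.inl (Metric.frontier_closedBall_subset_sphere h.1)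
  · rw [frontier_compl] at h
    exact Or.inr (Metric.frontier_ball_subset_sphere h.2)

theorem volume_frontier_annulus (hR : 1 < R) : volume (frontier (annulus n R)) = 0 :=
  measure_mono_null frontier_annulus_subset (measure_union_null
    (Measure.addHaar_sphere_of_ne_zero _ _ (by linarith))
    (Measure.addHaar_sphere_of_ne_zero _ _ one_ne_zero))

theorem annulus_prod_subset : annulus n R ×ˢ Icc (0 : ℝ) 1 ⊆ cylinder n :=
  prod_mono inter_subset_right subset_rfl

theorem isClosed_cylinder : IsClosed (cylinder n) :=
  Metric.isOpen_ball.isClosed_compl.prod isClosed_Icc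

theorem volume_frontier_compl_ball :
    volume (frontier ((Metric.ball (0 : EuclideanSpace ℝ (Fin n)) 1)ᶜ)) = 0 := by
  rw [frontier_compl]
  exact measure_mono_null Metric.frontier_ball_subset_sphere
    (Measure.addHaar_sphere_of_ne_zero _ _ one_ne_zero)

end Annulus

/-! ### The integrated inequality. -/

section IntegralInequality

variable {n : ℕ} {b β γ k Λ lam M E R : ℝ} {a : SpaceTime n → Matrix (Fin n) (Fin n) ℝ}
  {v : SpaceTime n → ℝ}

theorem ae_regularPoint (hR : 1 < R) (ha : IsCoefficient Λ lam M E a) :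
    ∀ᵐ p ∂(volume.restrict (annulus n R ×ˢ Icc (0 : ℝ) 1)), RegularPoint M E a p := by
  have h1 : ∀ i j, ∀ᵐ p ∂(volume.restrict (annulus n R ×ˢ Icc (0 : ℝ) 1)),
      DifferentiableAt ℝ (fun q => a q i j) p := by
    intro i j
    obtain ⟨C, hC⟩ := ((ha.lipschitz i j).mono annulus_prod_subset
      ).exists_lipschitzOnWith_of_compact (isCompact_annulus.prod isCompact_Icc)
    filter_upwards [ae_differentiableAt_of_lipschitzOn (volume_frontier_annulus hR) hC] with p hp
    exact hp.1
  have h2 := fun i j => ae_restrict_of_ae_restrict_of_subset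
    (annulus_prod_subset (n := n) (R := R)) (ha.deriv_le i j)
  have h3 := fun i j => ae_restrict_of_ae_restrict_of_subset
    (annulus_prod_subset (n := n) (R := R)) (ha.grad_le i j)
  simp only [← ae_all_iff] at h1 h2 h3
  filter_upwards [h1, h2, h3] with p hp1 hp2 hp3
  refine ⟨hp1, fun i j y => (abs_fderiv_space_le (hp1 i j) y).trans ?_, fun i j => ?_⟩
  · gcongr
    exact hp3 i j
  · rw [← timeDeriv_eq (hp1 i j)]
    linarith [hp2 i j, norm_nonneg (spaceGrad (fun q => a q i j) p)]

/-- A test function vanishes, with its gradient, off its support and inside the unit ball. -/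
theorem eq_zero_of_notMem {K : Set (SpaceTime n)} (hK : IsCompact K)
    (hv0 : ∀ p : SpaceTime n, p.2 ∈ Icc (0 : ℝ) 1 → p ∉ K → v p = 0) {p : SpaceTime n}
    (hp : p.2 ∈ Icc (0 : ℝ) 1) (hpK : p ∉ K) : v p = 0 ∧ spaceGrad v p = 0 := by
  refine ⟨hv0 p hp hpK, ?_⟩
  have h : (fun y => v (y, p.2)) =ᶠ[𝓝 p.1] fun _ => 0 := by
    have hc : Continuous (fun y : EuclideanSpace ℝ (Fin n) => (y, p.2)) := by fun_prop
    filter_upwards [hc.continuousAt.preimage_mem_nhds (hK.isClosed.isOpen_compl.mem_nhds hpK)]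
      with y hy
    exact hv0 _ hp hy
  rw [spaceGrad, h.gradient_eq]
  simp [gradient]

/-- The support lies in `Q`, so `v` vanishes in the open unit ball, and continuity carries `v = 0`
and `∇v = 0` to the unit sphere. Hence the flux has no contribution from the inner boundary. -/
theorem eq_zero_of_norm_le_one (hv : ContDiff ℝ ∞ v) {K : Set (SpaceTime n)} (hK : IsCompact K)
    (hKQ : K ⊆ cylinder n)
    (hv0 : ∀ p : SpaceTime n, p.2 ∈ Icc (0 : ℝ) 1 → p ∉ K → v p = 0) {p : SpaceTime n}
    (hp : p.2 ∈ Icc (0 : ℝ) 1) (hp1 : ‖p.1‖ ≤ 1) : v p = 0 ∧ spaceGrad v p = 0 := by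
  have hcl : IsClosed {x : EuclideanSpace ℝ (Fin n) |
      v (x, p.2) = 0 ∧ spaceGrad v (x, p.2) = 0} := by
    have h1 := hv.continuous
    have h2 := (contDiff_spaceGrad hv).continuous
    exact (isClosed_eq (by fun_prop) continuous_const).inter
      (isClosed_eq (h2.comp (by fun_prop)) continuous_const)
  have hsub : Metric.ball (0 : EuclideanSpace ℝ (Fin n)) 1 ⊆
      {x | v (x, p.2) = 0 ∧ spaceGrad v (x, p.2) = 0} := by
    intro x hx
    refine eq_zero_of_notMem hK hv0 (p := (x, p.2)) hp fun hmem => ?_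
    exact (hKQ hmem).1 hx
  have := closure_minimal hsub hcl
  rw [closure_ball _ one_ne_zero] at this
  exact this (by simpa using hp1)

theorem flux_eq_zero {p : SpaceTime n} (h : v p = 0 ∧ spaceGrad v p = 0) :
    flux b β γ k a v p = 0 := by
  simp [flux, conj, conjGrad, h.1, h.2]

theorem continuousOn_weight : ContinuousOn (weight (n := n) b β γ) (cylinder n) := by
  have h : ContinuousOn (fun p : SpaceTime n => Real.exp (phase b β γ p) ^ 2) (cylinder n) :=
    (locallyLipschitzOn_cylinder fun _ hx ht =>
      (contDiffAt_phase hx ht).exp.pow 2).continuousOn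
  exact h.congr fun p _ => weight_eq_exp_phase b β γ p

theorem integral_divergence_eq_zero {F : SpaceTime n → EuclideanSpace ℝ (Fin n)} (hR : 1 < R)
    (hF : LocallyLipschitzOn (cylinder n) F)
    (h0 : ∀ x ∈ frontier (annulus n R), ∀ t ∈ Icc (0 : ℝ) 1, F (x, t) = 0)
    (hd : ∀ᵐ p ∂(volume.restrict (annulus n R ×ˢ Icc (0 : ℝ) 1)), DifferentiableAt ℝ F p) :
    IntegrableOn (fun p => divergence (fderiv ℝ F p)) (annulus n R ×ˢ Icc (0 : ℝ) 1) ∧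
      ∫ p in annulus n R ×ˢ Icc (0 : ℝ) 1, divergence (fderiv ℝ F p) = 0 := by
  have hcomp : ∀ i, ∃ C, LipschitzOnWith C (fun p => F p i) (annulus n R ×ˢ Icc (0 : ℝ) 1) := by
    intro i
    refine LocallyLipschitzOn.exists_lipschitzOnWith_of_compact
      (isCompact_annulus.prod isCompact_Icc) ?_
    exact locallyLipschitzOn_comp (contDiff_locallyLipschitz
      (EuclideanSpace.proj i : EuclideanSpace ℝ (Fin n) →L[ℝ] ℝ).contDiff)
      (hF.mono annulus_prod_subset)
  choose C hC using hcomp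
  have hS0 := volume_frontier_annulus (n := n) hR
  have hint := fun i => integrableOn_fderiv_of_lipschitzOn isCompact_annulus hS0 (hC i)
    (EuclideanSpace.single i 1, 0)
  have hae : (fun p => divergence (fderiv ℝ F p))
      =ᵐ[volume.restrict (annulus n R ×ˢ Icc (0 : ℝ) 1)]
      fun p => ∑ i, fderiv ℝ (fun q => F q i) p (EuclideanSpace.single i 1, 0) := by
    filter_upwards [hd] with p hp
    refine Finset.sum_congr rfl fun i _ => ?_
    have : HasFDerivAt (fun q => F q i)
        ((EuclideanSpace.proj i : EuclideanSpace ℝ (Fin n) →L[ℝ] ℝ).comp (fderiv ℝ F p)) p :=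
      (EuclideanSpace.proj i : EuclideanSpace ℝ (Fin n) →L[ℝ] ℝ).hasFDerivAt.comp p
        hp.hasFDerivAt
    rw [this.fderiv]
    rfl
  refine ⟨(integrable_finsetSum _ fun i _ => hint i).congr hae.symm, ?_⟩
  rw [integral_congr_ae hae, integral_finsetSum _ fun i _ => hint i]
  refine Finset.sum_eq_zero fun i _ => integral_fderiv_space_eq_zero isCompact_annulus hS0 (hC i)
    (fun x hx t ht => ?_) _
  rw [h0 x hx t ht]
  rfl

/-- Monotonicity of the integral needs an integrable right side. Almost everywhere `Pv` equals `∂ₜv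
+ div(A∇v)` computed with Fréchet derivatives, which is measurable, and bounded because `A∇v` is
Lipschitz on the compact cylinder. -/
theorem integrableOn_weight_backwardOp (hR : 1 < R) (ha : IsCoefficient Λ lam M E a)
    (hv : ContDiff ℝ ∞ v) :
    IntegrableOn (fun p => weight b β γ p * |backwardOp a v p| ^ 2)
      (annulus n R ×ˢ Icc (0 : ℝ) 1) := by
  have hcomp : IsCompact (annulus n R ×ˢ Icc (0 : ℝ) 1) := isCompact_annulus.prod isCompact_Icc
  have hS0 := volume_frontier_annulus (n := n) hR
  set Y : SpaceTime n → EuclideanSpace ℝ (Fin n) := fun z => coeffMap a z (spaceGrad v z) with hY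
  have hYL : LocallyLipschitzOn (cylinder n) Y :=
    locallyLipschitzOn_clm_apply' (locallyLipschitzOn_coeffMap ha)
      (locallyLipschitzOn_cylinder fun p _ _ => (contDiff_spaceGrad hv).contDiffAt)
  obtain ⟨C, hC⟩ := (hYL.mono annulus_prod_subset).exists_lipschitzOnWith_of_compact hcomp
  have hvt := (contDiff_fderiv_apply hv (0, 1)).continuous
  obtain ⟨B, hB⟩ := hcomp.exists_bound_of_continuousOn hvt.continuousOn
  have hwc := (continuousOn_weight (n := n) (b := b) (β := β) (γ := γ)).mono
    (annulus_prod_subset (R := R))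
  obtain ⟨B', hB'⟩ := hcomp.exists_bound_of_continuousOn hwc
  set G : SpaceTime n → ℝ := fun p => fderiv ℝ v p (0, 1) + divergence (fderiv ℝ Y p) with hG
  have hGm : Measurable G := by
    refine hvt.measurable.add ?_
    refine Finset.measurable_sum _ fun i _ => ?_
    exact (EuclideanSpace.proj i : EuclideanSpace ℝ (Fin n) →L[ℝ] ℝ).continuous.measurable.comp
      (measurable_fderiv_apply_const ℝ Y _)
  have hPG : ∀ᵐ p ∂(volume.restrict (annulus n R ×ˢ Icc (0 : ℝ) 1)),
      weight b β γ p * |G p| ^ 2 = weight b β γ p * |backwardOp a v p| ^ 2 := by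
    filter_upwards [ae_regularPoint hR ha] with p hp
    have hGd := ((contDiff_spaceGrad hv).differentiable (by simp) p).hasFDerivAt
    have hYd := (hasFDerivAt_coeffMap hp.diff).clm_apply hGd
    rw [backwardOp_eq hv hp.diff, hG]
    simp only [hY]
    rw [hYd.fderiv]
  refine Integrable.congr ?_ hPG
  refine IntegrableOn.of_bound hcomp.measure_lt_top
    ((hwc.aestronglyMeasurable hcomp.isClosed.measurableSet).mul
      (hGm.abs.pow_const 2).aestronglyMeasurable) (B' * (B + n * C) ^ 2) ?_
  have hbd : ∀ᵐ p ∂(volume.restrict (annulus n R ×ˢ Icc (0 : ℝ) 1)),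
      p ∈ interior (annulus n R ×ˢ Icc (0 : ℝ) 1) := ae_mem_interior hS0
  filter_upwards [hbd] with p hpi
  have hpD := interior_subset hpi
  have hYn : ‖fderiv ℝ Y p‖ ≤ C :=
    norm_fderiv_le_of_lipschitzOn ℝ (mem_interior_iff_mem_nhds.1 hpi) hC
  have hdiv : |divergence (fderiv ℝ Y p)| ≤ n * C := by
    calc _ ≤ ∑ i, |fderiv ℝ Y p (EuclideanSpace.single i 1, 0) i| :=
          Finset.abs_sum_le_sum_abs _ _
      _ ≤ ∑ _i : Fin n, (C : ℝ) := by
          refine Finset.sum_le_sum fun i _ => ?_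
          refine (PiLp.norm_apply_le (fderiv ℝ Y p (EuclideanSpace.single i 1, 0)) i).trans ?_
          refine ((fderiv ℝ Y p).le_opNorm _).trans ?_
          simpa [Prod.norm_def] using hYn
      _ = _ := by simp
  have hGb : |G p| ≤ B + n * C := by
    refine (abs_add_le _ _).trans (add_le_add ?_ hdiv)
    simpa using hB p hpD
  have hw := hB' p hpD
  have hB'0 : 0 ≤ B' := (norm_nonneg _).trans hw
  rw [norm_mul, norm_pow, Real.norm_eq_abs |G p|, abs_abs]
  gcongr

/-- The Carleman inequality integrated over an annulus that contains the support of the test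
function. -/
theorem integral_carleman (hE : 0 ≤ E)
    (hpar : AdmissibleParameters b Λ lam (n ^ 2 * E) (n ^ 2 * M) k
      (n * Λ + 3 * Λ + 2 * (n ^ 2 * E)) β) (hkn : (n : ℝ) ≤ k) (hγ : 0 ≤ γ)
    (hcoef : IsCoefficient Λ lam M E a) (hv : ContDiff ℝ ∞ v) (hR : 1 < R)
    (hv1 : ∀ p : SpaceTime n, p.2 ∈ Icc (0 : ℝ) 1 → ‖p.1‖ ≤ 1 → v p = 0 ∧ spaceGrad v p = 0)
    (hvR : ∀ p : SpaceTime n, p.2 ∈ Icc (0 : ℝ) 1 → R ≤ ‖p.1‖ → v p = 0 ∧ spaceGrad v p = 0) :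
    (∫ p in annulus n R ×ˢ Icc (0 : ℝ) 1,
        weight b β γ p * (|v p| ^ 2 + ‖spaceGrad v p‖ ^ 2))
      + ∫ x in annulus n R, (energy b β γ a v (x, 1) - energy b β γ a v (x, 0))
    ≤ ∫ p in annulus n R ×ˢ Icc (0 : ℝ) 1, weight b β γ p * |backwardOp a v p| ^ 2 := by
  have hcomp : IsCompact (annulus n R ×ˢ Icc (0 : ℝ) 1) := isCompact_annulus.prod isCompact_Icc
  have hS0 := volume_frontier_annulus (n := n) hR
  have hpt : ∀ᵐ p ∂(volume.restrict (annulus n R ×ˢ Icc (0 : ℝ) 1)),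
      DifferentiableAt ℝ (flux b β γ k a v) p ∧ DifferentiableAt ℝ (energy b β γ a v) p ∧
      weight b β γ p * (|v p| ^ 2 + ‖spaceGrad v p‖ ^ 2)
        + (divergence (fderiv ℝ (flux b β γ k a v) p) + fderiv ℝ (energy b β γ a v) p (0, 1))
      ≤ weight b β γ p * |backwardOp a v p| ^ 2 := by
    filter_upwards [ae_regularPoint hR hcoef, ae_restrict_mem hcomp.isClosed.measurableSet]
      with p hp hpD
    exact pointwise_carleman hE hpar hkn hγ hcoef hp (annulus_prod_subset hpD) hv
  obtain ⟨hdivI, hdiv0⟩ := integral_divergence_eq_zero hR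
    (locallyLipschitzOn_flux (b := b) (β := β) (γ := γ) (k := k) hcoef hv)
    (fun x hx t ht => flux_eq_zero (by
      rcases frontier_annulus_subset hx with h | h
      · exact hvR (x, t) ht (by simpa using h.ge)
      · exact hv1 (x, t) ht (by simpa using h.le)))
    (by filter_upwards [hpt] with p hp using hp.1)
  obtain ⟨C, hC⟩ := ((locallyLipschitzOn_energy (b := b) (β := β) (γ := γ) hcoef hv).mono
    annulus_prod_subset).exists_lipschitzOnWith_of_compact hcomp
  have hgI := integrableOn_fderiv_of_lipschitzOn isCompact_annulus hS0 hC (0, 1)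
  have hLI : IntegrableOn (fun p => weight b β γ p * (|v p| ^ 2 + ‖spaceGrad v p‖ ^ 2))
      (annulus n R ×ˢ Icc (0 : ℝ) 1) := by
    refine ContinuousOn.integrableOn_compact hcomp ?_
    have h1 := hv.continuous
    have h2 := (contDiff_spaceGrad hv).continuous
    exact (continuousOn_weight.mono annulus_prod_subset).mul
      (by fun_prop : Continuous fun p => |v p| ^ 2 + ‖spaceGrad v p‖ ^ 2).continuousOn
  rw [← integral_fderiv_time_eq isCompact_annulus hS0 hC]
  have key := integral_mono_ae (hLI.add (hdivI.add hgI))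
    (integrableOn_weight_backwardOp (b := b) (β := β) (γ := γ) hR hcoef hv)
    (by filter_upwards [hpt] with p hp using hp.2.2)
  rwa [integral_add' hLI (hdivI.add hgI), integral_add' hdivI hgI, hdiv0, zero_add] at key

theorem backwardOp_eq_zero {p : SpaceTime n} {O : Set (SpaceTime n)} (hO : IsOpen O)
    (hvO : ∀ q ∈ O, v q = 0) (hp : p ∈ O) : backwardOp a v p = 0 := by
  have hd : ∀ q ∈ O, DifferentiableAt ℝ v q ∧ fderiv ℝ v q = 0 := by
    intro q hq
    have h : v =ᶠ[𝓝 q] fun _ => 0 := by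
      filter_upwards [hO.mem_nhds hq] with z hz using hvO z hz
    exact ⟨h.differentiableAt_iff.2 (differentiableAt_const _), by rw [h.fderiv_eq]; simp⟩
  have h2 : ∀ i : Fin n, (fun q => ∑ j, a q i j * spaceDeriv j v q) =ᶠ[𝓝 p] fun _ => 0 := by
    intro i
    filter_upwards [hO.mem_nhds hp] with q hq
    refine Finset.sum_eq_zero fun j _ => ?_
    rw [spaceDeriv_eq (hd q hq).1, (hd q hq).2]
    simp
  rw [backwardOp, timeDeriv_eq (hd p hp).1, (hd p hp).2]
  simp only [zero_apply, zero_add]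
  refine Finset.sum_eq_zero fun i _ => ?_
  rw [spaceDeriv_eq ((h2 i).differentiableAt_iff.2 (differentiableAt_const _)), (h2 i).fderiv_eq]
  simp

/-- Both space-time integrals of the Carleman inequality live on the annulus. -/
theorem setIntegral_cylinder_eq
    (hvR : ∀ p : SpaceTime n, p.2 ∈ Icc (0 : ℝ) 1 → R ≤ ‖p.1‖ → v p = 0 ∧ spaceGrad v p = 0) :
    ∫ p in cylinder n, weight b β γ p * (|v p| ^ 2 + ‖spaceGrad v p‖ ^ 2)
        = ∫ p in annulus n R ×ˢ Icc (0 : ℝ) 1,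
          weight b β γ p * (|v p| ^ 2 + ‖spaceGrad v p‖ ^ 2) ∧
      ∫ p in cylinder n, weight b β γ p * |backwardOp a v p| ^ 2
        = ∫ p in annulus n R ×ˢ Icc (0 : ℝ) 1, weight b β γ p * |backwardOp a v p| ^ 2 := by
  have hout : ∀ p ∈ cylinder n \ (annulus n R ×ˢ Icc (0 : ℝ) 1), R < ‖p.1‖ := by
    rintro p ⟨hp, hpn⟩
    by_contra! hcon
    exact hpn ⟨mem_annulus.2 ⟨hcon, one_le_norm_of_mem_cylinder hp⟩, hp.2⟩
  constructor
  · refine setIntegral_eq_of_subset_of_forall_sdiff_eq_zero isClosed_cylinder.measurableSet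
      annulus_prod_subset fun p hp => ?_
    obtain ⟨h1, h2⟩ := hvR p hp.1.2 (hout p hp).le
    simp [h1, h2]
  · refine setIntegral_eq_of_subset_of_ae_sdiff_eq_zero
      isClosed_cylinder.measurableSet.nullMeasurableSet annulus_prod_subset ?_
    -- At `t = 0` and `t = 1` the time derivative may see values of `v` outside `[0, 1]`, which are
    -- arbitrary, so `Pv` is shown to vanish only at interior times.
    filter_upwards [ae_imp_of_ae_restrict (ae_mem_interior (n := n) volume_frontier_compl_ball)]
      with p hpi hp
    have hpi' := hpi hp.1
    rw [interior_prod_eq, interior_Icc] at hpi'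
    have hO : IsOpen ({x : EuclideanSpace ℝ (Fin n) | R < ‖x‖} ×ˢ Ioo (0 : ℝ) 1) :=
      (isOpen_lt continuous_const continuous_norm).prod isOpen_Ioo
    rw [backwardOp_eq_zero hO (fun q hq => (hvR q (Ioo_subset_Icc_self hq.2) (le_of_lt hq.1)).1)
      ⟨hout p hp, hpi'.2⟩]
    simp

end IntegralInequality

end ExteriorCarleman

namespace ExteriorCarleman

open scoped RealInnerProductSpace

/-! ### The energy at the initial and final times. -/

section Boundary

variable {n : ℕ} {b β γ Λ lam M E : ℝ} {a : SpaceTime n → Matrix (Fin n) (Fin n) ℝ}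
  {v : SpaceTime n → ℝ}

/-- With `e^s ≥ 1 + s + s²/2` at `s = β/2`, the exponential beats the boundary constants, which grow
linearly in `β`. This makes `c` independent of all parameters. -/
theorem add_mul_exp_neg_le_one {C β : ℝ} (hC : 0 ≤ C) (hβ : 8 * (C + 1) ≤ β) :
    (C + β) * Real.exp (-(β / 2)) ≤ 1 := by
  rw [Real.exp_neg, ← div_eq_mul_inv, div_le_one (Real.exp_pos _)]
  have h := Real.quadratic_le_exp_of_nonneg (x := β / 2) (by linarith)
  nlinarith

theorem timeFactor_one (β : ℝ) : timeFactor β 1 = 0 := by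
  rw [timeFactor]; norm_num

theorem timeFactor_zero_le_one (β : ℝ) : timeFactor β 0 ≤ 1 := by
  rw [timeFactor]
  have : 0 < (2 : ℝ) ^ (-β) := by positivity
  simp
  linarith

theorem norm_rpow_neg_half_le_one {x : EuclideanSpace ℝ (Fin n)} (hx : 1 ≤ ‖x‖) :
    ‖x‖ ^ (-1 / 2 : ℝ) ≤ 1 :=
  Real.rpow_le_one_of_one_le_of_nonpos hx (by norm_num)

/-- Since `f(1) = 0`, `γ` drops out of the weight and the slope is `-b/2`. The remaining `γ` sits in
`α₁`, which enters `-q` with a favourable sign, as does `μ² Ax·x`. -/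
theorem neg_energy_one_le (hb : 0 < b) (hlam : 0 < lam) (hΛ : lam ≤ Λ) (hγ : 0 ≤ γ)
    (hβ : 8 * ((5 * Λ + 2 * Λ * b ^ 2 + b) + 1) ≤ β) (ha : IsCoefficient Λ lam M E a)
    {x : EuclideanSpace ℝ (Fin n)} (hx : 1 ≤ ‖x‖) :
    -energy b β γ a v (x, 1) ≤ ‖x‖ ^ 2 * Real.exp (-(b * ‖x‖ ^ 2 / 2)) *
      (|v (x, 1)| ^ 2 + ‖spaceGrad v (x, 1)‖ ^ 2) := by
  have hΛ0 : 0 < Λ := hlam.trans_le hΛ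
  have hβ0 : 0 ≤ β := le_trans (by positivity) hβ
  have hp : ((x, 1) : SpaceTime n) ∈ cylinder n := ⟨by simpa using hx, by norm_num⟩
  have hμ : radialSlope b β γ ((x, 1) : SpaceTime n) = -(b / 2) := by
    simp [radialSlope, radialConvex, timeFactor_one]; norm_num
  obtain ⟨e, he⟩ : ∃ e, e = Real.exp (phase b β γ ((x, 1) : SpaceTime n)) := ⟨_, rfl⟩
  have he0 : 0 < e := by rw [he]; exact Real.exp_pos _
  have he2 : e ^ 2 = Real.exp (-(b * ‖x‖ ^ 2 / 2)) * Real.exp (-(β / 2)) := by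
    rw [he, ← weight_eq_exp_phase, weight, ← Real.exp_add]
    congr 1
    simp [timeFactor_one]
    ring
  have hr : phaseRate b β γ ((x, 1) : SpaceTime n) ≤ (b * ‖x‖ ^ 2 + β) / 8 := by
    have : 0 ≤ radialConvex₁ β γ ((x, 1) : SpaceTime n) := by
      rw [radialConvex₁]; positivity
    have h2 : 0 ≤ radialConvex₁ β γ ((x, 1) : SpaceTime n) * ‖x‖ ^ 2 := by positivity
    simp only [phaseRate]
    norm_num
    linarith
  have hm := (ha.le_inner hp x).trans' (by positivity : 0 ≤ lam * ‖x‖ ^ 2)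
  have hAU := ha.inner_le hp (conjGrad b β γ v (x, 1))
  have hU : ‖conjGrad b β γ v (x, 1)‖ ≤
      e * (‖spaceGrad v (x, 1)‖ + |v (x, 1)| * (b / 2) * ‖x‖) := by
    rw [conjGrad, ← he, norm_smul, Real.norm_of_nonneg he0.le]
    gcongr
    refine (norm_add_le _ _).trans_eq ?_
    rw [norm_smul, Real.norm_eq_abs, abs_mul, hμ, abs_neg, abs_of_pos (by positivity : 0 < b / 2)]
  have hU2 : ‖conjGrad b β γ v (x, 1)‖ ^ 2 ≤
      e ^ 2 * (2 * ‖spaceGrad v (x, 1)‖ ^ 2 + v (x, 1) ^ 2 * (b ^ 2 / 2) * ‖x‖ ^ 2) := by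
    calc _ ≤ (e * (‖spaceGrad v (x, 1)‖ + |v (x, 1)| * (b / 2) * ‖x‖)) ^ 2 := by gcongr
      _ = e ^ 2 * (2 * ‖spaceGrad v (x, 1)‖ ^ 2 + |v (x, 1)| ^ 2 * (b ^ 2 / 2) * ‖x‖ ^ 2)
          - e ^ 2 * (‖spaceGrad v (x, 1)‖ - |v (x, 1)| * (b / 2) * ‖x‖) ^ 2 := by ring
      _ ≤ _ := by
        rw [sq_abs]
        have : 0 ≤ e ^ 2 * (‖spaceGrad v (x, 1)‖ - |v (x, 1)| * (b / 2) * ‖x‖) ^ 2 := by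
          positivity
        linarith
  have hx2 : 1 ≤ ‖x‖ ^ 2 := one_le_pow₀ hx
  obtain ⟨w, hw⟩ : ∃ w, w = v (x, 1) ^ 2 := ⟨_, rfl⟩
  obtain ⟨g, hg⟩ : ∃ g, g = ‖spaceGrad v (x, 1)‖ ^ 2 := ⟨_, rfl⟩
  have hw0 : 0 ≤ w := by rw [hw]; positivity
  have hg0 : 0 ≤ g := by rw [hg]; positivity
  rw [sq_abs, ← hw, ← hg]
  rw [← hw, ← hg] at hU2
  have h1 : -energy b β γ a v (x, 1) ≤
      Λ * (e ^ 2 * (2 * g + w * (b ^ 2 / 2) * ‖x‖ ^ 2)) + (b * ‖x‖ ^ 2 + β) / 8 * (e ^ 2 * w) := by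
    have h2 : conj b β γ v (x, 1) ^ 2 = e ^ 2 * w := by rw [conj, ← he, mul_pow, hw]
    rw [energy, h2, potential]
    have h3 : 0 ≤ radialSlope b β γ ((x, 1) : SpaceTime n) ^ 2 * ⟪coeffMap a (x, 1) x, x⟫
        * (e ^ 2 * w) := by positivity
    have h4 : phaseRate b β γ ((x, 1) : SpaceTime n) * (e ^ 2 * w) ≤
        (b * ‖x‖ ^ 2 + β) / 8 * (e ^ 2 * w) := by gcongr
    have h5 := hAU.trans (mul_le_mul_of_nonneg_left hU2 hΛ0.le)
    linarith
  have h2 : Λ * (e ^ 2 * (2 * g + w * (b ^ 2 / 2) * ‖x‖ ^ 2))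
      + (b * ‖x‖ ^ 2 + β) / 8 * (e ^ 2 * w)
      ≤ e ^ 2 * (((5 * Λ + 2 * Λ * b ^ 2 + b) + β) * (‖x‖ ^ 2 * (w + g))) := by
    have h3 : 2 * Λ * g ≤ 2 * Λ * g * ‖x‖ ^ 2 := le_mul_of_one_le_right (by positivity) hx2
    have h4 : β / 8 * w ≤ β / 8 * w * ‖x‖ ^ 2 := le_mul_of_one_le_right (by positivity) hx2
    have h5 : Λ * (2 * g + w * (b ^ 2 / 2) * ‖x‖ ^ 2) + (b * ‖x‖ ^ 2 + β) / 8 * w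
        ≤ ((5 * Λ + 2 * Λ * b ^ 2 + b) + β) * (‖x‖ ^ 2 * (w + g)) := by
      have p1 : 0 ≤ Λ * (‖x‖ ^ 2 * w) := by positivity
      have p2 : 0 ≤ Λ * (‖x‖ ^ 2 * g) := by positivity
      have p3 : 0 ≤ Λ * b ^ 2 * (‖x‖ ^ 2 * w) := by positivity
      have p4 : 0 ≤ Λ * b ^ 2 * (‖x‖ ^ 2 * g) := by positivity
      have p5 : 0 ≤ b * (‖x‖ ^ 2 * w) := by positivity
      have p6 : 0 ≤ b * (‖x‖ ^ 2 * g) := by positivity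
      have p7 : 0 ≤ β * (‖x‖ ^ 2 * w) := by positivity
      have p8 : 0 ≤ β * (‖x‖ ^ 2 * g) := by positivity
      linarith
    have := mul_le_mul_of_nonneg_left h5 (sq_nonneg e)
    linarith
  have h3 := add_mul_exp_neg_le_one (by positivity) hβ
  refine h1.trans (h2.trans ?_)
  rw [he2]
  calc _ = Real.exp (-(b * ‖x‖ ^ 2 / 2)) * (‖x‖ ^ 2 * (w + g))
        * (((5 * Λ + 2 * Λ * b ^ 2 + b) + β) * Real.exp (-(β / 2))) := by ring
    _ ≤ Real.exp (-(b * ‖x‖ ^ 2 / 2)) * (‖x‖ ^ 2 * (w + g)) * 1 := by gcongr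
    _ = _ := by ring

/-- The gradient enters the energy with a minus sign and is dropped, so no `∇v(x, 0)` appears. The
potential is at most quadratic in `γ`, through `μ²` and `α₁`, whence `(1 + γ)²`. Of the available
factor `e^{-β}` only `e^{-β/2}` is needed. -/
theorem energy_zero_le (hb : 0 < b) (hlam : 0 < lam) (hΛ : lam ≤ Λ) (hγ : 0 ≤ γ)
    (hβ : 8 * ((5 * Λ + 2 * Λ * b ^ 2 + b) + 1) ≤ β) (ha : IsCoefficient Λ lam M E a)
    {x : EuclideanSpace ℝ (Fin n)} (hx : 1 ≤ ‖x‖) :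
    energy b β γ a v (x, 0) ≤ (1 + γ) ^ 2 * (‖x‖ ^ 2 *
      Real.exp (2 * γ * ‖x‖ ^ (3 / 2 : ℝ) - b * ‖x‖ ^ 2) * |v (x, 0)| ^ 2) := by
  have hΛ0 : 0 < Λ := hlam.trans_le hΛ
  have hβ0 : 0 ≤ β := le_trans (by positivity) hβ
  have hp : ((x, 0) : SpaceTime n) ∈ cylinder n := ⟨by simpa using hx, by norm_num⟩
  have hf0 := timeFactor_nonneg (β := β) (t := 0) hβ0 le_rfl zero_le_one
  have hf1 := timeFactor_zero_le_one β
  have hrp := norm_rpow_neg_half_le_one hx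
  have hα0 : 0 ≤ radialConvex β γ ((x, 0) : SpaceTime n) := by rw [radialConvex]; positivity
  have hα : radialConvex β γ ((x, 0) : SpaceTime n) ≤ 3 / 2 * γ := by
    rw [radialConvex]
    calc _ ≤ 3 / 2 * γ * 1 * 1 := by gcongr
      _ = _ := by ring
  have hα₁ : radialConvex₁ β γ ((x, 0) : SpaceTime n) ≤ 3 / 2 * γ * β := by
    rw [radialConvex₁]
    calc _ ≤ 3 / 2 * γ * (β * (0 + 1) ^ (-β - 1)) * 1 := by gcongr
      _ = _ := by simp
  have hμ : radialSlope b β γ ((x, 0) : SpaceTime n) ^ 2 ≤ 9 / 2 * γ ^ 2 + 2 * b ^ 2 := by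
    have h1 : radialSlope b β γ ((x, 0) : SpaceTime n) = radialConvex β γ ((x, 0) : SpaceTime n) - b := by
      simp [radialSlope]
    have h2 : radialConvex β γ ((x, 0) : SpaceTime n) ^ 2 ≤ (3 / 2 * γ) ^ 2 := by gcongr
    rw [h1]
    linarith [sq_nonneg (radialConvex β γ ((x, 0) : SpaceTime n) + b)]
  obtain ⟨e, he⟩ : ∃ e, e = Real.exp (phase b β γ ((x, 0) : SpaceTime n)) := ⟨_, rfl⟩
  have he2 : e ^ 2 ≤ Real.exp (2 * γ * ‖x‖ ^ (3 / 2 : ℝ) - b * ‖x‖ ^ 2) * Real.exp (-(β / 2)) := by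
    rw [he, ← weight_eq_exp_phase, weight, ← Real.exp_add, Real.exp_le_exp]
    have : 2 * γ * timeFactor β 0 * ‖x‖ ^ (3 / 2 : ℝ) ≤ 2 * γ * 1 * ‖x‖ ^ (3 / 2 : ℝ) := by gcongr
    simp only [zero_add, div_one]
    linarith
  have hm := ha.inner_le hp x
  have hm0 := (ha.le_inner hp x).trans' (by positivity : 0 ≤ lam * ‖x‖ ^ 2)
  have hAU := (ha.le_inner hp (conjGrad b β γ v (x, 0))).trans'
    (by positivity : 0 ≤ lam * ‖conjGrad b β γ v (x, 0)‖ ^ 2)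
  have hq : potential b β γ a (x, 0) ≤
      (1 + γ) ^ 2 * (((5 * Λ + 2 * Λ * b ^ 2 + b) + β) * ‖x‖ ^ 2) := by
    have h1 : radialSlope b β γ ((x, 0) : SpaceTime n) ^ 2 * ⟪coeffMap a (x, 0) x, x⟫ ≤
        (9 / 2 * γ ^ 2 + 2 * b ^ 2) * (Λ * ‖x‖ ^ 2) := by gcongr
    have h2 : radialConvex₁ β γ ((x, 0) : SpaceTime n) * ‖x‖ ^ 2 ≤ 3 / 2 * γ * β * ‖x‖ ^ 2 := by
      gcongr
    have h3 : 0 ≤ b * ‖x‖ ^ 2 + β := by positivity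
    have p1 : 0 ≤ Λ * ‖x‖ ^ 2 := by positivity
    have p2 : 0 ≤ Λ * ‖x‖ ^ 2 * γ := by positivity
    have p3 : 0 ≤ Λ * ‖x‖ ^ 2 * γ ^ 2 := by positivity
    have p4 : 0 ≤ Λ * b ^ 2 * ‖x‖ ^ 2 * γ := by positivity
    have p5 : 0 ≤ Λ * b ^ 2 * ‖x‖ ^ 2 * γ ^ 2 := by positivity
    have p6 : 0 ≤ (1 + γ) ^ 2 * (b * ‖x‖ ^ 2) := by positivity
    have p7 : 0 ≤ β * ‖x‖ ^ 2 * γ ^ 2 := by positivity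
    have p8 : 0 ≤ β * ‖x‖ ^ 2 * γ := by positivity
    have p9 : 0 ≤ β * ‖x‖ ^ 2 := by positivity
    simp only [potential, phaseRate, zero_add, one_pow, mul_one]
    linarith
  have h1 : energy b β γ a v (x, 0) ≤
      (1 + γ) ^ 2 * (((5 * Λ + 2 * Λ * b ^ 2 + b) + β) * ‖x‖ ^ 2) * (e ^ 2 * v (x, 0) ^ 2) := by
    have h2 : conj b β γ v (x, 0) ^ 2 = e ^ 2 * v (x, 0) ^ 2 := by rw [conj, ← he, mul_pow]
    rw [energy, h2]
    have := mul_le_mul_of_nonneg_right hq (by positivity : 0 ≤ e ^ 2 * v (x, 0) ^ 2)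
    linarith
  have h3 := add_mul_exp_neg_le_one (by positivity) hβ
  refine h1.trans ?_
  rw [sq_abs]
  calc _ ≤ (1 + γ) ^ 2 * (((5 * Λ + 2 * Λ * b ^ 2 + b) + β) * ‖x‖ ^ 2)
        * (Real.exp (2 * γ * ‖x‖ ^ (3 / 2 : ℝ) - b * ‖x‖ ^ 2) * Real.exp (-(β / 2))
          * v (x, 0) ^ 2) := by gcongr
    _ = (1 + γ) ^ 2 * (‖x‖ ^ 2 * Real.exp (2 * γ * ‖x‖ ^ (3 / 2 : ℝ) - b * ‖x‖ ^ 2)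
        * v (x, 0) ^ 2) * (((5 * Λ + 2 * Λ * b ^ 2 + b) + β) * Real.exp (-(β / 2))) := by ring
    _ ≤ (1 + γ) ^ 2 * (‖x‖ ^ 2 * Real.exp (2 * γ * ‖x‖ ^ (3 / 2 : ℝ) - b * ‖x‖ ^ 2)
        * v (x, 0) ^ 2) * 1 := by gcongr
    _ = _ := by ring

theorem integral_energy_le (hb : 0 < b) (hlam : 0 < lam) (hΛ : lam ≤ Λ) (hγ : 0 ≤ γ)
    (hβ : 8 * ((5 * Λ + 2 * Λ * b ^ 2 + b) + 1) ≤ β) (ha : IsCoefficient Λ lam M E a)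
    (hv : ContDiff ℝ ∞ v) {R : ℝ}
    (hv1 : ∀ p : SpaceTime n, p.2 ∈ Icc (0 : ℝ) 1 → ‖p.1‖ ≤ 1 → v p = 0 ∧ spaceGrad v p = 0)
    (hvR : ∀ p : SpaceTime n, p.2 ∈ Icc (0 : ℝ) 1 → R ≤ ‖p.1‖ → v p = 0 ∧ spaceGrad v p = 0) :
    -(∫ x in annulus n R, (energy b β γ a v (x, 1) - energy b β γ a v (x, 0))) ≤
      (∫ x : EuclideanSpace ℝ (Fin n), ‖x‖ ^ 2 * Real.exp (-(b * ‖x‖ ^ 2 / 2)) *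
        (|v (x, 1)| ^ 2 + ‖spaceGrad v (x, 1)‖ ^ 2))
      + (1 + γ) ^ 2 * (∫ x : EuclideanSpace ℝ (Fin n),
        ‖x‖ ^ 2 * Real.exp (2 * γ * ‖x‖ ^ (3 / 2 : ℝ) - b * ‖x‖ ^ 2) * |v (x, 0)| ^ 2) := by
  have hout : ∀ x ∉ annulus n R, ∀ t ∈ Icc (0 : ℝ) 1,
      v (x, t) = 0 ∧ spaceGrad v (x, t) = 0 := by
    intro x hx t ht
    rw [mem_annulus, not_and_or, not_le, not_le] at hx
    exact hx.elim (fun h => hvR (x, t) ht h.le) (fun h => hv1 (x, t) ht h.le)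
  have hm0 : (0 : ℝ) ∈ Icc (0 : ℝ) 1 := by norm_num
  have hm1 : (1 : ℝ) ∈ Icc (0 : ℝ) 1 := by norm_num
  have hc1 := hv.continuous
  have hc2 := (contDiff_spaceGrad hv).continuous
  have hI1 : IntegrableOn (fun x : EuclideanSpace ℝ (Fin n) =>
      ‖x‖ ^ 2 * Real.exp (-(b * ‖x‖ ^ 2 / 2)) *
        (|v (x, 1)| ^ 2 + ‖spaceGrad v (x, 1)‖ ^ 2)) (annulus n R) :=
    ContinuousOn.integrableOn_compact isCompact_annulus (by fun_prop)
  have hI0 : IntegrableOn (fun x : EuclideanSpace ℝ (Fin n) => (1 + γ) ^ 2 * (‖x‖ ^ 2 *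
      Real.exp (2 * γ * ‖x‖ ^ (3 / 2 : ℝ) - b * ‖x‖ ^ 2) * |v (x, 0)| ^ 2)) (annulus n R) := by
    have hc3 : Continuous fun x : EuclideanSpace ℝ (Fin n) => ‖x‖ ^ (3 / 2 : ℝ) :=
      continuous_norm.rpow_const fun _ => Or.inr (by norm_num)
    exact ContinuousOn.integrableOn_compact isCompact_annulus (by fun_prop)
  have hIe : ∀ t ∈ Icc (0 : ℝ) 1,
      IntegrableOn (fun x => energy b β γ a v (x, t)) (annulus n R) := by
    intro t ht
    refine ContinuousOn.integrableOn_compact isCompact_annulus ?_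
    exact (locallyLipschitzOn_energy ha hv).continuousOn.comp (by fun_prop)
      fun x hx => ⟨hx.2, ht⟩
  rw [← setIntegral_eq_integral_of_forall_compl_eq_zero (s := annulus n R)
      (f := fun x => ‖x‖ ^ 2 * Real.exp (-(b * ‖x‖ ^ 2 / 2)) *
        (|v (x, 1)| ^ 2 + ‖spaceGrad v (x, 1)‖ ^ 2)) (fun x hx => by
      obtain ⟨h1, h2⟩ := hout x hx 1 hm1
      simp [h1, h2]),
    ← setIntegral_eq_integral_of_forall_compl_eq_zero (s := annulus n R)
      (f := fun x => ‖x‖ ^ 2 * Real.exp (2 * γ * ‖x‖ ^ (3 / 2 : ℝ) - b * ‖x‖ ^ 2) * |v (x, 0)| ^ 2)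
      (fun x hx => by simp [(hout x hx 0 hm0).1]),
    ← integral_const_mul, ← integral_add hI1 hI0, ← integral_neg]
  refine setIntegral_mono_on ((hIe 1 hm1).sub (hIe 0 hm0)).neg (hI1.add hI0)
    isCompact_annulus.isClosed.measurableSet fun x hx => ?_
  have hx1 := (mem_annulus.1 hx).2
  have h1 := neg_energy_one_le (v := v) hb hlam hΛ hγ hβ ha hx1
  have h0 := energy_zero_le (v := v) hb hlam hΛ hγ hβ ha hx1
  linarith

end Boundary

/-! ### Choice of parameters and conclusion. -/

/-- Admissible parameters exist once the oscillation of the coefficients is small. -/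
theorem exists_admissibleParameters (n : ℕ) {Λ lam ε M H : ℝ} (hlam : 0 < lam) (hΛ : lam ≤ Λ)
    (hε : 0 ≤ ε) (hεΛ : 16 * ε * Λ ≤ lam ^ 2) (hM : 0 ≤ M) (hH : 0 ≤ H) (B : ℝ) :
    ∃ k β : ℝ, AdmissibleParameters (1 / (16 * Λ)) Λ lam ε M k H β ∧ (n : ℝ) ≤ k ∧ B ≤ β := by
  have hΛ0 : 0 < Λ := hlam.trans_le hΛ
  set b := 1 / (16 * Λ) with hb
  have hb0 : 0 < b := by positivity
  set c₀ := 4 * b * Λ ^ 2 + M + 2 + 2 * ε ^ 2 with hc₀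
  have hc₀0 : 0 ≤ c₀ := by positivity
  set c₁ := b * ε + 16 * ε * Λ * b ^ 2 + 2 * c₀ * b with hc₁
  have hc₁0 : 0 ≤ c₁ := by positivity
  set c₂ := (2 + M + Λ / 4 + ε / 2) / lam with hc₂
  have hc₂0 : 0 ≤ c₂ := by positivity
  have hc₂l : c₂ * lam = 2 + M + Λ / 4 + ε / 2 := div_mul_cancel₀ _ hlam.ne'
  have hn : (0 : ℝ) ≤ n := Nat.cast_nonneg n
  -- The conditions on `k` do not involve `β`: `c₂` serves the gradient terms, `32 c₁` the
  -- constants, and `n` the trace bound `b tr A ≤ k`. Then `β` may depend on `k` and `H`.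
  obtain ⟨k, hk⟩ : ∃ k, k = 4 + n + c₂ + 32 * c₁ := ⟨_, rfl⟩
  have hk0 : 0 ≤ k := by rw [hk]; positivity
  set c₃ := (2 * c₀ + 8 * k * Λ) / lam with hc₃
  have hc₃0 : 0 ≤ c₃ := by positivity
  have hc₃l : lam * c₃ = 2 * c₀ + 8 * k * Λ := mul_div_cancel₀ _ hlam.ne'
  set c₄ := 3 * (1 / 4 + 8 / 3 * k + 4 / 3 * b * ε
    + 2 * (2 * lam ^ 2 * b ^ 2 + 1 / 4 + 2 * (H * Λ / lam) ^ 2 + ε * b) + 2 * ε) with hc₄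
  have hc₄0 : 0 ≤ c₄ := by positivity
  refine ⟨k, 1 + c₃ + c₄ + (256 * k + 8) + |B|, ⟨hb0, hlam, hΛ, ?_, hε, hεΛ, hM, hH, ?_, ?_, ?_, ?_,
    ?_, ?_, ?_⟩, ?_, ?_⟩
  · rw [hb]; field_simp
  · linarith
  · rw [← hc₂l]; gcongr; linarith
  · rw [← hc₀, ← hc₁]; linarith
  · linarith [abs_nonneg B]
  · rw [← hc₀, ← hc₃l]; gcongr; linarith [abs_nonneg B]
  · rw [← hc₄]; linarith [abs_nonneg B]
  · linarith [abs_nonneg B]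
  · linarith
  · linarith [le_abs_self B]

/-- The Carleman inequality for admissible parameters. -/
theorem carleman_inequality {n : ℕ} {Λ lam M E b k β γ : ℝ} (hE : 0 ≤ E)
    (hpar : AdmissibleParameters b Λ lam (n ^ 2 * E) (n ^ 2 * M) k
      (n * Λ + 3 * Λ + 2 * (n ^ 2 * E)) β) (hkn : (n : ℝ) ≤ k)
    (hβ : 8 * ((5 * Λ + 2 * Λ * b ^ 2 + b) + 1) ≤ β) (hγ : 0 ≤ γ)
    {a : SpaceTime n → Matrix (Fin n) (Fin n) ℝ} (ha : IsCoefficient Λ lam M E a)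
    {v : SpaceTime n → ℝ} (hv : IsTestFunction v) :
    ∫ p in cylinder n, weight b β γ p * (|v p| ^ 2 + ‖spaceGrad v p‖ ^ 2)
      ≤ (∫ p in cylinder n, weight b β γ p * |backwardOp a v p| ^ 2)
        + (∫ x : EuclideanSpace ℝ (Fin n), ‖x‖ ^ 2 * Real.exp (-(b * ‖x‖ ^ 2 / 2)) *
          (|v (x, 1)| ^ 2 + ‖spaceGrad v (x, 1)‖ ^ 2))
        + (1 + γ) ^ 2 * (∫ x : EuclideanSpace ℝ (Fin n),
          ‖x‖ ^ 2 * Real.exp (2 * γ * ‖x‖ ^ (3 / 2 : ℝ) - b * ‖x‖ ^ 2) * |v (x, 0)| ^ 2) := by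
  obtain ⟨hvs, K, hK, hKQ, hv0⟩ := hv
  obtain ⟨B, hB⟩ := hK.exists_bound_of_continuousOn (f := fun p : SpaceTime n => p.1)
    continuousOn_fst
  -- The outer sphere lies strictly outside the support, and `R > 1` makes both boundary spheres
  -- null sets of positive radius.
  set R := max 2 (B + 1) with hRdef
  have hR : 1 < R := lt_of_lt_of_le (by norm_num) (le_max_left 2 (B + 1))
  have hv1 : ∀ p : SpaceTime n, p.2 ∈ Icc (0 : ℝ) 1 → ‖p.1‖ ≤ 1 →
      v p = 0 ∧ spaceGrad v p = 0 :=
    fun p hp hp1 => eq_zero_of_norm_le_one hvs hK hKQ hv0 hp hp1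
  have hvR : ∀ p : SpaceTime n, p.2 ∈ Icc (0 : ℝ) 1 → R ≤ ‖p.1‖ →
      v p = 0 ∧ spaceGrad v p = 0 := fun p hp hpR =>
    eq_zero_of_notMem hK hv0 hp fun hmem => by
      linarith [hB p hmem, le_max_right 2 (B + 1)]
  obtain ⟨e1, e2⟩ := setIntegral_cylinder_eq (b := b) (β := β) (γ := γ) (a := a) hvR
  have h1 := integral_carleman hE hpar hkn hγ ha hvs hR hv1 hvR
  have h2 := integral_energy_le hpar.b_pos hpar.lam_pos hpar.lam_le hγ hβ ha hvs hv1 hvR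
  rw [e1, e2]
  linarith

end ExteriorCarleman

theorem proposition1p6 :
    ∃ c : ℝ, 0 < c ∧
      ∀ (n : ℕ) (Λ lam : ℝ), 0 < lam → lam ≤ Λ →
        ∃ E₀ : ℝ, 0 < E₀ ∧
          ∀ M E : ℝ, 0 < M → 0 < E → E < E₀ →
            ∃ β : ℝ, 1 ≤ β ∧
              ∀ (b : ℝ), b = 1 / (16 * Λ) →
              ∀ a : ExteriorCarleman.SpaceTime n → Matrix (Fin n) (Fin n) ℝ,
                ExteriorCarleman.IsCoefficient Λ lam M E a →
              ∀ v : ExteriorCarleman.SpaceTime n → ℝ, ExteriorCarleman.IsTestFunction v →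
              ∀ γ : ℝ, 0 < γ →
                ∫ p in ExteriorCarleman.cylinder n, ExteriorCarleman.weight b β γ p *
                    (|v p| ^ 2 + ‖ExteriorCarleman.spaceGrad v p‖ ^ 2)
                  ≤ (∫ p in ExteriorCarleman.cylinder n, ExteriorCarleman.weight b β γ p *
                      |ExteriorCarleman.backwardOp a v p| ^ 2)
                    + c * (∫ x : EuclideanSpace ℝ (Fin n),
                        ‖x‖ ^ 2 * Real.exp (-(b * ‖x‖ ^ 2 / 2)) *
                          (|v (x, 1)| ^ 2 + ‖ExteriorCarleman.spaceGrad v (x, 1)‖ ^ 2))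
                    + c * (1 + γ) ^ 2 * (∫ x : EuclideanSpace ℝ (Fin n),
                        ‖x‖ ^ 2 * Real.exp (2 * γ * ‖x‖ ^ (3 / 2 : ℝ) - b * ‖x‖ ^ 2) *
                          |v (x, 0)| ^ 2) := by
  refine ⟨1, one_pos, fun n Λ lam hlam hΛ => ?_⟩
  have hΛ0 : 0 < Λ := hlam.trans_le hΛ
  -- This `E₀` is the condition `16 ε Λ ≤ lam²` for `ε = n²E`; the `+ 1` keeps the denominator
  -- positive when `n = 0`. It does not involve `M`, whose effect is absorbed by `k` and `β`.
  refine ⟨lam ^ 2 / (16 * Λ * (n ^ 2 + 1)), by positivity, fun M E hM hE hE₀ => ?_⟩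
  have hεΛ : 16 * ((n : ℝ) ^ 2 * E) * Λ ≤ lam ^ 2 := by
    rw [lt_div_iff₀ (by positivity)] at hE₀
    have : 0 < 16 * E * Λ := by positivity
    linarith
  obtain ⟨k, β, hpar, hkn, hβ⟩ := ExteriorCarleman.exists_admissibleParameters n
    (M := n ^ 2 * M) (H := n * Λ + 3 * Λ + 2 * (n ^ 2 * E)) hlam hΛ (by positivity) hεΛ
    (by positivity) (by positivity)
    (8 * ((5 * Λ + 2 * Λ * (1 / (16 * Λ)) ^ 2 + 1 / (16 * Λ)) + 1))
  refine ⟨β, hpar.one_le, fun b hb a ha v hv γ hγ => ?_⟩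
  subst hb
  simpa only [one_mul] using ExteriorCarleman.carleman_inequality hE.le hpar hkn hβ hγ.le ha hv
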